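/- **Setting.** Let $N\ge 1$, let $\mathcal I$ be a set of possible values $\iota$ of the privileged information and let $\mathcal Z\subseteq\mathbb R^{n_z}$ be a set of planner states. Each $\iota\in\mathcal I$ determines the data of a linear-quadratic MPC problem: matrices $A,B$; weights $\mathcal L_x\succeq0$, $\mathcal L_u\succ0$, $\mathcal L_N\succ0$; a target pair $(\bar z_d,\bar u_d)$ and a reference $d$; polyhedra $\tilde{\mathcal Z}=\{z: a_i^\top z+b_i\le 0\ \forall i\}$, $\tilde{\mathcal U}=\{u: c_i^\top u+d_i\le 0\ \forall i\}$ and a polyhedral terminal set $\Omega$. For $z\in\mathcal Z$ and $\mathbf u=(u_0,\dots,u_{N-1})\in\mathbb R^{pN}$ let $\hat z_0=z$, $\hat z_{\kappa+1}=A\hat z_\kappa+Bu_\kappa$, and $$J(\mathbf u)=\sum_{\kappa=0}^{N-1}\big(\|\hat z_\kappa-\bar z_d\|^2_{\mathcal L_x}+\|u_\kappa-\bar u_d\|^2_{\mathcal L_u}\big)+\|\hat z_N-\bar z_d\|^2_{\mathcal L_N}.$$ The constraints $\hat z_\kappa\in\tilde{\mathcal Z}$, $u_\kappa\in\tilde{\mathcal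 U}$ ($0\le\kappa<N$), $(\hat z_N,d)\in\Omega$ are affine in $\mathbf u$; write them as $\eta_i^\top\mathbf u+g_i\le0$, $i=1,\dots,\bar c$. Let $\mathbb U$ be the set of $\mathbf u$ that satisfy them, $\mathfrak U$ the set of first elements $u_0$ of sequences in $\mathbb U$, and $\mathbf u^\ast$ the minimizer of $J$ over $\mathbb U$. For $\omega>0$ let $\mathbb U_\omega=\{\mathbf u:\eta_i^\top\mathbf u+g_i+1/\omega\le0\ \forall i\}$, and for $\beta\ge\omega$ consider the barrier function $$\mathcal B(\mathbf u,\lambda)=J(\mathbf u)-\sum_{i=1}^{\bar c}\lambda_i\log\big(1-\beta(\eta_i^\top\mathbf u+g_i+1/\omega)\big)$$ on the set $D_{\omega,\beta}$ of $\mathbf u$ at which all arguments of the logarithms are positive. Let $(\mathbf u^\dagger,\lambda^\dagger)$ be the pair for which $\mathbf u^\dagger$ minimizes $\mathcal B(\cdot,\lambda^\dagger)$ on $D_{\omega,\beta}$ and $\lambda^\dagger\ge0$ maximizes $\mathcal B(\mathbf u^\dagger,\cdot)$ over $\lambda\ge0$. With $\zeta>0$ the REAP flow is $$\dot{\hat{\mathbf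 u}}_\rho=-\zeta\nabla_{\mathbf u}\mathcal B(\hat{\mathbf u}_\rho,\hat\lambda_\rho),\qquad \dot{\hat\lambda}_\rho=\zeta\big(\nabla_\lambda\mathcal B(\hat{\mathbf u}_\rho,\hat\lambda_\rho)+\Psi_\rho\big),$$ where $(\Psi_\rho)_i=-(\nabla_\lambda\mathcal B)_i$ if $\hat\lambda_{\rho,i}=0$ and $(\nabla_\lambda\mathcal B)_i<0$, and $(\Psi_\rho)_i=0$ otherwise; the derivative of $\hat\lambda$ is the right derivative. An initial condition is feasible if $\hat{\mathbf u}_0\in D_{\omega,\beta}$ and $\hat\lambda_0\ge0$. The planner $\pi^{(t)}_{\omega,\beta}(z,\iota)$ is the first element of $\hat{\mathbf u}_t$. **Statement.** Let $\zeta>0$ and $\beta\ge\omega>0$, and assume that for every $z\in\mathcal Z$, $\iota\in\mathcal I$: $\mathbb U_\omega\neq\emptyset$; the vectors $\eta_i$ of the constraints of $\mathbb U_\omega$ active at $\mathbf u^\dagger$ are linearly independent; the initial condition (which may depend on $z,\iota$) is feasible. Then $\mathbf u^\ast$ and $(\mathbf u^\dagger,\lambda^\dagger)$ exist and are unique, the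 flow has exactly one solution on $[0,\infty)$, and for all $z\in\mathcal Z$, $\iota\in\mathcal I$: 1. $(\hat{\mathbf u}_\rho,\hat\lambda_\rho)\to(\mathbf u^\dagger,\lambda^\dagger)$ exponentially as $\rho\to\infty$, and $\hat{\mathbf u}_\rho\in\mathbb U$ for all $\rho\ge0$. 2. The planner is anytime-feasible: $\pi^{(t)}_{\omega,\beta}(z,\iota)\in\mathfrak U$ for every $t\ge0$, and $\pi^{(t)}_{\omega,\beta}(z,\iota)$ converges to the first element $u^\dagger$ of $\mathbf u^\dagger$ as $t\to\infty$. 3. It is asymptotically optimal up to the tightening: if $\mathbf u^\ast\in\mathbb U_\omega$, then $\mathbf u^\dagger=\mathbf u^\ast$; and for every $\varepsilon>0$ there is $\omega_0>0$ such that for all $\beta'\ge\omega'\ge\omega_0$ and every initial condition feasible for $(\omega',\beta')$, the flow for $(\omega',\beta')$ has exactly one solution on $[0,\infty)$ and $\|\pi^{(t)}_{\omega',\beta'}(z,\iota)-u^\ast\|<\varepsilon$ for all sufficiently large $t$, where $u^\ast$ is the first element of $\mathbf u^\ast$. -/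

import Mathlib

open Set Filter Topology
open scoped Matrix

noncomputable section

namespace Reap

/-- Control sequences `𝐮 ∈ ℝ^{pN}`, read as `N` blocks of `p` entries, with the Euclidean norm. -/
abbrev CtrlSeq (N p : ℕ) : Type := EuclideanSpace ℝ (Fin N × Fin p)

/-- Index set of all inequality constraints: state constraints at stages `0, …, N-1`,
input constraints at stages `0, …, N-1`, terminal constraints. -/
abbrev ConIdx (N cx cu cT : ℕ) : Type := (Fin N × Fin cx) ⊕ (Fin N × Fin cu) ⊕ Fin cT

/-- Dual vectors, one entry for each constraint. -/
abbrev Dual (N cx cu cT : ℕ) : Type := EuclideanSpace ℝ (ConIdx N cx cu cT)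

/-- The data of the linear-quadratic MPC problem, apart from the current state. -/
structure MPCProblem (nz p m cx cu cT : ℕ) where
  /-- linear model `z⁺ = A z + B u` -/
  A : Matrix (Fin nz) (Fin nz) ℝ
  B : Matrix (Fin nz) (Fin p) ℝ
  /-- state constraints `aᵢᵀ z + bᵢ ≤ 0` -/
  a : Fin cx → Fin nz → ℝ
  b : Fin cx → ℝ
  /-- input constraints `cᵢᵀ u + dᵢ ≤ 0` -/
  c : Fin cu → Fin p → ℝ
  d : Fin cu → ℝ
  /-- terminal constraints `eᵢᵀ z + fᵢᵀ r + hᵢ ≤ 0` on a pair (state, reference) -/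
  e : Fin cT → Fin nz → ℝ
  f : Fin cT → Fin m → ℝ
  h : Fin cT → ℝ
  /-- the reference and its steady-state configuration -/
  ref : Fin m → ℝ
  zbar : Fin nz → ℝ
  ubar : Fin p → ℝ
  /-- weighting matrices -/
  Lx : Matrix (Fin nz) (Fin nz) ℝ
  Lu : Matrix (Fin p) (Fin p) ℝ
  LN : Matrix (Fin nz) (Fin nz) ℝ
  hLx : Lx.PosSemidef
  hLu : Lu.PosDef
  hLN : LN.PosDef

variable {nz p m cx cu cT N : ℕ}

/-- The tightened state set. -/
def MPCProblem.stateSet (P : MPCProblem nz p m cx cu cT) : Set (Fin nz → ℝ) :=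
  {z | ∀ i, P.a i ⬝ᵥ z + P.b i ≤ 0}

/-- The tightened input set. -/
def MPCProblem.inputSet (P : MPCProblem nz p m cx cu cT) : Set (Fin p → ℝ) :=
  {u | ∀ i, P.c i ⬝ᵥ u + P.d i ≤ 0}

/-- The terminal constraint set, a polyhedron of pairs (state, reference). -/
def MPCProblem.terminalSet (P : MPCProblem nz p m cx cu cT) :
    Set ((Fin nz → ℝ) × (Fin m → ℝ)) :=
  {x | ∀ i, P.e i ⬝ᵥ x.1 + P.f i ⬝ᵥ x.2 + P.h i ≤ 0}

/-- The `k`-th control of a sequence (zero for `k ≥ N`, which is never used). -/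
def ctrl (u : CtrlSeq N p) (k : ℕ) : Fin p → ℝ :=
  if hk : k < N then fun j => u (⟨k, hk⟩, j) else 0

/-- The first control of a sequence, as an element of Euclidean `ℝ^p`. -/
def firstBlock (u : CtrlSeq N p) : EuclideanSpace ℝ (Fin p) :=
  WithLp.toLp 2 (ctrl u 0)

/-- Predicted states `ẑ₀ = z`, `ẑ_{k+1} = A ẑ_k + B u_k`. -/
def MPCProblem.predict (P : MPCProblem nz p m cx cu cT) (z : Fin nz → ℝ) (u : CtrlSeq N p) :
    ℕ → Fin nz → ℝ
  | 0 => z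
  | k + 1 => P.A *ᵥ (P.predict z u k) + P.B *ᵥ (ctrl u k)

/-- The weighted square norm `‖x‖²_L = xᵀ L x`. -/
def wsq {n : ℕ} (L : Matrix (Fin n) (Fin n) ℝ) (x : Fin n → ℝ) : ℝ := x ⬝ᵥ (L *ᵥ x)

/-- The MPC cost. -/
def MPCProblem.cost (P : MPCProblem nz p m cx cu cT) (z : Fin nz → ℝ) (u : CtrlSeq N p) : ℝ :=
  (∑ k ∈ Finset.range N,
    (wsq P.Lx (P.predict z u k - P.zbar) + wsq P.Lu (ctrl u k - P.ubar)))
  + wsq P.LN (P.predict z u N - P.zbar)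

/-- The constraint functions `ηᵢᵀ 𝐮 + gᵢ`, obtained by substituting the predicted states. -/
def MPCProblem.con (P : MPCProblem nz p m cx cu cT) (z : Fin nz → ℝ) :
    ConIdx N cx cu cT → CtrlSeq N p → ℝ
  | .inl (k, i), u => P.a i ⬝ᵥ P.predict z u k + P.b i
  | .inr (.inl (k, i)), u => P.c i ⬝ᵥ ctrl u k + P.d i
  | .inr (.inr i), u => P.e i ⬝ᵥ P.predict z u N + P.f i ⬝ᵥ P.ref + P.h i

/-- The constraint set `𝕌`. -/
def MPCProblem.feasibleSet (P : MPCProblem nz p m cx cu cT) (N : ℕ) (z : Fin nz → ℝ) :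
    Set (CtrlSeq N p) :=
  {u | ∀ i : ConIdx N cx cu cT, P.con z i u ≤ 0}

/-- The set `𝕌` is the set of sequences that satisfy the constraints of the MPC problem. -/
theorem MPCProblem.mem_feasibleSet_iff (P : MPCProblem nz p m cx cu cT) (z : Fin nz → ℝ)
    (u : CtrlSeq N p) :
    u ∈ P.feasibleSet N z ↔
      (∀ k < N, P.predict z u k ∈ P.stateSet ∧ ctrl u k ∈ P.inputSet) ∧
        (P.predict z u N, P.ref) ∈ P.terminalSet := by
  constructor
  · intro hu
    exact ⟨fun k hk => ⟨fun i => hu (.inl (⟨k, hk⟩, i)), fun i => hu (.inr (.inl (⟨k, hk⟩, i)))⟩,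
      fun i => hu (.inr (.inr i))⟩
  · rintro ⟨h1, h2⟩ (⟨k, i⟩ | ⟨k, i⟩ | i)
    · exact (h1 k k.2).1 i
    · exact (h1 k k.2).2 i
    · exact h2 i

/-- The set `𝔘` of first elements of the sequences in `𝕌`. -/
def MPCProblem.firstSet (P : MPCProblem nz p m cx cu cT) (N : ℕ) (z : Fin nz → ℝ) :
    Set (EuclideanSpace ℝ (Fin p)) :=
  firstBlock '' P.feasibleSet N z

/-- The set of sequences with `ηᵢᵀ 𝐮 + gᵢ + 1/ω ≤ 0` for all `i`. -/
def MPCProblem.tightenedSet (P : MPCProblem nz p m cx cu cT) (N : ℕ) (z : Fin nz → ℝ) (ω : ℝ) :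
    Set (CtrlSeq N p) :=
  {u | ∀ i : ConIdx N cx cu cT, P.con z i u + 1 / ω ≤ 0}

/-- `u` solves the MPC problem. -/
def MPCProblem.IsMPCOptimal (P : MPCProblem nz p m cx cu cT) (z : Fin nz → ℝ)
    (u : CtrlSeq N p) : Prop :=
  u ∈ P.feasibleSet N z ∧ ∀ v ∈ P.feasibleSet N z, P.cost z u ≤ P.cost z v

/-- The argument `-β (ηᵢᵀ 𝐮 + gᵢ + 1/ω) + 1` of the logarithm in the barrier function. -/
def MPCProblem.slack (P : MPCProblem nz p m cx cu cT) (z : Fin nz → ℝ) (ω β : ℝ)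
    (i : ConIdx N cx cu cT) (u : CtrlSeq N p) : ℝ :=
  -β * (P.con z i u + 1 / ω) + 1

/-- The set of sequences at which the barrier function is defined. -/
def MPCProblem.barrierDomain (P : MPCProblem nz p m cx cu cT) (N : ℕ) (z : Fin nz → ℝ)
    (ω β : ℝ) : Set (CtrlSeq N p) :=
  {u | ∀ i : ConIdx N cx cu cT, 0 < P.slack z ω β i u}

/-- The barrier function. -/
def MPCProblem.barrier (P : MPCProblem nz p m cx cu cT) (z : Fin nz → ℝ) (ω β : ℝ)
    (u : CtrlSeq N p) (lam : Dual N cx cu cT) : ℝ :=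
  P.cost z u - ∑ i, lam i * Real.log (P.slack z ω β i u)

/-- `w = (𝐮†, λ†)`: the vector `𝐮†` minimizes the barrier function for the dual variables `λ†`,
and `λ† ≥ 0` are optimal dual variables, i.e. they maximize it over `λ ≥ 0` at `𝐮†`. -/
def MPCProblem.IsBarrierOptimal (P : MPCProblem nz p m cx cu cT) (z : Fin nz → ℝ) (ω β : ℝ)
    (w : CtrlSeq N p × Dual N cx cu cT) : Prop :=
  w.1 ∈ P.barrierDomain N z ω β ∧ (∀ i, 0 ≤ w.2 i) ∧
  (∀ v ∈ P.barrierDomain N z ω β, P.barrier z ω β w.1 w.2 ≤ P.barrier z ω β v w.2) ∧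
  (∀ mu : Dual N cx cu cT, (∀ i, 0 ≤ mu i) → P.barrier z ω β w.1 mu ≤ P.barrier z ω β w.1 w.2)

/-- Linear independence constraint qualification at `u`: the gradients `ηᵢ` of the constraints
`ηᵢᵀ 𝐮 + gᵢ + 1/ω ≤ 0` that are active at `u` are linearly independent. -/
def MPCProblem.LICQ (P : MPCProblem nz p m cx cu cT) (z : Fin nz → ℝ) (ω : ℝ)
    (u : CtrlSeq N p) : Prop :=
  LinearIndependent ℝ
    (fun i : {i : ConIdx N cx cu cT // P.con z i u + 1 / ω = 0} =>
      gradient (P.con z i.1) u)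

/-- The projection term: with `G` the gradient of the barrier function in `λ`,
it cancels the `i`-th entry of `G` when `λᵢ` is zero and would decrease, and is zero otherwise. -/
def projTerm (lam G : Dual N cx cu cT) : Dual N cx cu cT :=
  WithLp.toLp 2 (fun i => if 0 < lam i ∨ 0 ≤ G i then 0 else -G i)

/-- A feasible initial condition `(û₀, λ̂₀)`. -/
def MPCProblem.IsFeasibleInit (P : MPCProblem nz p m cx cu cT) (z : Fin nz → ℝ) (ω β : ℝ)
    (x0 : CtrlSeq N p × Dual N cx cu cT) : Prop :=
  x0.1 ∈ P.barrierDomain N z ω β ∧ ∀ i, 0 ≤ x0.2 i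

/-- `w = (û, λ̂)` solves the primal–dual gradient flow on `[0, ∞)` with `w 0 = x0`. The right side
of the second equation is discontinuous where `λ̂` leaves or reaches the boundary of the orthant,
so that the derivative of `λ̂` is its right derivative. -/
structure MPCProblem.IsFlow (P : MPCProblem nz p m cx cu cT) (z : Fin nz → ℝ) (ζ ω β : ℝ)
    (x0 : CtrlSeq N p × Dual N cx cu cT) (w : ℝ → CtrlSeq N p × Dual N cx cu cT) : Prop where
  init : w 0 = x0
  cont : ContinuousOn w (Ici 0)
  mem_domain : ∀ ρ, 0 ≤ ρ → (w ρ).1 ∈ P.barrierDomain N z ω β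
  primal : ∀ ρ, 0 ≤ ρ → HasDerivWithinAt (fun s => (w s).1)
    (-ζ • gradient (fun v => P.barrier z ω β v (w ρ).2) (w ρ).1) (Ici 0) ρ
  dual : ∀ ρ, 0 ≤ ρ → HasDerivWithinAt (fun s => (w s).2)
    (ζ • (gradient (fun mu => P.barrier z ω β (w ρ).1 mu) (w ρ).2
      + projTerm (w ρ).2 (gradient (fun mu => P.barrier z ω β (w ρ).1 mu) (w ρ).2))) (Ici ρ) ρ

/-- The flow from `x0` has exactly one solution on `[0, ∞)`. -/
def MPCProblem.WellPosed (P : MPCProblem nz p m cx cu cT) (z : Fin nz → ℝ) (ζ ω β : ℝ)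
    (x0 : CtrlSeq N p × Dual N cx cu cT) : Prop :=
  (∃ w, P.IsFlow z ζ ω β x0 w) ∧
    ∀ w w', P.IsFlow z ζ ω β x0 w → P.IsFlow z ζ ω β x0 w' → EqOn w w' (Ici 0)

open Classical in
/-- The trajectory of the flow from `x0` (the constant `x0` if there is no solution). -/
def MPCProblem.flow (P : MPCProblem nz p m cx cu cT) (z : Fin nz → ℝ) (ζ ω β : ℝ)
    (x0 : CtrlSeq N p × Dual N cx cu cT) : ℝ → CtrlSeq N p × Dual N cx cu cT :=
  if hw : ∃ w, P.IsFlow z ζ ω β x0 w then hw.choose else fun _ => x0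

/-- The planner that runs the flow for the computation time `t` and returns the first control.
The privileged information `ι` determines the problem data. -/
def planner {Info : Type*} (prob : Info → MPCProblem nz p m cx cu cT) (ζ ω β : ℝ)
    (init : (Fin nz → ℝ) → Info → CtrlSeq N p × Dual N cx cu cT)
    (t : ℝ) (z : Fin nz → ℝ) (ι : Info) : EuclideanSpace ℝ (Fin p) :=
  firstBlock ((prob ι).flow z ζ ω β (init z ι) t).1

/-- A planner `π t z ι` with computation time `t ≥ 0` is anytime-feasible on the states `Z`, for
the sets `U z ι` of admissible controls and the limit `target z ι`. -/
structure IsAnytimeFeasiblePlanner {S Info C : Type*} [TopologicalSpace C] (Z : Set S)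
    (U : S → Info → Set C) (target : S → Info → C) (π : ℝ → S → Info → C) : Prop where
  feasible : ∀ t, 0 ≤ t → ∀ z ∈ Z, ∀ ι, π t z ι ∈ U z ι
  tendsto : ∀ z ∈ Z, ∀ ι, Tendsto (fun t => π t z ι) atTop (𝓝 (target z ι))

end Reap

end

open Reap

/-! For `λ ≥ 0` the barrier function is strongly convex in `𝐮`, and it is affine in `λ`. Its
logarithms vanish exactly where the tightened constraints are active. Its saddle points over `λ ≥ 0`
are therefore the KKT pairs of the problem of minimizing `J` over `𝕌_ω` (`isBarrierOptimal_iff`).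
Such a pair exists by Farkas' lemma; strong convexity makes the primal part unique and linear
independence of the active gradients makes the multipliers unique.

The saddle operator is monotone and the projection preserves this, so the Euclidean distance of two
solutions never increases (`IsSaddleFlow.sqDist_le`). This gives uniqueness. Applied to a solution
and its own time translate, it shows that the speed never increases (`IsSaddleFlow.sqSpeed_le`). The
speed dominates each `-log` term, so the arguments of the logarithms stay above a positive constant:
the trajectory cannot reach the boundary of the barrier domain, and this domain lies in `𝕌` because
`β ≥ ω`.

The same a priori bounds give existence. The logarithm is continued by a tangent near zero and the
multipliers are clamped, so that all nonlinearities except the projection are globally Lipschitz.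
The projection is expressed by the Skorokhod map, which is Lipschitz on paths, and a weighted
contraction solves the resulting Volterra equation. Neither modification is active along the
solution.

The squared distance to the KKT pair dissipates the primal error and the inactive multipliers, but
not the active ones. A small cross term between the primal error and the active dual error recovers
these, since linear independence bounds the combination of active gradients from below
(`IsSaddleFlow.exists_exp_bound`). Primal convergence alone needs no constraint qualification
(`IsSaddleFlow.tendsto_fst`), which matters for the last claim, where none is assumed for the new
parameters. There, moving the optimizer slightly towards a point of `𝕌_ω` gives a competitor in the
less tightened set, and quadratic growth of `J` converts the small excess cost into a small
distance. -/

noncomputable section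

namespace Reap

/-! ### Farkas' lemma -/

/-- Farkas' lemma for finitely many vectors of an inner product space. -/
theorem farkas {E : Type*} [NormedAddCommGroup E] [InnerProductSpace ℝ E] {I : Type*}
    (s : Finset I) : ∀ (a : I → E) (g : E),
      (∀ w, (∀ i ∈ s, inner ℝ (a i) w ≤ 0) → inner ℝ g w ≤ 0) →
      ∃ c : I → ℝ, (∀ i, 0 ≤ c i) ∧ g = ∑ i ∈ s, c i • a i := by
  classical
  -- Both the family and `g` are kept general because the inductive step replaces them by their
  -- corrections along the new vector.
  induction s using Finset.induction_on with
  | empty =>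
    intro a g h
    refine ⟨0, fun _ => le_rfl, ?_⟩
    have := h g (by simp)
    rw [real_inner_self_nonpos] at this
    simpa using this
  | insert k s hk ih =>
    intro a g h
    by_cases h' : ∀ w, (∀ i ∈ s, inner ℝ (a i) w ≤ 0) → inner ℝ g w ≤ 0
    · obtain ⟨c, hc, hg⟩ := ih a g h'
      refine ⟨fun i => if i ∈ s then c i else 0, fun i => ?_, ?_⟩
      · dsimp only
        split_ifs
        exacts [hc i, le_rfl]
      · rw [Finset.sum_insert hk]
        dsimp only
        rw [if_neg hk, zero_smul, zero_add, hg]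
        exact Finset.sum_congr rfl fun i hi => by rw [if_pos hi]
    · push Not at h'
      obtain ⟨w₁, hw₁, hg₁⟩ := h'
      have hk₁ : 0 < inner ℝ (a k) w₁ := by
        by_contra hcon
        refine absurd (h w₁ fun i hi => ?_) (not_le.2 hg₁)
        rcases Finset.mem_insert.1 hi with rfl | hi
        exacts [not_lt.1 hcon, hw₁ i hi]
      obtain ⟨w, hw, hgw, hkw⟩ : ∃ w, (∀ i ∈ s, inner ℝ (a i) w ≤ 0) ∧ 0 < inner ℝ g w ∧
          inner ℝ (a k) w = 1 := by
        refine ⟨(inner ℝ (a k) w₁)⁻¹ • w₁, fun i hi => ?_, ?_, ?_⟩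
        · rw [inner_smul_right]
          exact mul_nonpos_of_nonneg_of_nonpos (inv_nonneg.2 hk₁.le) (hw₁ i hi)
        · rw [inner_smul_right]; positivity
        · rw [inner_smul_right]; field_simp
      -- Subtracting multiples of `a k` makes all vectors orthogonal to `w`. Testing the new system
      -- with `v` is testing the old one with `v - ⟪a k, v⟫ w`, which is orthogonal to `a k`, so
      -- that the constraint of `k` holds with equality.
      obtain ⟨c, hc, hg⟩ := ih (fun i => a i - inner ℝ (a i) w • a k) (g - inner ℝ g w • a k) (by
        intro v hv
        have := h (v - inner ℝ (a k) v • w) (by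
          intro i hi
          rcases Finset.mem_insert.1 hi with rfl | hi
          · rw [inner_sub_right, inner_smul_right, hkw]; simp
          · have := hv i hi
            rw [inner_sub_left, inner_smul_left] at this
            rw [inner_sub_right, inner_smul_right]
            simp only [conj_trivial] at this
            linarith)
        rw [inner_sub_right, inner_smul_right] at this
        rw [inner_sub_left, inner_smul_left]
        simp only [conj_trivial]
        linarith)
      -- The coefficient of `a k` collects the corrections. It is nonnegative because `⟪g, w⟫ > 0`,
      -- while `⟪a j, w⟫ ≤ 0` and `c j ≥ 0` for the others.
      refine ⟨fun i => if i = k then inner ℝ g w - ∑ j ∈ s, c j * inner ℝ (a j) w else c i,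
        fun i => ?_, ?_⟩
      · dsimp only
        split_ifs
        · have : ∑ j ∈ s, c j * inner ℝ (a j) w ≤ 0 :=
            Finset.sum_nonpos fun j hj => mul_nonpos_of_nonneg_of_nonpos (hc j) (hw j hj)
          linarith
        · exact hc i
      · rw [Finset.sum_insert hk]
        dsimp only
        rw [if_pos rfl]
        have e : ∑ i ∈ s, (if i = k then inner ℝ g w - ∑ j ∈ s, c j * inner ℝ (a j) w else c i) • a i
            = ∑ i ∈ s, c i • a i :=
          Finset.sum_congr rfl fun i hi => by rw [if_neg (ne_of_mem_of_not_mem hi hk)]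
        rw [e]
        rw [sub_eq_iff_eq_add] at hg
        refine hg.trans ?_
        simp only [smul_sub, Finset.sum_sub_distrib, smul_smul, sub_smul, Finset.sum_smul]
        abel

/-! ### The one-dimensional Skorokhod reflection -/

/-- The running maximum of the negative part of a path. -/
def regulator (y : ℝ → ℝ) (t : ℝ) : ℝ :=
  sSup ((fun θ => max 0 (-(y (θ * t)))) '' Icc (0 : ℝ) 1)

theorem continuous_regulator {y : ℝ → ℝ} (hy : Continuous y) : Continuous (regulator y) := by
  unfold regulator
  -- Writing past times as `θ * t` with `θ ∈ [0, 1]` keeps the compact index set independent of `t`.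
  refine IsCompact.continuous_sSup (f := fun t θ => max 0 (-(y (θ * t)))) isCompact_Icc ?_
  change Continuous fun p : ℝ × ℝ => max 0 (-(y (p.2 * p.1)))
  fun_prop

theorem le_regulator {y : ℝ → ℝ} (hy : Continuous y) {s t : ℝ} (hs : 0 ≤ s) (hst : s ≤ t) :
    max 0 (-(y s)) ≤ regulator y t := by
  have hbdd : BddAbove ((fun θ => max 0 (-(y (θ * t)))) '' Icc (0 : ℝ) 1) :=
    isCompact_Icc.bddAbove_image (by fun_prop)
  rcases eq_or_lt_of_le (hs.trans hst) with h0 | h0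
  · have : s = t := by linarith
    subst this
    refine le_csSup hbdd ⟨1, by simp, by simp⟩
  · refine le_csSup hbdd ⟨s / t, ⟨by positivity, (div_le_one h0).2 hst⟩, ?_⟩
    dsimp only
    rw [div_mul_cancel₀ _ h0.ne']

theorem regulator_nonneg {y : ℝ → ℝ} (hy : Continuous y) {t : ℝ} (ht : 0 ≤ t) :
    0 ≤ regulator y t :=
  (le_max_left _ _).trans (le_regulator hy le_rfl ht)

theorem neg_le_regulator {y : ℝ → ℝ} (hy : Continuous y) {s t : ℝ} (hs : 0 ≤ s) (hst : s ≤ t) :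
    -(y s) ≤ regulator y t :=
  (le_max_right _ _).trans (le_regulator hy hs hst)

theorem regulator_le {y : ℝ → ℝ} {t c : ℝ} (ht : 0 ≤ t) (hc : 0 ≤ c)
    (h : ∀ s ∈ Icc 0 t, -(y s) ≤ c) : regulator y t ≤ c := by
  refine csSup_le ⟨_, mem_image_of_mem _ (left_mem_Icc.2 zero_le_one)⟩ ?_
  rintro _ ⟨θ, hθ, rfl⟩
  exact max_le hc (h _ ⟨mul_nonneg hθ.1 ht, mul_le_of_le_one_left ht hθ.2⟩)

theorem regulator_mono {y : ℝ → ℝ} (hy : Continuous y) {s t : ℝ} (hs : 0 ≤ s) (hst : s ≤ t) :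
    regulator y s ≤ regulator y t :=
  regulator_le hs (regulator_nonneg hy (hs.trans hst))
    fun _ hr => neg_le_regulator hy hr.1 (hr.2.trans hst)

/-- A running maximum is 1-Lipschitz in the uniform norm. Hence the reflection `y + regulator y` is
2-Lipschitz on paths, although the projected vector field is discontinuous. -/
theorem abs_regulator_sub_le {y y' : ℝ → ℝ} (hy : Continuous y) (hy' : Continuous y') {t D : ℝ}
    (ht : 0 ≤ t) (h : ∀ s ∈ Icc 0 t, |y s - y' s| ≤ D) :
    |regulator y t - regulator y' t| ≤ D := by
  have hD : 0 ≤ D := (abs_nonneg _).trans (h 0 ⟨le_rfl, ht⟩)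
  have key : ∀ {y y' : ℝ → ℝ}, Continuous y' → (∀ s ∈ Icc 0 t, |y s - y' s| ≤ D) →
      regulator y t ≤ regulator y' t + D := by
    intro y y' hy' h
    refine regulator_le ht (add_nonneg (regulator_nonneg hy' ht) hD) fun s hs => ?_
    have h1 := (abs_le.1 (h s hs)).1
    have h2 := neg_le_regulator hy' hs.1 hs.2
    linarith
  rw [abs_le]
  have h1 := key hy' h
  have h2 := key (y := y') (y' := y) hy fun s hs => by rw [abs_sub_comm]; exact h s hs
  constructor <;> linarith

/-- The right derivative of a reflected path. -/
theorem hasDerivWithinAt_reflection {y : ℝ → ℝ} (hy : Continuous y) {t g : ℝ} (ht : 0 ≤ t)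
    (hg : HasDerivWithinAt y g (Ici t) t) :
    HasDerivWithinAt (fun s => y s + regulator y s)
      (if 0 < y t + regulator y t ∨ 0 ≤ g then g else 0) (Ici t) t := by
  have hnn : 0 ≤ y t + regulator y t := by
    have := neg_le_regulator hy ht le_rfl
    linarith
  -- If the reflected path is positive at `t`, then `-y` lies strictly below its running maximum
  -- there, so the regulator is constant just after `t`.
  rcases hnn.lt_or_eq with hpos | hzero
  · rw [if_pos (Or.inl hpos)]
    have hev : ∀ᶠ r in 𝓝[≥] t, -(y r) < regulator y t := by
      have : ∀ᶠ r in 𝓝 t, -(y r) < regulator y t :=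
        (hy.neg.tendsto t).eventually (gt_mem_nhds (by rw [Pi.neg_apply]; linarith))
      exact this.filter_mono nhdsWithin_le_nhds
    obtain ⟨b, hb, hsub⟩ := mem_nhdsGE_iff_exists_Ico_subset.1 hev
    have hconst : (regulator y) =ᶠ[𝓝[≥] t] fun _ => regulator y t := by
      filter_upwards [Ico_mem_nhdsGE hb] with s hs
      refine le_antisymm ?_ (regulator_mono hy ht hs.1)
      refine regulator_le (ht.trans hs.1) (regulator_nonneg hy ht) fun r hr => ?_
      rcases le_total r t with h | h
      · exact neg_le_regulator hy hr.1 h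
      · exact (show -(y r) < regulator y t from hsub ⟨h, hr.2.trans_lt hs.2⟩).le
    have := hg.add ((hasDerivWithinAt_const t (Ici t) (regulator y t)).congr_of_eventuallyEq hconst
      rfl)
    rw [add_zero] at this
    exact this
  -- At contact `-y t` equals the running maximum, which then grows at the rate `max 0 (-g)`: it
  -- follows `-y` if that increases and stays constant otherwise. The sum has slope `g + max 0 (-g)
  -- = max 0 g`.
  · have hk : HasDerivWithinAt (regulator y) (max 0 (-g)) (Ici t) t := by
      rw [hasDerivWithinAt_iff_isLittleO, Asymptotics.isLittleO_iff]
      intro ε hε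
      have h1 := Asymptotics.isLittleO_iff.1 (hasDerivWithinAt_iff_isLittleO.1 hg) hε
      obtain ⟨b, hb, hsub⟩ := mem_nhdsGE_iff_exists_Ico_subset.1 h1
      filter_upwards [Ico_mem_nhdsGE hb] with s hs
      have hyr : ∀ r, t ≤ r → r ≤ s → |y r - y t - (r - t) * g| ≤ ε * (r - t) := by
        intro r h1 h2
        have := hsub (show r ∈ Ico t b from ⟨h1, h2.trans_lt hs.2⟩)
        simp only [mem_ofPred_eq, smul_eq_mul, Real.norm_eq_abs] at this
        rwa [abs_of_nonneg (sub_nonneg.2 h1)] at this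
      have hst : 0 ≤ s - t := sub_nonneg.2 hs.1
      have hup : regulator y s ≤ regulator y t + (s - t) * max 0 (-g) + ε * (s - t) := by
        have h0 : 0 ≤ (s - t) * max 0 (-g) := mul_nonneg hst (le_max_left _ _)
        have h0' : 0 ≤ ε * (s - t) := mul_nonneg hε.le hst
        have h0'' := regulator_nonneg hy ht
        refine regulator_le (ht.trans hs.1) (by linarith) fun r hr => ?_
        rcases le_total r t with h | h
        · have := neg_le_regulator hy hr.1 h
          linarith
        · have h1 := (abs_le.1 (hyr r h hr.2)).1
          have h2 : (r - t) * (-g) ≤ (s - t) * max 0 (-g) :=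
            (mul_le_mul_of_nonneg_left (le_max_right _ _) (sub_nonneg.2 h)).trans
              (mul_le_mul_of_nonneg_right (by linarith [hr.2]) (le_max_left _ _))
          have h3 : ε * (r - t) ≤ ε * (s - t) :=
            mul_le_mul_of_nonneg_left (by linarith [hr.2]) hε.le
          linarith
      have hlo : regulator y t + (s - t) * max 0 (-g) - ε * (s - t) ≤ regulator y s := by
        rcases le_total 0 (-g) with h | h
        · rw [max_eq_right h]
          have h1 := (abs_le.1 (hyr s hs.1 le_rfl)).2
          have h2 := neg_le_regulator hy (ht.trans hs.1) (le_refl s)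
          linarith
        · rw [max_eq_left h]
          have := regulator_mono hy ht hs.1
          have h0' : 0 ≤ ε * (s - t) := mul_nonneg hε.le hst
          linarith
      rw [Real.norm_eq_abs, Real.norm_eq_abs, abs_of_nonneg hst, abs_le, smul_eq_mul]
      constructor <;> linarith
    have := hg.add hk
    refine this.congr_deriv ?_
    rcases le_or_gt 0 g with h | h
    · rw [if_pos (Or.inr h), max_eq_left (by linarith), add_zero]
    · rw [if_neg (by rintro (h' | h') <;> linarith), max_eq_right (by linarith)]
      ring

/-! ### Volterra equations and reflected differential equations -/

/-- Integrating `exp (L s)` gains a factor `1 / L`. This gain makes the Picard operator a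
contraction on the whole half-line at once. -/
theorem norm_integral_le_exp {E : Type*} [NormedAddCommGroup E] [NormedSpace ℝ E]
    {v : ℝ → E} {c L t : ℝ} (hL : 0 < L) (hc : 0 ≤ c)
    (hv : ∀ s, 0 ≤ s → ‖v s‖ ≤ c * Real.exp (L * s)) (ht : 0 ≤ t) :
    ‖∫ s in (0 : ℝ)..t, v s‖ ≤ c / L * Real.exp (L * t) := by
  have h1 : ‖∫ s in (0 : ℝ)..t, v s‖ ≤ ∫ s in (0 : ℝ)..t, c * Real.exp (L * s) := by
    refine intervalIntegral.norm_integral_le_of_norm_le ht ?_ ?_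
    · exact Filter.Eventually.of_forall fun s hs => hv s hs.1.le
    · exact (by fun_prop : Continuous fun s => c * Real.exp (L * s)).intervalIntegrable _ _
  refine h1.trans ?_
  have h2 : ∫ s in (0 : ℝ)..t, c * Real.exp (L * s) =
      c / L * Real.exp (L * t) - c / L * Real.exp (L * 0) := by
    refine intervalIntegral.integral_eq_sub_of_hasDerivAt (f := fun s => c / L * Real.exp (L * s))
      (fun s _ => ?_) ?_
    · have : HasDerivAt (fun s => L * s) L s := by simpa using (hasDerivAt_id s).const_mul L
      refine (this.exp.const_mul (c / L)).congr_deriv ?_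
      field_simp
    · exact (by fun_prop : Continuous fun s => c * Real.exp (L * s)).intervalIntegrable _ _
  rw [h2]
  have : 0 ≤ c / L * Real.exp (L * 0) := by positivity
  linarith

/-- Global existence for Volterra equations `u = u₀ + ∫ N u` whose right side is Lipschitz in
an exponentially weighted norm. -/
theorem exists_volterra_solution {E : Type*} [NormedAddCommGroup E] [NormedSpace ℝ E]
    [CompleteSpace E] (N : (ℝ → E) → ℝ → E) (hcont : ∀ x, Continuous x → Continuous (N x))
    {K L C : ℝ} (hK : 0 ≤ K) (hKL : K < L)
    (hN : ∀ x y d, Continuous x → Continuous y → 0 ≤ d →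
      (∀ s, 0 ≤ s → ‖x s - y s‖ ≤ d * Real.exp (L * s)) →
      ∀ s, 0 ≤ s → ‖N x s - N y s‖ ≤ K * d * Real.exp (L * s))
    (hC : ∀ s, 0 ≤ s → ‖N (fun _ => 0) s‖ ≤ C * Real.exp (L * s)) (u₀ : E) :
    ∃ u : ℝ → E, Continuous u ∧ ∀ t, 0 ≤ t → u t = u₀ + ∫ s in (0 : ℝ)..t, N u s := by
  have hL : 0 < L := hK.trans_lt hKL
  -- The unknown is `f t = exp (-L t) • u t`, a bounded continuous function. Negative times are
  -- frozen with `max t 0`, so that `f` lives on all of `ℝ`.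
  let X (f : BoundedContinuousFunction ℝ E) (t : ℝ) : E := Real.exp (L * max t 0) • f t
  have hX : ∀ f, Continuous (X f) := fun f => by
    have := f.continuous
    fun_prop
  have hXs : ∀ f g : BoundedContinuousFunction ℝ E, ∀ s, 0 ≤ s →
      ‖X f s - X g s‖ ≤ dist f g * Real.exp (L * s) := by
    intro f g s hs
    simp only [X]
    rw [← smul_sub, norm_smul, Real.norm_eq_abs, abs_of_pos (Real.exp_pos _), max_eq_left hs,
      mul_comm, ← dist_eq_norm]
    exact mul_le_mul_of_nonneg_right (BoundedContinuousFunction.dist_coe_le_dist s)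
      (Real.exp_pos _).le
  have hX0 : X 0 = fun _ => 0 := by
    funext s
    simp [X]
  have hC0 : 0 ≤ C := by
    have := (norm_nonneg _).trans (hC 0 le_rfl)
    simpa using this
  have hNX : ∀ f, ∀ s, 0 ≤ s → ‖N (X f) s‖ ≤ (K * dist f 0 + C) * Real.exp (L * s) := by
    intro f s hs
    have h1 := hN (X f) (X 0) (dist f 0) (hX f) (hX 0) dist_nonneg (hXs f 0) s hs
    rw [hX0] at h1
    calc ‖N (X f) s‖ = ‖(N (X f) s - N (fun _ => 0) s) + N (fun _ => 0) s‖ := by simp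
      _ ≤ _ := (norm_add_le _ _).trans (add_le_add h1 (hC s hs))
      _ = _ := by ring
  have hcontI : ∀ f, Continuous fun t => u₀ + ∫ s in (0 : ℝ)..(max t 0), N (X f) s := by
    intro f
    have := intervalIntegral.continuous_primitive
      (fun a b => (hcont _ (hX f)).intervalIntegrable (μ := MeasureTheory.volume) a b) 0
    exact continuous_const.add (this.comp (by fun_prop : Continuous fun t : ℝ => max t 0))
  let T (f : BoundedContinuousFunction ℝ E) : BoundedContinuousFunction ℝ E :=
    BoundedContinuousFunction.ofNormedAddCommGroup
      (fun t => Real.exp (-(L * max t 0)) • (u₀ + ∫ s in (0 : ℝ)..(max t 0), N (X f) s))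
      (by have := hcontI f; fun_prop)
      (‖u₀‖ + (K * dist f 0 + C) / L) (by
        intro t
        have ht : 0 ≤ max t 0 := le_max_right _ _
        have h1 := norm_integral_le_exp hL (by positivity) (hNX f) ht
        rw [norm_smul, Real.norm_eq_abs, abs_of_pos (Real.exp_pos _)]
        have h2 : Real.exp (-(L * max t 0)) ≤ 1 := Real.exp_le_one_iff.2 (by
          have := mul_nonneg hL.le ht
          linarith)
        have h3 : Real.exp (-(L * max t 0)) * Real.exp (L * max t 0) = 1 := by
          rw [← Real.exp_add]; simp
        calc _ ≤ Real.exp (-(L * max t 0)) *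
              (‖u₀‖ + (K * dist f 0 + C) / L * Real.exp (L * max t 0)) :=
              mul_le_mul_of_nonneg_left ((norm_add_le _ _).trans (add_le_add le_rfl h1))
                (Real.exp_pos _).le
          _ = Real.exp (-(L * max t 0)) * ‖u₀‖ + (K * dist f 0 + C) / L *
              (Real.exp (-(L * max t 0)) * Real.exp (L * max t 0)) := by ring
          _ ≤ _ := by
            rw [h3, mul_one]
            have := mul_le_mul_of_nonneg_right h2 (norm_nonneg u₀)
            linarith)
  -- The Lipschitz constant `K` of the right side and the factor `1 / L` from integration give the
  -- ratio `K / L < 1`.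
  have hT : ContractingWith (Real.toNNReal (K / L)) T := by
    refine ⟨?_, LipschitzWith.of_dist_le_mul fun f g => ?_⟩
    · rw [Real.toNNReal_lt_one]
      exact (div_lt_one hL).2 hKL
    · rw [Real.coe_toNNReal _ (by positivity)]
      refine (BoundedContinuousFunction.dist_le (by positivity)).2 fun t => ?_
      have ht : 0 ≤ max t 0 := le_max_right _ _
      have h1 := hN (X f) (X g) (dist f g) (hX f) (hX g) dist_nonneg (hXs f g)
      have h2 := norm_integral_le_exp hL (by positivity) h1 ht
      have h3 : Real.exp (-(L * max t 0)) * Real.exp (L * max t 0) = 1 := by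
        rw [← Real.exp_add]; simp
      rw [intervalIntegral.integral_sub ((hcont _ (hX f)).intervalIntegrable _ _)
        ((hcont _ (hX g)).intervalIntegrable _ _)] at h2
      rw [dist_eq_norm]
      change ‖Real.exp (-(L * max t 0)) • (u₀ + ∫ s in (0 : ℝ)..(max t 0), N (X f) s) -
        Real.exp (-(L * max t 0)) • (u₀ + ∫ s in (0 : ℝ)..(max t 0), N (X g) s)‖ ≤ _
      rw [← smul_sub, add_sub_add_left_eq_sub, norm_smul, Real.norm_eq_abs,
        abs_of_pos (Real.exp_pos _)]
      calc _ ≤ Real.exp (-(L * max t 0)) * (K * dist f g / L * Real.exp (L * max t 0)) :=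
            mul_le_mul_of_nonneg_left h2 (Real.exp_pos _).le
        _ = K / L * dist f g * (Real.exp (-(L * max t 0)) * Real.exp (L * max t 0)) := by ring
        _ = _ := by rw [h3, mul_one]
  let f := hT.fixedPoint
  have hf : T f = f := hT.fixedPoint_isFixedPt
  refine ⟨X f, hX f, fun t ht => ?_⟩
  have h1 : f t = Real.exp (-(L * max t 0)) • (u₀ + ∫ s in (0 : ℝ)..(max t 0), N (X f) s) := by
    conv_lhs => rw [← hf]
    rfl
  simp only [X]
  rw [h1, smul_smul, ← Real.exp_add, add_neg_cancel, Real.exp_zero, one_smul, max_eq_left ht]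

/-- Global existence for a differential equation whose second component is reflected at the
boundary of the nonnegative orthant. -/
theorem exists_reflected_solution {E : Type*} [NormedAddCommGroup E] [NormedSpace ℝ E]
    [CompleteSpace E] {I : Type*} [Fintype I] (F : E → (I → ℝ) → E) (g : E → I → ℝ) {K : ℝ}
    (hK : 0 ≤ K) (hF : ∀ u v l k, ‖F u l - F v k‖ ≤ K * (‖u - v‖ + ‖l - k‖))
    (hg : ∀ u v i, |g u i - g v i| ≤ K * ‖u - v‖) (u₀ : E) (l₀ : I → ℝ) (hl₀ : ∀ i, 0 ≤ l₀ i) :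
    ∃ (u : ℝ → E) (l : ℝ → I → ℝ), Continuous u ∧ Continuous l ∧ u 0 = u₀ ∧ l 0 = l₀ ∧
      (∀ t, 0 ≤ t → ∀ i, 0 ≤ l t i) ∧
      (∀ t, 0 ≤ t → HasDerivWithinAt u (F (u t) (l t)) (Ici 0) t) ∧
      ∀ t, 0 ≤ t → ∀ i, HasDerivWithinAt (fun s => l s i)
        (if 0 < l t i ∨ 0 ≤ g (u t) i then g (u t) i else 0) (Ici t) t := by
  have hgc : ∀ i, Continuous fun u => g u i := fun i =>
    (LipschitzWith.of_dist_le_mul (K := Real.toNNReal K) fun u v => by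
      rw [Real.coe_toNNReal _ hK, Real.dist_eq, dist_eq_norm]
      exact hg u v i).continuous
  have hFc : Continuous fun p : E × (I → ℝ) => F p.1 p.2 :=
    (LipschitzWith.of_dist_le_mul (K := Real.toNNReal (K * 2)) fun p q => by
      rw [Real.coe_toNNReal _ (by positivity), dist_eq_norm, dist_eq_norm]
      have h1 : ‖p.1 - q.1‖ ≤ ‖p - q‖ := norm_fst_le (p - q)
      have h2 : ‖p.2 - q.2‖ ≤ ‖p - q‖ := norm_snd_le (p - q)
      have := mul_le_mul_of_nonneg_left (add_le_add h1 h2) hK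
      refine (hF _ _ _ _).trans (this.trans (le_of_eq (by ring)))).continuous
  -- `Y` is the dual path without projection and `Γ` its Skorokhod reflection. Setting `l = Γ u`
  -- leaves a Volterra equation for `u` alone, whose memory term is Lipschitz.
  let Y (x : ℝ → E) (i : I) (s : ℝ) : ℝ := l₀ i + ∫ r in (0 : ℝ)..s, g (x r) i
  let Γ (x : ℝ → E) (s : ℝ) (i : I) : ℝ := Y x i s + regulator (Y x i) s
  have hYc : ∀ x, Continuous x → ∀ i, Continuous (Y x i) := fun x hx i =>
    continuous_const.add (intervalIntegral.continuous_primitive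
      (fun a b => ((hgc i).comp hx).intervalIntegrable a b) 0)
  have hΓc : ∀ x, Continuous x → Continuous (Γ x) := fun x hx =>
    continuous_pi fun i => (hYc x hx i).add (continuous_regulator (hYc x hx i))
  -- With `K / L ≤ 1 / 2` the factor 2 of the reflection cancels and `Γ` is 1-Lipschitz in the
  -- weighted norm. The right side then has constant `2 * K < L`. Also `L ≥ 1`, so `exp (L s)`
  -- dominates `1 + s`.
  set L : ℝ := 3 * K + 1 with hLdef
  have hL : 0 < L := by positivity
  have hΓd : ∀ x y d, Continuous x → Continuous y → 0 ≤ d →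
      (∀ s, 0 ≤ s → ‖x s - y s‖ ≤ d * Real.exp (L * s)) →
      ∀ s, 0 ≤ s → ‖Γ x s - Γ y s‖ ≤ d * Real.exp (L * s) := by
    intro x y d hx hy hd h s hs
    refine (pi_norm_le_iff_of_nonneg (by positivity)).2 fun i => ?_
    have hY : ∀ r, 0 ≤ r → |Y x i r - Y y i r| ≤ K * d / L * Real.exp (L * r) := by
      intro r hr
      have := norm_integral_le_exp (v := fun r => g (x r) i - g (y r) i) (c := K * d) hL
        (by positivity) (fun s hs => by
          rw [mul_assoc]
          exact (hg _ _ i).trans (mul_le_mul_of_nonneg_left (h s hs) hK)) hr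
      have hxi : Continuous fun r => g (x r) i := (hgc i).comp hx
      have hyi : Continuous fun r => g (y r) i := (hgc i).comp hy
      rw [intervalIntegral.integral_sub (hxi.intervalIntegrable _ _)
        (hyi.intervalIntegrable _ _)] at this
      simpa [Y] using this
    have hY' : ∀ r ∈ Icc 0 s, |Y x i r - Y y i r| ≤ K * d / L * Real.exp (L * s) := fun r hr =>
      (hY r hr.1).trans (mul_le_mul_of_nonneg_left
        (Real.exp_le_exp.2 (mul_le_mul_of_nonneg_left hr.2 hL.le)) (by positivity))
    have h1 := hY' s ⟨hs, le_rfl⟩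
    have h2 := abs_regulator_sub_le (hYc x hx i) (hYc y hy i) hs hY'
    have h3 : K / L ≤ 1 / 2 := by
      rw [div_le_div_iff₀ hL two_pos, hLdef]; linarith
    have h4 : K * d / L * Real.exp (L * s) ≤ 1 / 2 * (d * Real.exp (L * s)) := by
      have := mul_le_mul_of_nonneg_right h3 (by positivity : 0 ≤ d * Real.exp (L * s))
      calc _ = K / L * (d * Real.exp (L * s)) := by ring
        _ ≤ _ := this
    calc ‖(Γ x s - Γ y s) i‖ = |(Y x i s - Y y i s) +
          (regulator (Y x i) s - regulator (Y y i) s)| := by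
            rw [Real.norm_eq_abs, Pi.sub_apply]; congr 1; simp only [Γ]; ring
      _ ≤ _ := abs_add_le _ _
      _ ≤ _ := by linarith
  have hN0 : ∀ s, 0 ≤ s → ‖F ((fun _ : ℝ => (0 : E)) s) (Γ (fun _ => 0) s)‖ ≤
      (‖F 0 0‖ + K * (2 * (‖l₀‖ + ‖g 0‖))) * Real.exp (L * s) := by
    intro s hs
    have hexp : 1 + s ≤ Real.exp (L * s) := by
      have h1 := Real.add_one_le_exp (L * s)
      have : s ≤ L * s := by
        rw [hLdef]
        nlinarith [mul_nonneg hK hs]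
      linarith
    have hY : ∀ i, ∀ r ∈ Icc 0 s, |Y (fun _ => 0) i r| ≤ (‖l₀‖ + ‖g 0‖) * (1 + s) := by
      intro i r hr
      have h1 := norm_le_pi_norm l₀ i
      have h2 := norm_le_pi_norm (g 0) i
      have hr' := hr.1
      simp only [Y, intervalIntegral.integral_const, sub_zero, smul_eq_mul]
      calc _ ≤ |l₀ i| + |r * g 0 i| := abs_add_le _ _
        _ = ‖l₀ i‖ + r * ‖g 0 i‖ := by rw [abs_mul, abs_of_nonneg hr']; rfl
        _ ≤ ‖l₀‖ + s * ‖g 0‖ := add_le_add h1 (mul_le_mul hr.2 h2 (norm_nonneg _) hs)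
        _ ≤ _ := by nlinarith [norm_nonneg l₀, norm_nonneg (g 0), mul_nonneg hs (norm_nonneg l₀)]
    have hΓ0 : ‖Γ (fun _ => 0) s‖ ≤ 2 * ((‖l₀‖ + ‖g 0‖) * (1 + s)) := by
      refine (pi_norm_le_iff_of_nonneg (by positivity)).2 fun i => ?_
      have h1 := hY i s ⟨hs, le_rfl⟩
      have h2 : |regulator (Y (fun _ => 0) i) s| ≤ (‖l₀‖ + ‖g 0‖) * (1 + s) := by
        rw [abs_of_nonneg (regulator_nonneg (hYc _ continuous_const i) hs)]
        exact regulator_le hs (by positivity) fun r hr => (neg_le_abs _).trans (hY i r hr)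
      calc _ ≤ |Y (fun _ => 0) i s| + |regulator (Y (fun _ => 0) i) s| := abs_add_le _ _
        _ ≤ _ := by linarith
    have h3 := hF 0 0 (Γ (fun _ => 0) s) 0
    rw [sub_zero, sub_zero, norm_zero, zero_add] at h3
    have h5 : ‖F 0 0‖ ≤ ‖F 0 0‖ * Real.exp (L * s) := by
      have : 1 ≤ Real.exp (L * s) := by linarith
      nlinarith [norm_nonneg (F 0 0)]
    have h6 : K * ‖Γ (fun _ => 0) s‖ ≤ K * (2 * (‖l₀‖ + ‖g 0‖)) * Real.exp (L * s) := by
      rw [mul_assoc]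
      refine mul_le_mul_of_nonneg_left (hΓ0.trans ?_) hK
      rw [mul_assoc]
      exact mul_le_mul_of_nonneg_left (mul_le_mul_of_nonneg_left hexp (by positivity)) zero_le_two
    calc _ = ‖(F 0 (Γ (fun _ => 0) s) - F 0 0) + F 0 0‖ := by simp
      _ ≤ _ := norm_add_le _ _
      _ ≤ _ := by linarith
  obtain ⟨u, huc, hu⟩ := exists_volterra_solution (fun x s => F (x s) (Γ x s))
    (fun x hx => hFc.comp (hx.prodMk (hΓc x hx))) (K := 2 * K) (L := L) (by positivity)
    (by rw [hLdef]; linarith)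
    (fun x y d hx hy hd h s hs => by
      have h1 := hΓd x y d hx hy hd h s hs
      calc _ ≤ _ := hF _ _ _ _
        _ ≤ K * (d * Real.exp (L * s) + d * Real.exp (L * s)) :=
          mul_le_mul_of_nonneg_left (add_le_add (h s hs) h1) hK
        _ = _ := by ring) hN0 u₀
  have hdY : ∀ i t, HasDerivAt (Y u i) (g (u t) i) t := fun i t =>
    (((hgc i).comp huc).integral_hasStrictDerivAt 0 t).hasDerivAt.const_add _
  refine ⟨u, Γ u, huc, hΓc u huc, ?_, ?_, ?_, ?_, ?_⟩
  · simpa using hu 0 le_rfl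
  · funext i
    -- There is no initial jump, because `l₀` already lies in the orthant.
    have : regulator (Y u i) 0 = 0 := by
      refine le_antisymm (regulator_le le_rfl le_rfl fun s hs => ?_)
        (regulator_nonneg (hYc u huc i) le_rfl)
      have : s = 0 := le_antisymm hs.2 hs.1
      subst this
      simpa [Y] using hl₀ i
    simp [Γ, this, Y]
  · intro t ht i
    have := neg_le_regulator (hYc u huc i) ht le_rfl
    simp only [Γ]
    linarith
  · intro t ht
    have hc : Continuous fun s => F (u s) (Γ u s) := hFc.comp (huc.prodMk (hΓc u huc))
    refine ((hc.integral_hasStrictDerivAt 0 t).hasDerivAt.const_add u₀).hasDerivWithinAt.congr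
      (fun s hs => hu s hs) (hu t ht)
  · intro t ht i
    exact hasDerivWithinAt_reflection (hYc u huc i) ht (hdY i t).hasDerivWithinAt

/-! ### The square distance in a primal-dual space -/

section SqDist

variable {E I : Type*} [NormedAddCommGroup E] [Fintype I]

/-- The square distance in the primal-dual space. -/
def sqDist (u v : E) (l k : I → ℝ) : ℝ := ‖u - v‖ ^ 2 + ∑ i, (l i - k i) ^ 2

theorem sqDist_nonneg (u v : E) (l k : I → ℝ) : 0 ≤ sqDist u v l k := by
  unfold sqDist
  positivity

theorem norm_sq_le_sqDist (u v : E) (l k : I → ℝ) : ‖u - v‖ ^ 2 ≤ sqDist u v l k :=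
  le_add_of_nonneg_right (Finset.sum_nonneg fun _ _ => sq_nonneg _)

theorem sq_le_sqDist (u v : E) (l k : I → ℝ) (i : I) : (l i - k i) ^ 2 ≤ sqDist u v l k :=
  (Finset.single_le_sum (f := fun i => (l i - k i) ^ 2) (fun _ _ => sq_nonneg _)
    (Finset.mem_univ i)).trans (le_add_of_nonneg_left (sq_nonneg _))

theorem continuousOn_sqDist {T : Set ℝ} {u v : ℝ → E} {l k : ℝ → I → ℝ} (hu : ContinuousOn u T)
    (hv : ContinuousOn v T) (hl : ∀ i, ContinuousOn (fun t => l t i) T)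
    (hk : ∀ i, ContinuousOn (fun t => k t i) T) :
    ContinuousOn (fun t => sqDist (u t) (v t) (l t) (k t)) T :=
  ((hu.sub hv).norm.pow 2).add (continuousOn_finsetSum _ fun i _ => ((hl i).sub (hk i)).pow 2)

end SqDist

/-! ### Strongly convex programs with affine constraints -/

/-- A strongly convex smooth objective `J` on `E` with gradient `G`, and affine functions
`sᵢ - ⟪aᵢ, u⟫`. -/
structure ConvexProgram (E I : Type*) [NormedAddCommGroup E] [InnerProductSpace ℝ E] where
  J : E → ℝ
  G : E → E
  m : ℝ
  a : I → E
  s : I → ℝ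
  m_pos : 0 < m
  cont : Continuous J
  strong : ∀ u v, J u + inner ℝ (G u) (v - u) + m * ‖v - u‖ ^ 2 ≤ J v
  lip : ∃ K, 0 ≤ K ∧ ∀ u v, ‖G u - G v‖ ≤ K * ‖u - v‖

namespace ConvexProgram

variable {E I : Type*} [NormedAddCommGroup E] [InnerProductSpace ℝ E] (P : ConvexProgram E I)

/-- The affine constraint functions. -/
def gap (i : I) (u : E) : ℝ := P.s i - inner ℝ (P.a i) u

/-- The polyhedron on which all affine functions are at least one. -/
def feasible : Set E := {u | ∀ i, 1 ≤ P.gap i u}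

theorem gap_sub (i : I) (u v : E) : P.gap i u - P.gap i v = -inner ℝ (P.a i) (u - v) := by
  simp only [gap, inner_sub_right]
  ring

theorem gap_add_smul (i : I) (u w : E) (t : ℝ) :
    P.gap i (u + t • w) = P.gap i u - t * inner ℝ (P.a i) w := by
  simp only [gap, inner_add_right, inner_smul_right]
  ring

theorem continuous_gap (i : I) : Continuous (P.gap i) := by
  unfold gap
  fun_prop

theorem continuous_G : Continuous P.G := by
  obtain ⟨K, hK, h⟩ := P.lip
  exact (LipschitzWith.of_dist_le_mul (K := Real.toNNReal K) fun u v => by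
    rw [Real.coe_toNNReal _ hK, dist_eq_norm, dist_eq_norm]
    exact h u v).continuous

theorem strong_mono (u v : E) : 2 * P.m * ‖u - v‖ ^ 2 ≤ inner ℝ (P.G u - P.G v) (u - v) := by
  have h1 := P.strong u v
  have h2 := P.strong v u
  rw [← neg_sub u v, inner_neg_right, norm_neg] at h1
  rw [inner_sub_left]
  linarith

/-- A minimizer of a strongly convex function on a midpoint-convex set has quadratic growth. -/
theorem quadratic_growth {S : Set E} (hS : Convex ℝ S) {u v : E} (hu : u ∈ S) (hv : v ∈ S)
    (hmin : ∀ w ∈ S, P.J u ≤ P.J w) : P.J u + P.m / 2 * ‖v - u‖ ^ 2 ≤ P.J v := by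
  set p : E := (1 / 2 : ℝ) • u + (1 / 2 : ℝ) • v with hp
  have hpS : p ∈ S := hS hu hv (by norm_num) (by norm_num) (by norm_num)
  have h1 := P.strong p u
  have h2 := P.strong p v
  have e1 : u - p = -((1 / 2 : ℝ) • (v - u)) := by rw [hp]; module
  have e2 : v - p = (1 / 2 : ℝ) • (v - u) := by rw [hp]; module
  rw [e1, inner_neg_right, norm_neg, norm_smul] at h1
  rw [e2, norm_smul] at h2
  norm_num [mul_pow] at h1 h2
  have h3 := hmin p hpS
  linarith

/-- The tangent inequality at the origin bounds `J v` below by a quadratic in `‖v‖` with leading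
coefficient `m > 0`, so `J` is coercive. -/
theorem exists_min [FiniteDimensional ℝ E] {S : Set E} (hS : IsClosed S) (hne : S.Nonempty) :
    ∃ u ∈ S, ∀ v ∈ S, P.J u ≤ P.J v := by
  obtain ⟨u₀, hu₀⟩ := hne
  have hco : Tendsto P.J (cocompact E) atTop := by
    have hn : Tendsto (fun v : E => ‖v‖) (cocompact E) atTop := tendsto_norm_cocompact_atTop
    have hpoly : Tendsto (fun x : ℝ => P.J 0 + x * (P.m * x - ‖P.G 0‖)) atTop atTop := by
      refine tendsto_atTop_add_const_left _ _ ?_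
      refine tendsto_id.atTop_mul_atTop₀ ?_
      simp_rw [sub_eq_add_neg]
      exact tendsto_atTop_add_const_right _ _ (tendsto_id.const_mul_atTop P.m_pos)
    refine tendsto_atTop_mono (fun v => ?_) (hpoly.comp hn)
    have h1 := P.strong 0 v
    rw [sub_zero] at h1
    have h2 := (abs_le.1 (abs_real_inner_le_norm (P.G 0) v)).1
    simp only [Function.comp]
    nlinarith
  have hev : ∀ᶠ v in cocompact E ⊓ 𝓟 S, P.J u₀ ≤ P.J v :=
    (hco.eventually_ge_atTop (P.J u₀)).filter_mono inf_le_left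
  obtain ⟨u, hu, hmin⟩ := P.cont.continuousOn.exists_isMinOn' hS hu₀ hev
  exact ⟨u, hu, fun v hv => hmin hv⟩

theorem isClosed_feasible : IsClosed P.feasible := by
  have : P.feasible = ⋂ i, {u | 1 ≤ P.gap i u} := by
    ext u
    simp [feasible]
  rw [this]
  exact isClosed_iInter fun i => isClosed_le continuous_const (P.continuous_gap i)

variable [Fintype I]

/-- The Karush–Kuhn–Tucker conditions for the minimization of `J` on the feasible set. -/
structure IsKKT (u : E) (l : I → ℝ) : Prop where
  nonneg : ∀ i, 0 ≤ l i
  one_le : ∀ i, 1 ≤ P.gap i u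
  compl : ∀ i, l i * (P.gap i u - 1) = 0
  stat : P.G u + ∑ i, l i • P.a i = 0

variable {P}

/-- Stationarity turns `⟪G u, v - u⟫` into `∑ lᵢ (gapᵢ v - gapᵢ u)`, and complementarity replaces
`gapᵢ u` by one, so this term is nonnegative for feasible `v`. Strong convexity supplies the
quadratic term. -/
theorem IsKKT.min {u : E} {l : I → ℝ} (h : P.IsKKT u l) {v : E} (hv : v ∈ P.feasible) :
    P.J u + P.m * ‖v - u‖ ^ 2 ≤ P.J v := by
  have h1 := P.strong u v
  have h2 : P.G u = -∑ i, l i • P.a i := eq_neg_of_add_eq_zero_left h.stat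
  have h3 : 0 ≤ inner ℝ (P.G u) (v - u) := by
    rw [h2, inner_neg_left, sum_inner, ← Finset.sum_neg_distrib]
    refine Finset.sum_nonneg fun i _ => ?_
    rw [inner_smul_left, conj_trivial, ← mul_neg, ← P.gap_sub i v u]
    have h4 := h.compl i
    have h5 := mul_nonneg (h.nonneg i) (sub_nonneg.2 (hv i))
    linarith
  linarith

theorem IsKKT.fst_unique {u v : E} {l k : I → ℝ} (h : P.IsKKT u l) (h' : P.IsKKT v k) : u = v := by
  have h1 := h.min (v := v) h'.one_le
  have h2 := h'.min (v := u) h.one_le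
  rw [norm_sub_rev] at h2
  have h3 : P.m * ‖v - u‖ ^ 2 ≤ 0 := by linarith
  have h4 : ‖v - u‖ ^ 2 ≤ 0 := by
    by_contra hc
    exact absurd h3 (not_le.2 (mul_pos P.m_pos (not_le.1 hc)))
  have h5 : ‖v - u‖ = 0 := by
    have := sq_nonneg ‖v - u‖
    exact pow_eq_zero_iff two_ne_zero |>.1 (le_antisymm h4 this)
  exact (sub_eq_zero.1 (norm_eq_zero.1 h5)).symm

theorem IsKKT.snd_eq_zero {u : E} {l : I → ℝ} (h : P.IsKKT u l) {i : I} (hi : P.gap i u ≠ 1) :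
    l i = 0 :=
  (mul_eq_zero.1 (h.compl i)).resolve_right (sub_ne_zero.2 hi)

/-- The difference of two multipliers is supported on the active constraints, and by stationarity it
is a linear relation between their normals. -/
theorem IsKKT.snd_unique {u : E} {l k : I → ℝ} (h : P.IsKKT u l) (h' : P.IsKKT u k)
    (hli : LinearIndependent ℝ fun i : {i // P.gap i u = 1} => P.a i.1) : l = k := by
  classical
  have h1 : ∑ i, (l i - k i) • P.a i = 0 := by
    have e1 := h.stat
    have e2 := h'.stat
    simp only [sub_smul, Finset.sum_sub_distrib]
    rw [← sub_eq_zero.2 (e1.trans e2.symm)]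
    abel
  have h2 : ∑ i : {i // P.gap i u = 1}, (l i - k i) • P.a i.1 = 0 := by
    rw [← h1, ← Finset.sum_subtype (Finset.univ.filter fun i => P.gap i u = 1) (by simp)
      (fun i => (l i - k i) • P.a i), Finset.sum_filter_of_ne]
    intro i _ hi
    by_contra hc
    exact hi (by rw [h.snd_eq_zero hc, h'.snd_eq_zero hc, sub_zero, zero_smul])
  funext i
  by_cases hi : P.gap i u = 1
  · exact sub_eq_zero.1 (Fintype.linearIndependent_iff.1 hli (fun i => l i - k i) h2 ⟨i, hi⟩)
  · rw [h.snd_eq_zero hi, h'.snd_eq_zero hi]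

variable (P)

/-- Farkas' lemma is applied to `-G u` and the active normals at the minimizer. No constraint
qualification is needed: for affine constraints, every direction admissible to first order is
feasible for small steps. -/
theorem exists_isKKT [FiniteDimensional ℝ E] (hne : P.feasible.Nonempty) :
    ∃ u l, P.IsKKT u l := by
  classical
  obtain ⟨u, hu, hmin⟩ := P.exists_min P.isClosed_feasible hne
  obtain ⟨c, hc, hg⟩ := farkas (Finset.univ.filter fun i => P.gap i u = 1) P.a (-P.G u) (by
    intro w hw
    rw [inner_neg_left, Left.neg_nonpos_iff]
    have hfeas : ∀ᶠ t in 𝓝[>] (0 : ℝ), u + t • w ∈ P.feasible := by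
      simp only [feasible, mem_ofPred_eq, eventually_all]
      intro i
      by_cases hi : P.gap i u = 1
      · filter_upwards [self_mem_nhdsWithin] with t ht
        rw [gap_add_smul, hi]
        have := mul_nonpos_of_nonneg_of_nonpos (le_of_lt (show 0 < t from ht))
          (hw i (by simp [hi]))
        linarith
      · have h1 : Tendsto (fun t : ℝ => P.gap i (u + t • w)) (𝓝 0) (𝓝 (P.gap i (u + (0 : ℝ) • w))) :=
          ((P.continuous_gap i).comp (by fun_prop : Continuous fun t : ℝ => u + t • w)).tendsto 0
        rw [zero_smul, add_zero] at h1
        have h2 := h1.eventually (lt_mem_nhds (lt_of_le_of_ne (hu i) (Ne.symm hi)))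
        exact (h2.filter_mono nhdsWithin_le_nhds).mono fun t ht => ht.le
    -- The tangent inequality is taken at the displaced point, and then `t → 0` by continuity of
    -- `G`; differentiability of `J` is not required.
    have hpos : ∀ᶠ t in 𝓝[>] (0 : ℝ), 0 ≤ inner ℝ (P.G (u + t • w)) w := by
      filter_upwards [hfeas, self_mem_nhdsWithin] with t ht ht0
      have ht0 : 0 < t := ht0
      have h1 := hmin _ ht
      have h2 := P.strong (u + t • w) u
      rw [show u - (u + t • w) = -(t • w) by abel, inner_neg_right, inner_smul_right] at h2
      have h3 : 0 ≤ P.m * ‖-(t • w)‖ ^ 2 := mul_nonneg P.m_pos.le (sq_nonneg _)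
      by_contra hc
      have := mul_neg_of_pos_of_neg ht0 (not_le.1 hc)
      linarith
    have hlim : Tendsto (fun t : ℝ => inner ℝ (P.G (u + t • w)) w) (𝓝[>] 0)
        (𝓝 (inner ℝ (P.G (u + (0 : ℝ) • w)) w)) := by
      have := P.continuous_G
      exact ((by fun_prop : Continuous fun t : ℝ => inner ℝ (P.G (u + t • w)) w).tendsto 0).mono_left
        nhdsWithin_le_nhds
    rw [zero_smul, add_zero] at hlim
    exact ge_of_tendsto hlim hpos)
  refine ⟨u, fun i => if P.gap i u = 1 then c i else 0, fun i => ?_, hu, fun i => ?_, ?_⟩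
  · split_ifs
    exacts [hc i, le_rfl]
  · split_ifs with h
    · rw [h, sub_self, mul_zero]
    · exact zero_mul _
  · simp only [ite_smul, zero_smul]
    rw [← Finset.sum_filter, ← hg, add_neg_cancel]

/-! ### Projected saddle flows -/

/-- The gradient in `u` of `J u + ∑ lᵢ φ (gapᵢ u)`, where `φ' = dφ`. -/
def field (dφ : ℝ → ℝ) (u : E) (l : I → ℝ) : E :=
  P.G u - ∑ i, (l i * dφ (P.gap i u)) • P.a i

/-- The rate of a nonnegative multiplier `l` with unconstrained rate `c`. -/
def projRate (l c : ℝ) : ℝ := if 0 < l ∨ 0 ≤ c then c else 0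

/-- The projection can only raise a rate, and by `mul_projRate` it has no effect after
multiplication by `l`. For `l, k ≥ 0` this gives `(l - k) * projRate l c ≤ (l - k) * c`: the
projection never hurts a distance estimate. -/
theorem le_projRate (l c : ℝ) : c ≤ projRate l c := by
  unfold projRate
  split_ifs with h
  · exact le_rfl
  · push Not at h
    exact h.2.le

theorem mul_projRate {l c : ℝ} (hl : 0 ≤ l) : l * projRate l c = l * c := by
  unfold projRate
  split_ifs with h
  · rfl
  · push Not at h
    rw [le_antisymm h.1 hl, zero_mul, zero_mul]

theorem projRate_mul {ζ : ℝ} (hζ : 0 < ζ) (l c : ℝ) : projRate l (ζ * c) = ζ * projRate l c := by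
  unfold projRate
  simp only [mul_nonneg_iff_of_pos_left hζ]
  split_ifs <;> simp

theorem abs_projRate_le (l c : ℝ) : |projRate l c| ≤ |c| := by
  unfold projRate
  split_ifs
  · exact le_rfl
  · simp

/-- `φ` lies above its tangents with slope `dφ` on the set `S`. -/
def TangentOn (φ dφ : ℝ → ℝ) (S : Set ℝ) : Prop :=
  ∀ x ∈ S, ∀ y ∈ S, φ x + dφ x * (y - x) ≤ φ y

/-- This is the monotonicity of the saddle operator of a function convex in `u` and affine in `l`.
Weighting the tangent inequalities of `φ` by `l` and `k` leaves only the strong monotonicity of `G`.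
An abstract `φ` covers both the logarithm on the positive reals and its extension to the line. -/
theorem field_monotone {φ dφ : ℝ → ℝ} {S : Set ℝ} (hφ : TangentOn φ dφ S) {u v : E}
    {l k : I → ℝ} (hl : ∀ i, 0 ≤ l i) (hk : ∀ i, 0 ≤ k i) (hu : ∀ i, P.gap i u ∈ S)
    (hv : ∀ i, P.gap i v ∈ S) :
    -inner ℝ (u - v) (P.field dφ u l - P.field dφ v k) +
      ∑ i, (l i - k i) * (φ (P.gap i u) - φ (P.gap i v)) ≤ -(2 * P.m * ‖u - v‖ ^ 2) := by
  have h1 := P.strong_mono u v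
  rw [real_inner_comm] at h1
  have h2 : inner ℝ (u - v) (P.field dφ u l - P.field dφ v k) =
      inner ℝ (u - v) (P.G u - P.G v) + ∑ i, (l i * dφ (P.gap i u) - k i * dφ (P.gap i v)) *
        (P.gap i u - P.gap i v) := by
    have e : P.field dφ u l - P.field dφ v k = (P.G u - P.G v) -
        ∑ i, (l i * dφ (P.gap i u) - k i * dφ (P.gap i v)) • P.a i := by
      simp only [field, sub_smul, Finset.sum_sub_distrib]
      abel
    rw [e, inner_sub_right, inner_sum, sub_eq_add_neg, ← Finset.sum_neg_distrib]
    congr 1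
    refine Finset.sum_congr rfl fun i _ => ?_
    rw [inner_smul_right, gap_sub, real_inner_comm]
    ring
  have h3 : ∑ i, (l i - k i) * (φ (P.gap i u) - φ (P.gap i v)) ≤
      ∑ i, (l i * dφ (P.gap i u) - k i * dφ (P.gap i v)) * (P.gap i u - P.gap i v) := by
    refine Finset.sum_le_sum fun i _ => ?_
    have e1 := mul_le_mul_of_nonneg_left (hφ _ (hu i) _ (hv i)) (hl i)
    have e2 := mul_le_mul_of_nonneg_left (hφ _ (hv i) _ (hu i)) (hk i)
    linarith
  linarith

/-- `(u, l)` solves the projected saddle flow of `J u + ∑ lᵢ φ (gapᵢ u)` on `[0, ∞)`. -/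
structure IsSaddleFlow (φ dφ : ℝ → ℝ) (S : Set ℝ) (ζ : ℝ) (u : ℝ → E) (l : ℝ → I → ℝ) : Prop where
  cont_fst : ContinuousOn u (Ici 0)
  cont_snd : ∀ i, ContinuousOn (fun t => l t i) (Ici 0)
  mem : ∀ t, 0 ≤ t → ∀ i, P.gap i (u t) ∈ S
  nonneg : ∀ t, 0 ≤ t → ∀ i, 0 ≤ l t i
  primal : ∀ t, 0 ≤ t → HasDerivWithinAt u (-ζ • P.field dφ (u t) (l t)) (Ici t) t
  dual : ∀ t, 0 ≤ t → ∀ i, HasDerivWithinAt (fun s => l s i)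
    (ζ * projRate (l t i) (φ (P.gap i (u t)))) (Ici t) t

theorem hasDerivWithinAt_sqDist {T : Set ℝ} {t : ℝ} {u v : ℝ → E} {l k : ℝ → I → ℝ} {u' v' : E}
    {l' k' : I → ℝ} (hu : HasDerivWithinAt u u' T t) (hv : HasDerivWithinAt v v' T t)
    (hl : ∀ i, HasDerivWithinAt (fun t => l t i) (l' i) T t)
    (hk : ∀ i, HasDerivWithinAt (fun t => k t i) (k' i) T t) :
    HasDerivWithinAt (fun t => sqDist (u t) (v t) (l t) (k t))
      (2 * (inner ℝ (u t - v t) (u' - v') + ∑ i, (l t i - k t i) * (l' i - k' i))) T t := by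
  have h1 := (hu.sub hv).norm_sq
  have h2 := HasDerivWithinAt.fun_sum (u := Finset.univ) fun i _ => ((hl i).sub (hk i)).pow 2
  refine (h1.add h2).congr_deriv ?_
  rw [mul_add, Finset.mul_sum]
  congr 1
  refine Finset.sum_congr rfl fun i _ => ?_
  simp
  ring

variable {P} {φ dφ : ℝ → ℝ} {S : Set ℝ} {ζ : ℝ} {u v : ℝ → E} {l k : ℝ → I → ℝ}

/-- The system is autonomous. This is what allows a solution to be compared with its own translates.
-/
theorem IsSaddleFlow.shift (h : P.IsSaddleFlow φ dφ S ζ u l) {τ : ℝ} (hτ : 0 ≤ τ) :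
    P.IsSaddleFlow φ dφ S ζ (fun t => u (t + τ)) (fun t => l (t + τ)) := by
  have hmaps : MapsTo (fun t : ℝ => t + τ) (Ici 0) (Ici 0) := fun t ht =>
    show 0 ≤ t + τ from add_nonneg ht hτ
  have hc : ContinuousOn (fun t : ℝ => t + τ) (Ici 0) := by fun_prop
  have hd : ∀ t : ℝ, HasDerivWithinAt (fun t : ℝ => t + τ) 1 (Ici t) t := fun t =>
    ((hasDerivAt_id t).add_const τ).hasDerivWithinAt
  have hmaps' : ∀ t : ℝ, MapsTo (fun t : ℝ => t + τ) (Ici t) (Ici (t + τ)) := fun t s hs =>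
    (add_le_add_iff_right τ).2 hs
  refine ⟨h.cont_fst.comp hc hmaps, fun i => (h.cont_snd i).comp hc hmaps,
    fun t ht => h.mem _ (add_nonneg ht hτ), fun t ht => h.nonneg _ (add_nonneg ht hτ),
    fun t ht => ?_, fun t ht i => ?_⟩
  · have h1 := h.primal (t + τ) (add_nonneg ht hτ)
    have := HasDerivWithinAt.scomp t h1 (hd t) (hmaps' t)
    rw [one_smul] at this
    exact this
  · have h1 := h.dual (t + τ) (add_nonneg ht hτ) i
    have := HasDerivWithinAt.scomp t h1 (hd t) (hmaps' t)
    rw [one_smul] at this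
    exact this

/-- Monotonicity of the saddle operator makes the flow nonexpansive. Right derivatives suffice for
the comparison, so the jumps of the dual rate do no harm. -/
theorem IsSaddleFlow.sqDist_le (hφ : TangentOn φ dφ S) (hζ : 0 < ζ)
    (h : P.IsSaddleFlow φ dφ S ζ u l) (h' : P.IsSaddleFlow φ dφ S ζ v k) {t : ℝ} (ht : 0 ≤ t) :
    sqDist (u t) (v t) (l t) (k t) ≤ sqDist (u 0) (v 0) (l 0) (k 0) := by
  have hsub : Icc 0 t ⊆ Ici 0 := fun s hs => hs.1
  refine image_le_of_deriv_right_le_deriv_boundary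
    ((continuousOn_sqDist h.cont_fst h'.cont_fst h.cont_snd h'.cont_snd).mono hsub)
    (fun s hs => hasDerivWithinAt_sqDist (h.primal s hs.1) (h'.primal s hs.1) (h.dual s hs.1)
      (h'.dual s hs.1)) (B := fun _ => sqDist (u 0) (v 0) (l 0) (k 0)) (B' := fun _ => 0) le_rfl
    continuousOn_const (fun s _ => hasDerivWithinAt_const _ _ _) (fun s hs => ?_) ⟨ht, le_rfl⟩
  have h1 := P.field_monotone hφ (h.nonneg s hs.1) (h'.nonneg s hs.1) (h.mem s hs.1)
    (h'.mem s hs.1)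
  have h2 : ∑ i, (l s i - k s i) * (projRate (l s i) (φ (P.gap i (u s))) -
      projRate (k s i) (φ (P.gap i (v s)))) ≤
      ∑ i, (l s i - k s i) * (φ (P.gap i (u s)) - φ (P.gap i (v s))) := by
    refine Finset.sum_le_sum fun i _ => ?_
    have e1 := mul_projRate (c := φ (P.gap i (u s))) (h.nonneg s hs.1 i)
    have e2 := mul_projRate (c := φ (P.gap i (v s))) (h'.nonneg s hs.1 i)
    have e3 := mul_le_mul_of_nonneg_left (le_projRate (l s i) (φ (P.gap i (u s))))
      (h'.nonneg s hs.1 i)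
    have e4 := mul_le_mul_of_nonneg_left (le_projRate (k s i) (φ (P.gap i (v s))))
      (h.nonneg s hs.1 i)
    linarith
  have h3 : 0 ≤ 2 * P.m * ‖u s - v s‖ ^ 2 := by
    have := P.m_pos
    positivity
  rw [← smul_sub, inner_smul_right]
  simp_rw [← mul_sub ζ, mul_left_comm _ ζ, ← Finset.mul_sum]
  rw [neg_mul, ← mul_neg, ← mul_add]
  refine mul_nonpos_of_nonneg_of_nonpos zero_le_two
    (mul_nonpos_of_nonneg_of_nonpos hζ.le (by linarith))

theorem IsSaddleFlow.unique (hφ : TangentOn φ dφ S) (hζ : 0 < ζ)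
    (h : P.IsSaddleFlow φ dφ S ζ u l) (h' : P.IsSaddleFlow φ dφ S ζ v k) (h0 : u 0 = v 0)
    (h0' : l 0 = k 0) {t : ℝ} (ht : 0 ≤ t) : u t = v t ∧ l t = k t := by
  have h1 := h.sqDist_le hφ hζ h' ht
  have h2 : sqDist (u 0) (v 0) (l 0) (k 0) = 0 := by simp [sqDist, h0, h0']
  rw [h2] at h1
  constructor
  · have := (norm_sq_le_sqDist (u t) (v t) (l t) (k t)).trans h1
    have := pow_eq_zero_iff two_ne_zero |>.1 (le_antisymm this (sq_nonneg _))
    exact sub_eq_zero.1 (norm_eq_zero.1 this)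
  · funext i
    have := (sq_le_sqDist (u t) (v t) (l t) (k t) i).trans h1
    exact sub_eq_zero.1 (pow_eq_zero_iff two_ne_zero |>.1 (le_antisymm this (sq_nonneg _)))

variable (P) in
/-- The square norm of the velocity of the flow with unit gain. -/
def sqSpeed (φ dφ : ℝ → ℝ) (u : E) (l : I → ℝ) : ℝ :=
  ‖P.field dφ u l‖ ^ 2 + ∑ i, projRate (l i) (φ (P.gap i u)) ^ 2

/-- The speed is a limit of difference quotients, that is, of distances between the solution and its
translates. Bounds on distances thus pass to speeds. -/
theorem IsSaddleFlow.tendsto_sqDist (h : P.IsSaddleFlow φ dφ S ζ u l) {t : ℝ} (ht : 0 ≤ t) :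
    Tendsto (fun s => (s⁻¹) ^ 2 * sqDist (u (s + t)) (u t) (l (s + t)) (l t)) (𝓝[>] 0)
      (𝓝 (ζ ^ 2 * P.sqSpeed φ dφ (u t) (l t))) := by
  have hs := h.shift ht
  have h1 := (hs.primal 0 le_rfl).Ioi_of_Ici
  rw [hasDerivWithinAt_iff_tendsto_slope' self_notMem_Ioi] at h1
  have h2 : ∀ i, _ := fun i => (hs.dual 0 le_rfl i).Ioi_of_Ici
  simp_rw [hasDerivWithinAt_iff_tendsto_slope' self_notMem_Ioi] at h2
  have h3 := (h1.norm.pow 2).add (tendsto_finsetSum Finset.univ fun i _ => (h2 i).pow 2)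
  simp only [zero_add] at h3
  convert h3 using 2 with s
  · simp only [sqDist, slope_def_module, sub_zero, zero_add, norm_smul, mul_pow,
      norm_inv, Real.norm_eq_abs, sq_abs, smul_eq_mul, mul_add, Finset.mul_sum, inv_pow]
  · simp only [sqSpeed, norm_smul, mul_pow, norm_neg, Real.norm_eq_abs, sq_abs, mul_add,
      Finset.mul_sum]

/-- Two translates of a solution do not move apart; dividing by `s ^ 2` and letting `s → 0` shows
that the speed decreases. Differentiating the speed would fail at the jumps of the projection. -/
theorem IsSaddleFlow.sqSpeed_le (hφ : TangentOn φ dφ S) (hζ : 0 < ζ)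
    (h : P.IsSaddleFlow φ dφ S ζ u l) {t : ℝ} (ht : 0 ≤ t) :
    P.sqSpeed φ dφ (u t) (l t) ≤ P.sqSpeed φ dφ (u 0) (l 0) := by
  have h1 := h.tendsto_sqDist ht
  have h2 := h.tendsto_sqDist le_rfl
  have h3 : ζ ^ 2 * P.sqSpeed φ dφ (u t) (l t) ≤ ζ ^ 2 * P.sqSpeed φ dφ (u 0) (l 0) := by
    refine le_of_tendsto_of_tendsto h1 h2 ?_
    filter_upwards [self_mem_nhdsWithin] with s hs
    have := (h.shift (le_of_lt (show 0 < s from hs))).sqDist_le hφ hζ h ht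
    refine mul_le_mul_of_nonneg_left ?_ (sq_nonneg _)
    simp only [add_zero, zero_add] at this ⊢
    rwa [add_comm s t]
  exact le_of_mul_le_mul_left h3 (by positivity)

/-- Along the flow, `φ` stays below the initial speed. -/
theorem IsSaddleFlow.le_sqrt_sqSpeed (hφ : TangentOn φ dφ S) (hζ : 0 < ζ)
    (h : P.IsSaddleFlow φ dφ S ζ u l) {t : ℝ} (ht : 0 ≤ t) (i : I) :
    φ (P.gap i (u t)) ≤ √(P.sqSpeed φ dφ (u 0) (l 0)) := by
  -- Since `φ` is at most the projected rate, only an upper bound results. For `φ = -log` that is a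
  -- lower bound on the gap, as required.
  refine (le_projRate (l t i) _).trans (Real.le_sqrt_of_sq_le ((le_trans ?_
    (h.sqSpeed_le hφ hζ ht))))
  exact (Finset.single_le_sum (f := fun i => projRate (l t i) (φ (P.gap i (u t))) ^ 2)
    (fun _ _ => sq_nonneg _) (Finset.mem_univ i)).trans (le_add_of_nonneg_left (sq_nonneg _))

theorem IsSaddleFlow.norm_field_le (hφ : TangentOn φ dφ S) (hζ : 0 < ζ)
    (h : P.IsSaddleFlow φ dφ S ζ u l) {t : ℝ} (ht : 0 ≤ t) :
    ‖P.field dφ (u t) (l t)‖ ≤ √(P.sqSpeed φ dφ (u 0) (l 0)) := by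
  refine Real.le_sqrt_of_sq_le (le_trans ?_ (h.sqSpeed_le hφ hζ ht))
  exact le_add_of_nonneg_right (Finset.sum_nonneg fun _ _ => sq_nonneg _)

end ConvexProgram

/-! ### The negative logarithm and its linear extension -/

/-- The negative logarithm. -/
def negLog (x : ℝ) : ℝ := -Real.log x

/-- The derivative of the negative logarithm. -/
def negLogDeriv (x : ℝ) : ℝ := -x⁻¹

/-- The negative logarithm on `[δ, ∞)`, extended by its tangent at `δ`. -/
def negLogExt (δ x : ℝ) : ℝ := -Real.log (max x δ) + (max x δ - x) / δ

/-- The derivative of `negLogExt δ`. -/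
def negLogExtDeriv (δ x : ℝ) : ℝ := -(max x δ)⁻¹

theorem negLogExt_of_le {δ x : ℝ} (h : δ ≤ x) : negLogExt δ x = negLog x := by
  rw [negLogExt, max_eq_left h, sub_self, zero_div, add_zero, negLog]

theorem negLogExtDeriv_of_le {δ x : ℝ} (h : δ ≤ x) : negLogExtDeriv δ x = negLogDeriv x := by
  rw [negLogExtDeriv, max_eq_left h, negLogDeriv]

theorem neg_log_add_le {x y : ℝ} (hx : 0 < x) (hy : 0 < y) :
    -Real.log x + -x⁻¹ * (y - x) ≤ -Real.log y := by
  have h := Real.log_le_sub_one_of_pos (div_pos hy hx)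
  rw [Real.log_div hy.ne' hx.ne'] at h
  have : -x⁻¹ * (y - x) = -(y / x - 1) := by field_simp
  rw [this]
  linarith

theorem tangentOn_negLog : ConvexProgram.TangentOn negLog negLogDeriv (Ioi 0) :=
  fun _ hx _ hy => neg_log_add_le hx hy

/-- The extension continues with the slope `-1 / δ`, the steepest on `[δ, ∞)`, so slopes remain
monotone. In the proof `h2` is this comparison of slopes, and `h3` says that the correction at `x`
vanishes on either side of `δ`. -/
theorem tangentOn_negLogExt {δ : ℝ} (hδ : 0 < δ) :
    ConvexProgram.TangentOn (negLogExt δ) (negLogExtDeriv δ) univ := by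
  intro x _ y _
  simp only [negLogExt, negLogExtDeriv]
  set X := max x δ
  set Y := max y δ
  have hXδ : δ ≤ X := le_max_right _ _
  have hX : 0 < X := hδ.trans_le hXδ
  have hY : 0 < Y := hδ.trans_le (le_max_right _ _)
  have h1 := neg_log_add_le hX hY
  have h2 : 0 ≤ (Y - y) * (δ⁻¹ - X⁻¹) :=
    mul_nonneg (sub_nonneg.2 (le_max_left _ _)) (sub_nonneg.2 (inv_anti₀ hδ hXδ))
  have h3 : (X - x) * (X⁻¹ - δ⁻¹) = 0 := by
    rcases le_total x δ with h | h
    · simp only [X, max_eq_right h, sub_self, mul_zero]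
    · simp only [X, max_eq_left h, sub_self, zero_mul]
  have e : -X⁻¹ * (y - x) + (X - x) / δ - (Y - y) / δ = -X⁻¹ * (Y - X) - (Y - y) * (δ⁻¹ - X⁻¹)
      - (X - x) * (X⁻¹ - δ⁻¹) := by
    rw [div_eq_mul_inv, div_eq_mul_inv]
    ring
  linarith

theorem abs_negLogExtDeriv_le {δ : ℝ} (hδ : 0 < δ) (x : ℝ) : |negLogExtDeriv δ x| ≤ δ⁻¹ := by
  have h : δ ≤ max x δ := le_max_right _ _
  rw [negLogExtDeriv, abs_neg, abs_of_pos (inv_pos.2 (hδ.trans_le h))]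
  exact inv_anti₀ hδ h

theorem abs_negLogExt_sub_le {δ : ℝ} (hδ : 0 < δ) (x y : ℝ) :
    |negLogExt δ x - negLogExt δ y| ≤ δ⁻¹ * |x - y| := by
  have key : ∀ x y, negLogExt δ x - negLogExt δ y ≤ δ⁻¹ * |x - y| := fun x y => by
    have h1 := tangentOn_negLogExt hδ x (mem_univ _) y (mem_univ _)
    have h2 := neg_abs_le (negLogExtDeriv δ x * (y - x))
    rw [abs_mul, abs_sub_comm y x] at h2
    have h3 := mul_le_mul_of_nonneg_right (abs_negLogExtDeriv_le hδ x) (abs_nonneg (x - y))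
    linarith
  rw [abs_le]
  have h1 := key x y
  have h2 := key y x
  rw [abs_sub_comm] at h2
  constructor <;> linarith

theorem abs_negLogExtDeriv_sub_le {δ : ℝ} (hδ : 0 < δ) (x y : ℝ) :
    |negLogExtDeriv δ x - negLogExtDeriv δ y| ≤ (δ⁻¹) ^ 2 * |x - y| := by
  simp only [negLogExtDeriv]
  have hXδ : δ ≤ max x δ := le_max_right _ _
  have hYδ : δ ≤ max y δ := le_max_right _ _
  have hX : 0 < max x δ := hδ.trans_le hXδ
  have hY : 0 < max y δ := hδ.trans_le hYδ
  have e : -(max x δ)⁻¹ - -(max y δ)⁻¹ = (max x δ)⁻¹ * (max y δ)⁻¹ * (max x δ - max y δ) := by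
    field_simp
    ring
  rw [e, abs_mul, abs_mul, abs_of_pos (inv_pos.2 hX), abs_of_pos (inv_pos.2 hY), sq]
  exact mul_le_mul (mul_le_mul (inv_anti₀ hδ hXδ) (inv_anti₀ hδ hYδ) (inv_pos.2 hY).le
    (inv_pos.2 hδ).le) (abs_max_sub_max_le_abs _ _ _) (abs_nonneg _) (by positivity)

theorem abs_negLog_le {δ x : ℝ} (hδ : 0 < δ) (hδ1 : δ ≤ 1) (hx : δ ≤ x) :
    |negLog x| ≤ δ⁻¹ * |x - 1| := by
  have h := abs_negLogExt_sub_le hδ x 1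
  rw [negLogExt_of_le hx, negLogExt_of_le hδ1] at h
  simpa [negLog] using h

theorem exists_pos_forall_le {I : Type*} [Finite I] {p : I → Prop} {f : I → ℝ}
    (h : ∀ i, p i → 0 < f i) : ∃ c, 0 < c ∧ c ≤ 1 ∧ ∀ i, p i → c ≤ f i := by
  have h1 : ∀ᶠ c in 𝓝[>] (0 : ℝ), ∀ i, p i → c ≤ f i := by
    rw [eventually_all]
    intro i
    by_cases hi : p i
    · filter_upwards [Ioc_mem_nhdsGT (h i hi)] with c hc _ using hc.2
    · exact Eventually.of_forall fun c hc => absurd hc hi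
  obtain ⟨c, hc, hc'⟩ := (h1.and (Ioc_mem_nhdsGT one_pos)).exists
  exact ⟨c, hc'.1, hc'.2, hc⟩

namespace ConvexProgram

variable {E I : Type*} [NormedAddCommGroup E] [InnerProductSpace ℝ E] {P : ConvexProgram E I}
  [Fintype I]

/-! ### Equilibria -/

/-- The left side is the dissipation of half the squared distance to a KKT pair. The primal field
vanishes there because `dφ 1 = -1` at active constraints and `k` is zero at the others. The dual
rates of inactive constraints do not vanish; their negative contribution is kept, since it later
controls the inactive multipliers. -/
theorem IsKKT.le_zero {φ dφ : ℝ → ℝ} {S : Set ℝ} (hφ : TangentOn φ dφ S)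
    (hφ0 : ∀ x, 1 ≤ x → φ x = negLog x) (hdφ0 : ∀ x, 1 ≤ x → dφ x = negLogDeriv x)
    (hS : Ici 1 ⊆ S) {v : E} {k : I → ℝ} (hv : P.IsKKT v k) {u : E} {l : I → ℝ}
    (hl : ∀ i, 0 ≤ l i) (hu : ∀ i, P.gap i u ∈ S) :
    -inner ℝ (u - v) (P.field dφ u l) + ∑ i, (l i - k i) * projRate (l i) (φ (P.gap i u)) ≤
      -(2 * P.m * ‖u - v‖ ^ 2) + ∑ i, l i * negLog (P.gap i v) := by
  have h0 : P.field dφ v k = 0 := by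
    rw [field, ← hv.stat, sub_eq_add_neg, ← Finset.sum_neg_distrib]
    congr 1
    refine Finset.sum_congr rfl fun i _ => ?_
    rw [← neg_smul]
    congr 1
    by_cases h : P.gap i v = 1
    · rw [hdφ0 _ h.ge, h]; simp [negLogDeriv]
    · rw [hv.snd_eq_zero h]; simp
  have h1 := P.field_monotone hφ hl hv.nonneg hu fun i => hS (hv.one_le i)
  rw [h0, sub_zero] at h1
  have h2 : ∑ i, (l i - k i) * projRate (l i) (φ (P.gap i u)) ≤
      ∑ i, (l i - k i) * (φ (P.gap i u) - φ (P.gap i v)) + ∑ i, l i * negLog (P.gap i v) := by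
    rw [← Finset.sum_add_distrib]
    refine Finset.sum_le_sum fun i _ => ?_
    have e1 := mul_projRate (c := φ (P.gap i u)) (hl i)
    have e2 := mul_le_mul_of_nonneg_left (le_projRate (l i) (φ (P.gap i u))) (hv.nonneg i)
    have e3 : k i * negLog (P.gap i v) = 0 := by
      by_cases h : P.gap i v = 1
      · rw [h]; simp [negLog]
      · rw [hv.snd_eq_zero h, zero_mul]
    rw [hφ0 _ (hv.one_le i)]
    linarith
  linarith

theorem IsKKT.sum_mul_negLog_nonpos {v : E} {k : I → ℝ} (hv : P.IsKKT v k) {l : I → ℝ}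
    (hl : ∀ i, 0 ≤ l i) : ∑ i, l i * negLog (P.gap i v) ≤ 0 :=
  Finset.sum_nonpos fun i _ => mul_nonpos_of_nonneg_of_nonpos (hl i)
    (neg_nonpos.2 (Real.log_nonneg (hv.one_le i)))

/-! ### Existence of the flow -/

theorem field_congr {dφ dφ' : ℝ → ℝ} {u : E} (h : ∀ i, dφ (P.gap i u) = dφ' (P.gap i u))
    (l : I → ℝ) : P.field dφ u l = P.field dφ' u l := by
  simp only [field, h]

/-- The products `lᵢ * dφ` are only locally Lipschitz even for the extended logarithm, so the
multipliers are clamped at `M`. The distance to the KKT pair bounds the multipliers along the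
solution, so the clamp never acts. -/
theorem exists_saddleFlow_negLogExt [CompleteSpace E] {v : E} {k : I → ℝ} (hv : P.IsKKT v k)
    {δ ζ : ℝ} (hδ : 0 < δ) (hδ1 : δ ≤ 1) (hζ : 0 < ζ) (u₀ : E) {l₀ : I → ℝ}
    (hl₀ : ∀ i, 0 ≤ l₀ i) :
    ∃ (u : ℝ → E) (l : ℝ → I → ℝ), u 0 = u₀ ∧ l 0 = l₀ ∧
      P.IsSaddleFlow (negLogExt δ) (negLogExtDeriv δ) univ ζ u l ∧
      ∀ t, 0 ≤ t →
        HasDerivWithinAt u (-ζ • P.field (negLogExtDeriv δ) (u t) (l t)) (Ici 0) t := by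
  obtain ⟨KG, hKG, hlip⟩ := P.lip
  -- The extra one leaves room for the growing comparison function used below.
  set R : ℝ := sqDist u₀ v l₀ k + 1 with hR
  set M : ℝ := √R + ∑ i, k i with hM
  have hksum : 0 ≤ ∑ i, k i := Finset.sum_nonneg fun i _ => hv.nonneg i
  have hM0 : 0 ≤ M := add_nonneg (Real.sqrt_nonneg _) hksum
  have hMle : ∀ (u : E) (l : I → ℝ), sqDist u v l k ≤ R → ∀ i, l i ≤ M := by
    intro u l h i
    have h1 := (Real.abs_le_sqrt ((sq_le_sqDist u v l k i).trans h))
    have h2 : k i ≤ ∑ i, k i := Finset.single_le_sum (fun i _ => hv.nonneg i) (Finset.mem_univ i)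
    have h3 := le_abs_self (l i - k i)
    rw [hM]
    linarith
  let cl (x : ℝ) : ℝ := max 0 (min x M)
  have hcl0 : ∀ x, 0 ≤ cl x := fun x => le_max_left _ _
  have hclM : ∀ x, cl x ≤ M := fun x => max_le hM0 (min_le_right _ _)
  have hcl : ∀ x, 0 ≤ x → x ≤ M → cl x = x := fun x h0 h1 => by
    simp only [cl, min_eq_left h1, max_eq_right h0]
  have hcld : ∀ x y, |cl x - cl y| ≤ |x - y| := fun x y => by
    simp only [cl, max_comm (0 : ℝ)]
    exact (abs_max_sub_max_le_abs _ _ _).trans ((abs_min_sub_min_le_max _ _ _ _).trans (by simp))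
  set K : ℝ := ζ * (KG + ∑ i, (M * ((δ⁻¹) ^ 2 * ‖P.a i‖)) * ‖P.a i‖ + ∑ i, δ⁻¹ * ‖P.a i‖) with hKdef
  have hS1 : 0 ≤ ∑ i, (M * ((δ⁻¹) ^ 2 * ‖P.a i‖)) * ‖P.a i‖ :=
    Finset.sum_nonneg fun i _ => by positivity
  have hS2 : 0 ≤ ∑ i, δ⁻¹ * ‖P.a i‖ := Finset.sum_nonneg fun i _ => by positivity
  have hK : 0 ≤ K := by positivity
  have hgap : ∀ i u w, |P.gap i u - P.gap i w| ≤ ‖P.a i‖ * ‖u - w‖ := fun i u w => by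
    rw [gap_sub, abs_neg]
    exact abs_real_inner_le_norm _ _
  obtain ⟨u, l, huc, hlc, hu0, hl0, hnn, hdu, hdl⟩ := exists_reflected_solution
    (fun u l => -ζ • P.field (negLogExtDeriv δ) u (fun i => cl (l i)))
    (fun u i => ζ * negLogExt δ (P.gap i u)) hK (fun u w l j => by
      rw [← smul_sub, norm_smul, norm_neg, Real.norm_eq_abs, abs_of_pos hζ, hKdef, mul_assoc]
      refine mul_le_mul_of_nonneg_left ?_ hζ.le
      have e : P.field (negLogExtDeriv δ) u (fun i => cl (l i)) -
          P.field (negLogExtDeriv δ) w (fun i => cl (j i)) = (P.G u - P.G w) -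
          ∑ i, (cl (l i) * negLogExtDeriv δ (P.gap i u) -
            cl (j i) * negLogExtDeriv δ (P.gap i w)) • P.a i := by
        simp only [field, sub_smul, Finset.sum_sub_distrib]
        abel
      rw [e]
      have hterm : ∀ i, ‖(cl (l i) * negLogExtDeriv δ (P.gap i u) -
            cl (j i) * negLogExtDeriv δ (P.gap i w)) • P.a i‖ ≤
          (M * ((δ⁻¹) ^ 2 * ‖P.a i‖)) * ‖P.a i‖ * ‖u - w‖ + δ⁻¹ * ‖P.a i‖ * ‖l - j‖ := by
        intro i
        rw [norm_smul, Real.norm_eq_abs]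
        have e1 : cl (l i) * negLogExtDeriv δ (P.gap i u) - cl (j i) * negLogExtDeriv δ (P.gap i w)
            = cl (l i) * (negLogExtDeriv δ (P.gap i u) - negLogExtDeriv δ (P.gap i w)) +
              (cl (l i) - cl (j i)) * negLogExtDeriv δ (P.gap i w) := by ring
        have e2 : |cl (l i) * negLogExtDeriv δ (P.gap i u) -
            cl (j i) * negLogExtDeriv δ (P.gap i w)| ≤
            M * ((δ⁻¹) ^ 2 * (‖P.a i‖ * ‖u - w‖)) + ‖l - j‖ * δ⁻¹ := by
          rw [e1]
          refine (abs_add_le _ _).trans (add_le_add ?_ ?_)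
          · rw [abs_mul, abs_of_nonneg (hcl0 _)]
            refine mul_le_mul (hclM _) ((abs_negLogExtDeriv_sub_le hδ _ _).trans ?_)
              (abs_nonneg _) hM0
            exact mul_le_mul_of_nonneg_left (hgap i u w) (by positivity)
          · rw [abs_mul]
            exact mul_le_mul ((hcld _ _).trans (norm_le_pi_norm (l - j) i))
              (abs_negLogExtDeriv_le hδ _) (abs_nonneg _) (norm_nonneg _)
        calc _ ≤ _ := mul_le_mul_of_nonneg_right e2 (norm_nonneg _)
          _ = _ := by ring
      have hsum := (norm_sum_le Finset.univ fun i => (cl (l i) * negLogExtDeriv δ (P.gap i u) -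
        cl (j i) * negLogExtDeriv δ (P.gap i w)) • P.a i).trans
        (Finset.sum_le_sum fun i _ => hterm i)
      rw [Finset.sum_add_distrib, ← Finset.sum_mul, ← Finset.sum_mul] at hsum
      have h3 := hlip u w
      have h4 : 0 ≤ KG * ‖l - j‖ := by positivity
      have h5 : 0 ≤ (∑ i, (M * ((δ⁻¹) ^ 2 * ‖P.a i‖)) * ‖P.a i‖) * ‖l - j‖ := by positivity
      have h6 : 0 ≤ (∑ i, δ⁻¹ * ‖P.a i‖) * ‖u - w‖ := by positivity
      refine (norm_sub_le _ _).trans ?_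
      linarith) (fun u w i => by
      rw [← mul_sub, abs_mul, abs_of_pos hζ, hKdef, mul_assoc]
      refine mul_le_mul_of_nonneg_left ?_ hζ.le
      calc _ ≤ δ⁻¹ * (‖P.a i‖ * ‖u - w‖) := (abs_negLogExt_sub_le hδ _ _).trans
            (mul_le_mul_of_nonneg_left (hgap i u w) (by positivity))
        _ = δ⁻¹ * ‖P.a i‖ * ‖u - w‖ := by ring
        _ ≤ (∑ i, δ⁻¹ * ‖P.a i‖) * ‖u - w‖ := mul_le_mul_of_nonneg_right
            (Finset.single_le_sum (f := fun i => δ⁻¹ * ‖P.a i‖) (fun i _ => by positivity)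
              (Finset.mem_univ i)) (norm_nonneg _)
        _ ≤ _ := mul_le_mul_of_nonneg_right (by linarith) (norm_nonneg _)) u₀ l₀ hl₀
  have hdl' : ∀ t, 0 ≤ t → ∀ i, HasDerivWithinAt (fun s => l s i)
      (ζ * projRate (l t i) (negLogExt δ (P.gap i (u t)))) (Ici t) t := fun t ht i => by
    rw [← projRate_mul hζ]
    exact hdl t ht i
  have hlM : ∀ t, 0 ≤ t → ∀ i, l t i ≤ M := by
    intro T hT
    refine hMle (u T) (l T) ?_
    have hlci : ∀ i, Continuous fun t => l t i := fun i => (continuous_apply i).comp hlc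
    have hbound := image_le_of_deriv_right_lt_deriv_boundary'
      (f := fun t => sqDist (u t) v (l t) k) (a := 0) (b := T)
      (continuousOn_sqDist (v := fun _ => v) (k := fun _ => k) huc.continuousOn
        continuousOn_const (fun i => (hlci i).continuousOn)
        fun i => continuousOn_const)
      (fun t ht => hasDerivWithinAt_sqDist (v := fun _ => v) (k := fun _ => k)
        ((hdu t ht.1).mono (Ici_subset_Ici.2 ht.1))
        (hasDerivWithinAt_const _ _ _) (hdl' t ht.1) fun i => hasDerivWithinAt_const _ _ _)
      -- The comparison function has positive slope, so the derivative needs an estimate only at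
      -- contact times. There the distance is at most `R` and the clamp is inactive, which avoids
      -- circularity.
      (B := fun t => sqDist u₀ v l₀ k + t / (T + 1)) (B' := fun _ => 1 / (T + 1))
      (by simp [hu0, hl0]) (by fun_prop)
      (fun t _ => (((hasDerivAt_id t).div_const (T + 1)).const_add _).hasDerivWithinAt)
      (fun t ht heq => by
        have hle : sqDist (u t) v (l t) k ≤ R := by
          rw [heq, hR]
          have : t / (T + 1) ≤ 1 := by
            rw [div_le_one (by positivity)]
            linarith [ht.2]
          linarith
        have hfield : (fun i => cl (l t i)) = l t := funext fun i =>
          hcl _ (hnn t ht.1 i) (hMle _ _ hle i)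
        have h1 := hv.le_zero (tangentOn_negLogExt hδ) (fun x hx => negLogExt_of_le (hδ1.trans hx))
          (fun x hx => negLogExtDeriv_of_le (hδ1.trans hx)) (subset_univ _) (u := u t)
          (hnn t ht.1) fun i => mem_univ _
        have h2 := hv.sum_mul_negLog_nonpos (hnn t ht.1)
        have h3 : 0 ≤ 2 * P.m * ‖u t - v‖ ^ 2 := by
          have := P.m_pos
          positivity
        have h4 : 0 < 1 / (T + 1) := by positivity
        refine lt_of_le_of_lt ?_ h4
        rw [hfield]
        simp only [sub_zero, inner_smul_right, mul_left_comm _ ζ, ← Finset.mul_sum]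
        rw [neg_mul, ← mul_neg, ← mul_add]
        exact mul_nonpos_of_nonneg_of_nonpos zero_le_two
          (mul_nonpos_of_nonneg_of_nonpos hζ.le (by linarith)))
    have := hbound (x := T) ⟨hT, le_rfl⟩
    have h2 : T / (T + 1) ≤ 1 := by
      rw [div_le_one (by positivity)]
      linarith
    linarith
  have hdu' : ∀ t, 0 ≤ t →
      HasDerivWithinAt u (-ζ • P.field (negLogExtDeriv δ) (u t) (l t)) (Ici 0) t := by
    intro t ht
    have hfield : (fun i => cl (l t i)) = l t := funext fun i =>
      hcl _ (hnn t ht i) (hlM t ht i)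
    have := hdu t ht
    rwa [hfield] at this
  exact ⟨u, l, hu0, hl0, ⟨huc.continuousOn, fun i => ((continuous_apply i).comp hlc).continuousOn,
    fun _ _ _ => mem_univ _, hnn, fun t ht => (hdu' t ht).mono (Ici_subset_Ici.2 ht), hdl'⟩, hdu'⟩

variable (P) in
/-- The projected saddle flow of the logarithmic barrier function. -/
abbrev IsLogFlow (ζ : ℝ) (u : ℝ → E) (l : ℝ → I → ℝ) : Prop :=
  P.IsSaddleFlow negLog negLogDeriv (Ioi 0) ζ u l

/-- The extended flow is run with `δ` so small that its speed bound forbids gaps below `δ`; it then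
solves the original equation. The initial speed does not depend on `δ`, because the extension agrees
with the logarithm at the initial point. -/
theorem exists_logFlow [CompleteSpace E] {v : E} {k : I → ℝ} (hv : P.IsKKT v k)
    {ζ : ℝ} (hζ : 0 < ζ) {u₀ : E} {l₀ : I → ℝ} (hu₀ : ∀ i, 0 < P.gap i u₀)
    (hl₀ : ∀ i, 0 ≤ l₀ i) :
    ∃ (u : ℝ → E) (l : ℝ → I → ℝ), u 0 = u₀ ∧ l 0 = l₀ ∧ P.IsLogFlow ζ u l ∧
      ∀ t, 0 ≤ t → HasDerivWithinAt u (-ζ • P.field negLogDeriv (u t) (l t)) (Ici 0) t := by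
  obtain ⟨c, hc, hc1, hcle⟩ := exists_pos_forall_le (p := fun _ : I => True) fun i _ => hu₀ i
  set C : ℝ := √(P.sqSpeed negLog negLogDeriv u₀ l₀)
  -- The first entry makes the initial speeds agree. The second makes the extended `-log` at least
  -- `C + 1` below `δ`, above its a priori bound `C`.
  set δ : ℝ := min c (Real.exp (-(C + 1))) with hδdef
  have hδ : 0 < δ := lt_min hc (Real.exp_pos _)
  have hδc : δ ≤ c := min_le_left _ _
  obtain ⟨u, l, hu0, hl0, hflow, hdu⟩ := exists_saddleFlow_negLogExt hv hδ (hδc.trans hc1) hζ u₀ hl₀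
  have hspeed : P.sqSpeed (negLogExt δ) (negLogExtDeriv δ) (u 0) (l 0) =
      P.sqSpeed negLog negLogDeriv u₀ l₀ := by
    have h1 : ∀ i, δ ≤ P.gap i u₀ := fun i => hδc.trans (hcle i trivial)
    rw [hu0, hl0, sqSpeed, sqSpeed, field_congr fun i => negLogExtDeriv_of_le (h1 i)]
    simp only [negLogExt_of_le (h1 _)]
  have hgap : ∀ t, 0 ≤ t → ∀ i, δ ≤ P.gap i (u t) := by
    intro t ht i
    by_contra hlt
    have hlt := not_le.1 hlt
    have h1 := hflow.le_sqrt_sqSpeed (tangentOn_negLogExt hδ) hζ ht i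
    rw [hspeed] at h1
    have h2 : C + 1 ≤ negLogExt δ (P.gap i (u t)) := by
      rw [negLogExt, max_eq_right hlt.le]
      have h3 : Real.log δ ≤ -(C + 1) := by
        rw [← Real.log_exp (-(C + 1))]
        exact Real.log_le_log hδ (min_le_right _ _)
      have h4 : 0 ≤ (δ - P.gap i (u t)) / δ := div_nonneg (by linarith) hδ.le
      linarith
    linarith
  have hfield : ∀ t, 0 ≤ t → P.field (negLogExtDeriv δ) (u t) (l t) =
      P.field negLogDeriv (u t) (l t) := fun t ht =>
    field_congr (fun i => negLogExtDeriv_of_le (hgap t ht i)) _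
  refine ⟨u, l, hu0, hl0, ⟨hflow.cont_fst, hflow.cont_snd, fun t ht i => hδ.trans_le (hgap t ht i),
    hflow.nonneg, fun t ht => ?_, fun t ht i => ?_⟩, fun t ht => ?_⟩
  · rw [← hfield t ht]
    exact hflow.primal t ht
  · rw [← negLogExt_of_le (hgap t ht i)]
    exact hflow.dual t ht i
  · rw [← hfield t ht]
    exact hdu t ht

/-! ### Convergence of the flow -/

variable {ζ : ℝ} {u : ℝ → E} {l : ℝ → I → ℝ} {v : E} {k : I → ℝ}

theorem IsSaddleFlow.hasDerivWithinAt_sqDist_kkt (h : P.IsLogFlow ζ u l) {t : ℝ} (ht : 0 ≤ t) :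
    HasDerivWithinAt (fun t => sqDist (u t) v (l t) k)
      (2 * ζ * (-inner ℝ (u t - v) (P.field negLogDeriv (u t) (l t)) +
        ∑ i, (l t i - k i) * projRate (l t i) (negLog (P.gap i (u t))))) (Ici t) t := by
  refine (hasDerivWithinAt_sqDist (v := fun _ => v) (k := fun _ => k) (h.primal t ht)
    (hasDerivWithinAt_const _ _ _) (h.dual t ht)
    fun i => hasDerivWithinAt_const _ _ _).congr_deriv ?_
  simp only [sub_zero, inner_smul_right, mul_left_comm _ ζ, ← Finset.mul_sum]
  ring

theorem IsKKT.log_le_zero (hv : P.IsKKT v k) {u : E} {l : I → ℝ} (hl : ∀ i, 0 ≤ l i)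
    (hu : ∀ i, 0 < P.gap i u) :
    -inner ℝ (u - v) (P.field negLogDeriv u l) +
        ∑ i, (l i - k i) * projRate (l i) (negLog (P.gap i u)) ≤
      -(2 * P.m * ‖u - v‖ ^ 2) + ∑ i, l i * negLog (P.gap i v) :=
  hv.le_zero tangentOn_negLog (fun _ _ => rfl) (fun _ _ => rfl)
    (fun _ hx => lt_of_lt_of_le zero_lt_one (mem_Ici.1 hx)) hl hu

/-- With `r = 0` this is the monotonicity of the Lyapunov function; with `r > 0` it gives a definite
loss while the primal variable stays away from the minimizer. -/
theorem IsSaddleFlow.sqDist_kkt_le (h : P.IsLogFlow ζ u l) (hζ : 0 < ζ) (hv : P.IsKKT v k)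
    {r t t' : ℝ} (ht : 0 ≤ t) (htt : t ≤ t') (hr : 0 ≤ r) (hur : ∀ s ∈ Ico t t', r ≤ ‖u s - v‖) :
    sqDist (u t') v (l t') k ≤ sqDist (u t) v (l t) k - 4 * ζ * P.m * r ^ 2 * (t' - t) := by
  have hsub : Icc t t' ⊆ Ici 0 := fun s hs => ht.trans hs.1
  refine image_le_of_deriv_right_le_deriv_boundary (f := fun t => sqDist (u t) v (l t) k)
    (B := fun s => sqDist (u t) v (l t) k - 4 * ζ * P.m * r ^ 2 * (s - t))
    (B' := fun _ => -(4 * ζ * P.m * r ^ 2))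
    ((continuousOn_sqDist (v := fun _ => v) (k := fun _ => k) h.cont_fst continuousOn_const h.cont_snd
      fun _ => continuousOn_const).mono hsub)
    (fun s hs => h.hasDerivWithinAt_sqDist_kkt (ht.trans hs.1)) (by simp)
    (by fun_prop : Continuous _).continuousOn (fun s _ => ?_) (fun s hs => ?_) (right_mem_Icc.2 htt)
  · refine ((((hasDerivAt_id s).sub_const t).const_mul _).const_sub _).hasDerivWithinAt.congr_deriv ?_
    ring
  · have hs0 := ht.trans hs.1
    have h1 := hv.log_le_zero (h.nonneg s hs0) (h.mem s hs0)
    have h2 := hv.sum_mul_negLog_nonpos (h.nonneg s hs0)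
    have h3 : P.m * r ^ 2 ≤ P.m * ‖u s - v‖ ^ 2 :=
      mul_le_mul_of_nonneg_left (pow_le_pow_left₀ hr (hur s hs) 2) P.m_pos.le
    calc _ ≤ 2 * ζ * (-(2 * (P.m * r ^ 2))) :=
          mul_le_mul_of_nonneg_left (by linarith) (by positivity)
      _ = _ := by ring

/-- The speed bound keeps the gaps above `exp (-C)`, and the distance to the KKT pair bounds the
multipliers. -/
theorem IsSaddleFlow.exists_bounds (h : P.IsLogFlow ζ u l) (hζ : 0 < ζ) (hv : P.IsKKT v k) :
    ∃ δ M, 0 < δ ∧ δ ≤ 1 ∧ 0 < M ∧ ∀ t, 0 ≤ t → ∀ i, δ ≤ P.gap i (u t) ∧ l t i ≤ M := by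
  set C := √(P.sqSpeed negLog negLogDeriv (u 0) (l 0)) with hC
  refine ⟨Real.exp (-C), √(sqDist (u 0) v (l 0) k) + ∑ i, k i + 1, Real.exp_pos _,
    Real.exp_le_one_iff.2 (neg_nonpos.2 (Real.sqrt_nonneg _)), ?_, fun t ht i => ⟨?_, ?_⟩⟩
  · have : 0 ≤ ∑ i, k i := Finset.sum_nonneg fun i _ => hv.nonneg i
    positivity
  · have h1 := h.le_sqrt_sqSpeed tangentOn_negLog hζ ht i
    rw [← Real.exp_log (show 0 < P.gap i (u t) from h.mem t ht i)]
    refine Real.exp_le_exp.2 ?_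
    have h2 : -Real.log (P.gap i (u t)) ≤ C := h1
    linarith
  · have h1 := h.sqDist_kkt_le hζ hv le_rfl ht le_rfl fun s _ => norm_nonneg _
    have h2 : sqDist (u t) v (l t) k ≤ sqDist (u 0) v (l 0) k := by linarith
    have h3 := Real.abs_le_sqrt ((sq_le_sqDist (u t) v (l t) k i).trans h2)
    have h4 : k i ≤ ∑ i, k i := Finset.single_le_sum (fun i _ => hv.nonneg i) (Finset.mem_univ i)
    have h5 := le_abs_self (l t i - k i)
    linarith

/-- The primal variable converges to the minimizer, without any constraint qualification. -/
theorem IsSaddleFlow.tendsto_fst (h : P.IsLogFlow ζ u l) (hζ : 0 < ζ) (hv : P.IsKKT v k) :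
    Tendsto u atTop (𝓝 v) := by
  set V : ℝ → ℝ := fun t => sqDist (u t) v (l t) k with hV
  have hmono : ∀ t t', 0 ≤ t → t ≤ t' → V t' ≤ V t := fun t t' ht htt => by
    have := h.sqDist_kkt_le hζ hv ht htt le_rfl fun s _ => norm_nonneg _
    simp only [hV]
    linarith
  set C : ℝ := ζ * √(P.sqSpeed negLog negLogDeriv (u 0) (l 0)) + 1 with hC
  have hC0 : 0 < C := by positivity
  have hlip : ∀ t s, 0 ≤ t → t ≤ s → ‖u s - u t‖ ≤ C * (s - t) := fun t s ht hts =>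
    norm_image_sub_le_of_norm_deriv_right_le_segment (h.cont_fst.mono fun r hr => ht.trans hr.1)
      (fun r hr => h.primal r (ht.trans hr.1)) (fun r hr => by
        rw [norm_smul, norm_neg, Real.norm_eq_abs, abs_of_pos hζ, hC]
        have := mul_le_mul_of_nonneg_left
          (h.norm_field_le tangentOn_negLog hζ (ht.trans hr.1)) hζ.le
        linarith) s ⟨hts, le_rfl⟩
  rw [Metric.tendsto_atTop]
  intro ε hε
  have hbdd : BddBelow (V '' Ici 0) := ⟨0, by rintro _ ⟨t, _, rfl⟩; exact sqDist_nonneg _ _ _ _⟩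
  -- During a time `τ` the primal variable moves at most `ε / 2`. If it is `ε` away from `v`, it
  -- stays `ε / 2` away throughout, and the Lyapunov function drops by `η`. This is impossible once
  -- its value is within `η` of its infimum.
  set τ : ℝ := ε / (2 * C) with hτ
  have hτ0 : 0 < τ := by positivity
  set η : ℝ := 4 * ζ * P.m * (ε / 2) ^ 2 * τ with hη
  have hη0 : 0 < η := by
    have := P.m_pos
    positivity
  obtain ⟨_, ⟨t₀, ht₀, rfl⟩, hlt⟩ := Real.lt_sInf_add_pos (s := V '' Ici 0)
    ⟨_, mem_image_of_mem V self_mem_Ici⟩ hη0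
  refine ⟨t₀, fun t ht => ?_⟩
  rw [dist_eq_norm]
  by_contra hcon
  have hcon := not_lt.1 hcon
  have ht0 : 0 ≤ t := le_trans ht₀ ht
  have h1 := h.sqDist_kkt_le hζ hv ht0 (le_add_of_nonneg_right hτ0.le) (half_pos hε).le
    (fun s hs => by
      have h2 := hlip t s ht0 hs.1
      have h3 : C * (s - t) ≤ ε / 2 := by
        calc _ ≤ C * τ := mul_le_mul_of_nonneg_left (by linarith [hs.2]) hC0.le
          _ = ε / 2 := by rw [hτ]; field_simp
      have h4 : ‖u t - v‖ ≤ ‖u s - v‖ + ‖u s - u t‖ := by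
        have : u t - v = (u s - v) - (u s - u t) := by abel
        rw [this]
        exact norm_sub_le _ _
      linarith)
  rw [add_sub_cancel_left, ← hη] at h1
  have h2 : sInf (V '' Ici 0) ≤ V (t + τ) := csInf_le hbdd ⟨_, add_nonneg ht0 hτ0.le, rfl⟩
  have h3 := hmono t₀ t ht₀ ht
  simp only [hV] at h2 h3 hlt
  linarith

end ConvexProgram

/-! ### Exponential convergence -/

theorem le_exp_of_right_deriv_le {f f' : ℝ → ℝ} {μ : ℝ} (hf : ContinuousOn f (Ici 0))
    (hf' : ∀ t, 0 ≤ t → HasDerivWithinAt f (f' t) (Ici t) t) (h : ∀ t, 0 ≤ t → f' t ≤ -μ * f t)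
    {t : ℝ} (ht : 0 ≤ t) : f t ≤ f 0 * Real.exp (-μ * t) := by
  have hd : ∀ s, HasDerivAt (fun s => Real.exp (μ * s)) (Real.exp (μ * s) * μ) s := fun s => by
    have : HasDerivAt (fun s => μ * s) μ s := by simpa using (hasDerivAt_id s).const_mul μ
    exact this.exp
  have h1 : Real.exp (μ * t) * f t ≤ f 0 := by
    refine image_le_of_deriv_right_le_deriv_boundary (f := fun s => Real.exp (μ * s) * f s)
      (B := fun _ => f 0) (B' := fun _ => 0)
      (((by fun_prop : Continuous fun s => Real.exp (μ * s)).continuousOn.mul hf).mono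
        fun s hs => hs.1)
      (fun s hs => (hd s).hasDerivWithinAt.mul (hf' s hs.1)) (by simp) continuousOn_const
      (fun s _ => hasDerivWithinAt_const _ _ _) (fun s hs => ?_) (right_mem_Icc.2 ht)
    have h2 := mul_le_mul_of_nonneg_left (h s hs.1) (Real.exp_pos (μ * s)).le
    linarith
  have h2 : Real.exp (-μ * t) * Real.exp (μ * t) = 1 := by
    rw [← Real.exp_add, neg_mul, neg_add_cancel, Real.exp_zero]
  have h3 := mul_le_mul_of_nonneg_left h1 (Real.exp_pos (-μ * t)).le
  rw [← mul_assoc, h2, one_mul] at h3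
  linarith

/-- An injective linear map from a finite-dimensional space is bounded below. The factor `n` in the
constant passes from the maximum norm to the sum of squares, and the added one keeps it positive
when no index is selected. -/
theorem exists_pos_mul_sum_sq_le {E I : Type*} [NormedAddCommGroup E] [InnerProductSpace ℝ E]
    [Fintype I] {p : I → Prop} [DecidablePred p] {a : I → E}
    (h : LinearIndependent ℝ fun i : {i // p i} => a i.1) :
    ∃ σ, 0 < σ ∧ ∀ c : I → ℝ, σ * ∑ i with p i, c i ^ 2 ≤ ‖∑ i with p i, c i • a i‖ ^ 2 := by
  obtain ⟨K, hK, hanti⟩ := LinearMap.exists_antilipschitzWith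
    (Fintype.linearCombination ℝ fun i : {i // p i} => a i.1)
    (LinearMap.ker_eq_bot.2 (linearIndependent_iff_injective_fintypeLinearCombination.1 h))
  obtain ⟨n, hn⟩ : ∃ n, n = (Finset.univ.filter p).card := ⟨_, rfl⟩
  have hK0 : (0 : ℝ) < K := hK
  refine ⟨(n * (K : ℝ) ^ 2 + 1)⁻¹, by positivity, fun c => ?_⟩
  have e : Fintype.linearCombination ℝ (fun i : {i // p i} => a i.1) (fun i => c i.1) =
      ∑ i with p i, c i • a i := by
    rw [Fintype.linearCombination_apply,
      ← Finset.sum_subtype (Finset.univ.filter p) (by simp) (fun i => c i • a i)]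
  set y := ∑ i with p i, c i • a i
  have h1 : ‖fun i : {i // p i} => c i.1‖ ≤ K * ‖y‖ := by
    have := hanti.le_mul_dist (fun i : {i // p i} => c i.1) 0
    rwa [map_zero, dist_zero_right, dist_zero_right, e] at this
  have h2 : ∑ i with p i, c i ^ 2 ≤ n * ((K : ℝ) * ‖y‖) ^ 2 := by
    rw [← nsmul_eq_mul, hn]
    refine Finset.sum_le_card_nsmul _ _ _ fun i hi => ?_
    have h3 := (norm_le_pi_norm (fun i : {i // p i} => c i.1)
      ⟨i, (Finset.mem_filter.1 hi).2⟩).trans h1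
    rw [← sq_abs]
    exact pow_le_pow_left₀ (abs_nonneg _) h3 2
  rw [inv_mul_le_iff₀ (by positivity)]
  nlinarith [sq_nonneg ‖y‖]

namespace ConvexProgram

variable {E I : Type*} [NormedAddCommGroup E] [InnerProductSpace ℝ E] {P : ConvexProgram E I}
  [Fintype I] {ζ : ℝ} {v : E} {k : I → ℝ}

/-- Estimate for the cross term `⟪u - v, ∑ (lᵢ - kᵢ) aᵢ⟫` (sum over the active constraints) in the
Lyapunov function. -/
theorem IsKKT.exists_cross_le (hv : P.IsKKT v k) {δ M : ℝ} (hδ : 0 < δ) (hδ1 : δ ≤ 1) (hM : 0 < M)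
    [DecidablePred fun i => P.gap i v = 1] [DecidablePred fun i => P.gap i v ≠ 1] :
    ∃ K, 0 ≤ K ∧ ∀ (u : E) (l : I → ℝ), (∀ i, 0 ≤ l i) → (∀ i, δ ≤ P.gap i u ∧ l i ≤ M) →
      -inner ℝ (P.field negLogDeriv u l) (∑ i with P.gap i v = 1, (l i - k i) • P.a i) +
        inner ℝ (u - v) (∑ i with P.gap i v = 1, projRate (l i) (negLog (P.gap i u)) • P.a i) ≤
      -(1 / 2) * ‖∑ i with P.gap i v = 1, (l i - k i) • P.a i‖ ^ 2 +
        K * (‖u - v‖ ^ 2 + ∑ i with P.gap i v ≠ 1, l i ^ 2) := by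
  obtain ⟨KG, hKG, hlip⟩ := P.lip
  set κ : I → ℝ := fun i => M * δ⁻¹ * ‖P.a i‖ + δ⁻¹ with hκ
  have hκ0 : ∀ i, 0 ≤ κ i := fun i => by positivity
  set Kr : ℝ := KG + ∑ i, κ i * ‖P.a i‖ with hKr
  have hKr0 : 0 ≤ Kr := add_nonneg hKG (Finset.sum_nonneg fun i _ => by
    have := hκ0 i
    positivity)
  set K2 : ℝ := ∑ i with P.gap i v = 1, δ⁻¹ * ‖P.a i‖ ^ 2 with hK2
  have hK20 : 0 ≤ K2 := Finset.sum_nonneg fun i _ => by positivity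
  refine ⟨Kr ^ 2 + K2, by positivity, fun u l hl hb => ?_⟩
  set y : E := ∑ i with P.gap i v = 1, (l i - k i) • P.a i with hy
  set X : ℝ := ‖u - v‖ with hX
  set W : ℝ := ∑ i with P.gap i v ≠ 1, l i ^ 2 with hW
  have hX0 : 0 ≤ X := norm_nonneg _
  have hW0 : 0 ≤ W := Finset.sum_nonneg fun i _ => sq_nonneg _
  have hgap : ∀ i, P.gap i v = 1 → |P.gap i u - 1| ≤ ‖P.a i‖ * X := fun i hi => by
    rw [← hi, gap_sub, abs_neg]
    exact abs_real_inner_le_norm _ _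
  -- `ρ` is what remains of the multiplier part of the field after the equilibrium and the active
  -- dual error `y` are removed. At active constraints it is `l (1 / gap - 1)`, of the order of `X`;
  -- at inactive ones it is `l / gap`, of the order of `√W`.
  set ρ : I → ℝ := fun i => l i * (P.gap i u)⁻¹ - k i - if P.gap i v = 1 then l i - k i else 0
    with hρ
  have hρle : ∀ i, |ρ i| ≤ κ i * (X + √W) := by
    intro i
    have hg := hδ.trans_le (hb i).1
    have hinv : (P.gap i u)⁻¹ ≤ δ⁻¹ := inv_anti₀ hδ (hb i).1
    have hs := Real.sqrt_nonneg W
    by_cases hi : P.gap i v = 1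
    · have e : ρ i = l i * ((P.gap i u)⁻¹ * (1 - P.gap i u)) := by
        simp only [hρ, if_pos hi]
        field_simp
        ring
      rw [e, abs_mul, abs_mul, abs_of_nonneg (hl i), abs_of_pos (inv_pos.2 hg), abs_sub_comm]
      calc _ ≤ M * (δ⁻¹ * (‖P.a i‖ * X)) :=
            mul_le_mul (hb i).2 (mul_le_mul hinv (hgap i hi) (abs_nonneg _) (by positivity))
              (by positivity) hM.le
        _ = M * δ⁻¹ * ‖P.a i‖ * X := by ring
        _ ≤ κ i * (X + √W) := mul_le_mul (le_add_of_nonneg_right (by positivity))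
            (le_add_of_nonneg_right hs) hX0 (hκ0 i)
    · have e : ρ i = (P.gap i u)⁻¹ * l i := by
        simp only [hρ, if_neg hi, hv.snd_eq_zero hi]
        ring
      have hlW : l i ≤ √W := Real.le_sqrt_of_sq_le
        (Finset.single_le_sum (f := fun i => l i ^ 2) (fun i _ => sq_nonneg _)
          (Finset.mem_filter.2 ⟨Finset.mem_univ i, hi⟩))
      rw [e, abs_mul, abs_of_nonneg (hl i), abs_of_pos (inv_pos.2 hg)]
      calc _ ≤ δ⁻¹ * √W := mul_le_mul hinv hlW (hl i) (by positivity)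
        _ ≤ κ i * (X + √W) := mul_le_mul (le_add_of_nonneg_left (by positivity))
            (le_add_of_nonneg_left hX0) hs (hκ0 i)
  have hfield : P.field negLogDeriv u l = y + ((P.G u - P.G v) + ∑ i, ρ i • P.a i) := by
    have e1 : P.G v = -∑ i, k i • P.a i := eq_neg_of_add_eq_zero_left hv.stat
    have e2 : ∑ i, ρ i • P.a i = ∑ i, (l i * (P.gap i u)⁻¹) • P.a i - ∑ i, k i • P.a i - y := by
      simp only [hρ, sub_smul, Finset.sum_sub_distrib, ite_smul, zero_smul]
      rw [hy, Finset.sum_filter]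
      simp only [sub_smul]
    have e3 : P.field negLogDeriv u l = P.G u + ∑ i, (l i * (P.gap i u)⁻¹) • P.a i := by
      simp only [field, negLogDeriv, mul_neg, neg_smul, Finset.sum_neg_distrib, sub_neg_eq_add]
    rw [e3, e2, e1]
    abel
  set r : E := (P.G u - P.G v) + ∑ i, ρ i • P.a i with hr
  have hrle : ‖r‖ ≤ Kr * (X + √W) := by
    have h1 := hlip u v
    have h2 : ‖∑ i, ρ i • P.a i‖ ≤ (∑ i, κ i * ‖P.a i‖) * (X + √W) := by
      rw [Finset.sum_mul]
      refine norm_sum_le_of_le _ fun i _ => ?_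
      rw [norm_smul, Real.norm_eq_abs]
      calc _ ≤ κ i * (X + √W) * ‖P.a i‖ := mul_le_mul_of_nonneg_right (hρle i) (norm_nonneg _)
        _ = _ := by ring
    have h3 : 0 ≤ KG * √W := mul_nonneg hKG (Real.sqrt_nonneg _)
    refine (norm_add_le _ _).trans ?_
    rw [hKr]
    linarith
  have hr2 : ‖r‖ ^ 2 ≤ 2 * Kr ^ 2 * (X ^ 2 + W) := by
    have h1 := pow_le_pow_left₀ (norm_nonneg _) hrle 2
    have h2 : (X + √W) ^ 2 ≤ 2 * (X ^ 2 + W) := by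
      have := Real.sq_sqrt hW0
      nlinarith [sq_nonneg (X - √W)]
    calc _ ≤ _ := h1
      _ = Kr ^ 2 * (X + √W) ^ 2 := by ring
      _ ≤ Kr ^ 2 * (2 * (X ^ 2 + W)) := mul_le_mul_of_nonneg_left h2 (sq_nonneg _)
      _ = _ := by ring
  -- The field is `y + r`, so the first term is `-‖y‖² - ⟪r, y⟫`, and Young's inequality spends half
  -- of `‖y‖²` on the remainder.
  have hfirst : -inner ℝ (P.field negLogDeriv u l) y ≤
      -(1 / 2) * ‖y‖ ^ 2 + Kr ^ 2 * (X ^ 2 + W) := by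
    rw [hfield, inner_add_left, real_inner_self_eq_norm_sq]
    have h1 := (abs_le.1 (abs_real_inner_le_norm r y)).1
    nlinarith [sq_nonneg (‖r‖ - ‖y‖)]
  -- At an active constraint the projected rate is at most `|log gap|`, of the order of `X`, so this
  -- term is quadratic in the primal error.
  have hsecond : inner ℝ (u - v) (∑ i with P.gap i v = 1,
      projRate (l i) (negLog (P.gap i u)) • P.a i) ≤ K2 * X ^ 2 := by
    rw [inner_sum, hK2, Finset.sum_mul]
    refine Finset.sum_le_sum fun i hi => ?_
    have hi := (Finset.mem_filter.1 hi).2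
    rw [inner_smul_right]
    have h1 : |projRate (l i) (negLog (P.gap i u))| ≤ δ⁻¹ * (‖P.a i‖ * X) :=
      (abs_projRate_le _ _).trans ((abs_negLog_le hδ hδ1 (hb i).1).trans
        (mul_le_mul_of_nonneg_left (hgap i hi) (by positivity)))
    have h2 := abs_real_inner_le_norm (u - v) (P.a i)
    refine (le_abs_self _).trans ?_
    rw [abs_mul]
    calc _ ≤ δ⁻¹ * (‖P.a i‖ * X) * (X * ‖P.a i‖) :=
          mul_le_mul h1 h2 (abs_nonneg _) (by positivity)
      _ = _ := by ring
  have : 0 ≤ K2 * W := mul_nonneg hK20 hW0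
  linarith

/-- The squared distance `V` dissipates `X²` and the inactive multipliers only. Adding `2 ε ⟪u - v,
y⟫`, with `y` the active dual error mapped by the normals, produces `-‖y‖²` at the cost of terms
already dissipated. Linear independence makes `‖y‖²` control the active dual error, so the modified
function decays exponentially. -/
theorem IsSaddleFlow.exists_exp_bound {u : ℝ → E} {l : ℝ → I → ℝ} (h : P.IsLogFlow ζ u l)
    (hζ : 0 < ζ) (hv : P.IsKKT v k)
    (hli : LinearIndependent ℝ fun i : {i // P.gap i v = 1} => P.a i.1) :
    ∃ K μ, 0 < K ∧ 0 < μ ∧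
      ∀ t, 0 ≤ t → sqDist (u t) v (l t) k ≤ K * Real.exp (-μ * t) := by
  classical
  obtain ⟨δ, M, hδ, hδ1, hM, hb⟩ := h.exists_bounds hζ hv
  obtain ⟨σ, hσ, hσle⟩ := exists_pos_mul_sum_sq_le hli
  obtain ⟨K, hK, hcross⟩ := hv.exists_cross_le hδ hδ1 hM
  -- At inactive constraints the dissipation is linear, at least `c * l`. As `l ≤ M`, it dominates
  -- the quadratic term `(c / M) * l ^ 2`.
  obtain ⟨c, hc, -, hcle⟩ := exists_pos_forall_le (p := fun i => P.gap i v ≠ 1)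
    (f := fun i => Real.log (P.gap i v)) fun i hi =>
      Real.log_pos (lt_of_le_of_ne (hv.one_le i) (Ne.symm hi))
  set y : ℝ → E := fun t => ∑ i with P.gap i v = 1, (l t i - k i) • P.a i with hy
  set W : ℝ → ℝ := fun t => ∑ i with P.gap i v ≠ 1, l t i ^ 2 with hW
  set V : ℝ → ℝ := fun t => sqDist (u t) v (l t) k with hV
  have hsplit : ∀ t, V t = ‖u t - v‖ ^ 2 + ∑ i with P.gap i v = 1, (l t i - k i) ^ 2 + W t := by
    intro t
    have e : W t = ∑ i with P.gap i v ≠ 1, (l t i - k i) ^ 2 := by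
      refine Finset.sum_congr rfl fun i hi => ?_
      rw [hv.snd_eq_zero (Finset.mem_filter.1 hi).2, sub_zero]
    rw [e, add_assoc, Finset.sum_filter_add_sum_filter_not]
    rfl
  have hV0 : ∀ t, 0 ≤ V t := fun t => sqDist_nonneg _ _ _ _
  have hW0 : ∀ t, 0 ≤ W t := fun t => Finset.sum_nonneg fun i _ => sq_nonneg _
  set Ky : ℝ := (∑ i, ‖P.a i‖) ^ 2 with hKy
  have hKy0 : 0 ≤ Ky := sq_nonneg _
  have hyV : ∀ t, ‖y t‖ ^ 2 ≤ Ky * V t := by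
    intro t
    have h1 : ‖y t‖ ≤ (∑ i, ‖P.a i‖) * √(V t) := by
      rw [Finset.sum_mul]
      refine (norm_sum_le_of_le (f := fun i => (l t i - k i) • P.a i)
        (n := fun i => ‖P.a i‖ * √(V t)) _ fun i _ => ?_).trans
        (Finset.sum_le_sum_of_subset_of_nonneg (Finset.filter_subset _ _)
          fun i _ _ => by positivity)
      rw [norm_smul, Real.norm_eq_abs, mul_comm]
      exact mul_le_mul_of_nonneg_left (Real.abs_le_sqrt (sq_le_sqDist _ _ _ _ i)) (norm_nonneg _)
    have h2 := pow_le_pow_left₀ (norm_nonneg _) h1 2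
    rwa [mul_pow, Real.sq_sqrt (hV0 t)] at h2
  set κ : ℝ := min (2 * P.m) (c / M) with hκ
  have hκ0 : 0 < κ := lt_min (mul_pos two_pos P.m_pos) (by positivity)
  -- The first entry lets half of the dissipation `κ` absorb the error `ε * K`. The second keeps the
  -- cross term below `V / 2`, so that `Φ` is comparable with `V`.
  set ε : ℝ := min (κ / (2 * (K + 1))) (1 / (2 * (1 + Ky))) with hε
  have hε0 : 0 < ε := lt_min (by positivity) (by positivity)
  have hεK : ε * K ≤ κ / 2 := by
    have h1 : ε ≤ κ / (2 * (K + 1)) := min_le_left _ _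
    rw [le_div_iff₀ (by positivity)] at h1
    linarith
  have hεy : ε * (1 + Ky) ≤ 1 / 2 := by
    have h1 : ε ≤ 1 / (2 * (1 + Ky)) := min_le_right _ _
    rw [le_div_iff₀ (by positivity)] at h1
    linarith
  set κ' : ℝ := min (κ / 2) (ε * σ / 2) with hκ'
  have hκ'0 : 0 < κ' := lt_min (by positivity) (by positivity)
  set Φ : ℝ → ℝ := fun t => V t + 2 * ε * inner ℝ (u t - v) (y t) with hΦ
  have hcrossV : ∀ t, |2 * ε * inner ℝ (u t - v) (y t)| ≤ 1 / 2 * V t := by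
    intro t
    rw [abs_mul, abs_of_pos (mul_pos two_pos hε0)]
    have h1 := abs_real_inner_le_norm (u t - v) (y t)
    have h2 : 2 * (‖u t - v‖ * ‖y t‖) ≤ (1 + Ky) * V t := by
      have h3 := norm_sq_le_sqDist (u t) v (l t) k
      have h4 := hyV t
      simp only [hV] at h4 ⊢
      nlinarith [sq_nonneg (‖u t - v‖ - ‖y t‖)]
    calc 2 * ε * |inner ℝ (u t - v) (y t)| ≤ 2 * ε * (‖u t - v‖ * ‖y t‖) :=
          mul_le_mul_of_nonneg_left h1 (by positivity)
      _ = ε * (2 * (‖u t - v‖ * ‖y t‖)) := by ring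
      _ ≤ ε * ((1 + Ky) * V t) := mul_le_mul_of_nonneg_left h2 hε0.le
      _ = ε * (1 + Ky) * V t := by ring
      _ ≤ _ := mul_le_mul_of_nonneg_right hεy (hV0 t)
  have hyc : ContinuousOn y (Ici 0) := continuousOn_finsetSum _ fun i _ =>
    ((h.cont_snd i).sub continuousOn_const).smul continuousOn_const
  have hVc : ContinuousOn V (Ici 0) := continuousOn_sqDist (v := fun _ => v) (k := fun _ => k)
    h.cont_fst continuousOn_const h.cont_snd fun _ => continuousOn_const
  have hΦc : ContinuousOn Φ (Ici 0) :=
    hVc.add (continuousOn_const.mul ((h.cont_fst.sub continuousOn_const).inner hyc))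
  have hyd : ∀ t, 0 ≤ t → HasDerivWithinAt y
      (ζ • ∑ i with P.gap i v = 1, projRate (l t i) (negLog (P.gap i (u t))) • P.a i)
      (Ici t) t := by
    intro t ht
    refine (HasDerivWithinAt.fun_sum fun i _ =>
      ((h.dual t ht i).sub_const (k i)).smul_const (P.a i)).congr_deriv ?_
    rw [Finset.smul_sum]
    simp only [smul_smul]
  have hΦd : ∀ t, 0 ≤ t → HasDerivWithinAt Φ _ (Ici t) t := fun t ht =>
    (h.hasDerivWithinAt_sqDist_kkt (v := v) (k := k) ht).add
      ((((h.primal t ht).sub_const v).inner ℝ (hyd t ht)).const_mul (2 * ε))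
  have hbound := fun t ht => le_exp_of_right_deriv_le (μ := ζ * κ') hΦc hΦd (t := t)
    (fun t ht => by
      have h1 := hv.log_le_zero (h.nonneg t ht) (h.mem t ht)
      have h2 := hcross (u t) (l t) (h.nonneg t ht) (hb t ht)
      have h3 : ∑ i, l t i * negLog (P.gap i v) ≤ -(c / M * W t) := by
        rw [← Finset.sum_filter_add_sum_filter_not Finset.univ (fun i => P.gap i v = 1)]
        have e1 : ∑ i with P.gap i v = 1, l t i * negLog (P.gap i v) = 0 :=
          Finset.sum_eq_zero fun i hi => by
            rw [(Finset.mem_filter.1 hi).2]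
            simp [negLog]
        rw [e1, zero_add, hW, Finset.mul_sum, ← Finset.sum_neg_distrib]
        refine Finset.sum_le_sum fun i hi => ?_
        have h4 := hcle i (Finset.mem_filter.1 hi).2
        have h5 := h.nonneg t ht i
        have h6 := (hb t ht i).2
        have h7 : l t i ^ 2 / M ≤ l t i := by
          rw [div_le_iff₀ hM, sq]
          exact mul_le_mul_of_nonneg_left h6 h5
        have h8 : c * (l t i ^ 2 / M) ≤ Real.log (P.gap i v) * l t i :=
          mul_le_mul h4 h7 (by positivity) (hc.le.trans h4)
        have e2 : c / M * l t i ^ 2 = c * (l t i ^ 2 / M) := by ring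
        rw [e2, negLog]
        linarith
      have hXW0 : 0 ≤ ‖u t - v‖ ^ 2 + W t := add_nonneg (sq_nonneg _) (hW0 t)
      have h4 : κ * (‖u t - v‖ ^ 2 + W t) ≤ 2 * P.m * ‖u t - v‖ ^ 2 + c / M * W t := by
        have e1 := mul_le_mul_of_nonneg_right (min_le_left (2 * P.m) (c / M))
          (sq_nonneg ‖u t - v‖)
        have e2 := mul_le_mul_of_nonneg_right (min_le_right (2 * P.m) (c / M)) (hW0 t)
        rw [mul_add]
        exact add_le_add e1 e2
      have h5 : ε * (K * (‖u t - v‖ ^ 2 + W t)) ≤ κ / 2 * (‖u t - v‖ ^ 2 + W t) := by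
        rw [← mul_assoc]
        exact mul_le_mul_of_nonneg_right hεK hXW0
      have h6 : κ' * V t ≤ κ / 2 * (‖u t - v‖ ^ 2 + W t) + ε / 2 * ‖y t‖ ^ 2 := by
        have e1 := mul_le_mul_of_nonneg_right (min_le_left (κ / 2) (ε * σ / 2)) hXW0
        have e2 := mul_le_mul_of_nonneg_right (min_le_right (κ / 2) (ε * σ / 2))
          (Finset.sum_nonneg fun i (_ : i ∈ Finset.univ.filter fun i => P.gap i v = 1) =>
            sq_nonneg (l t i - k i))
        have e3 := mul_le_mul_of_nonneg_left (hσle fun i => l t i - k i) (half_pos hε0).le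
        rw [hsplit]
        simp only [hy]
        linarith
      have h7 : Φ t ≤ 2 * V t := by
        have := (abs_le.1 (hcrossV t)).2
        have := hV0 t
        simp only [hΦ]
        linarith
      have h8 := mul_le_mul_of_nonneg_left h7 hκ'0.le
      have h9 := mul_le_mul_of_nonneg_left h2 hε0.le
      have hfin : (-inner ℝ (u t - v) (P.field negLogDeriv (u t) (l t)) +
          ∑ i, (l t i - k i) * projRate (l t i) (negLog (P.gap i (u t)))) +
          ε * (-inner ℝ (P.field negLogDeriv (u t) (l t)) (y t) + inner ℝ (u t - v)
            (∑ i with P.gap i v = 1, projRate (l t i) (negLog (P.gap i (u t))) • P.a i)) ≤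
          -(1 / 2 * (κ' * Φ t)) := by
        simp only [hy] at h6 ⊢
        linarith
      have := mul_le_mul_of_nonneg_left hfin (mul_pos two_pos hζ).le
      rw [inner_smul_left, inner_smul_right]
      simp only [conj_trivial]
      linarith) ht
  refine ⟨2 * Φ 0 + 1, ζ * κ', ?_, by positivity, fun t ht => ?_⟩
  · have := (abs_le.1 (hcrossV 0)).1
    have := hV0 0
    simp only [hΦ]
    linarith
  · have h1 := hbound t ht
    have h2 := (abs_le.1 (hcrossV t)).1
    have h3 := Real.exp_pos (-(ζ * κ') * t)
    have h4 : V t ≤ 2 * Φ t := by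
      simp only [hΦ]
      linarith
    change V t ≤ _
    linarith

end ConvexProgram

/-! ### Gradients -/

namespace ConvexProgram

variable {E I : Type*} [NormedAddCommGroup E] [InnerProductSpace ℝ E] [CompleteSpace E]
  (P : ConvexProgram E I)

/-- The tangent inequality at `u` bounds the error below by zero, and the one at `v` with the
Lipschitz bound for `G` bounds it above by `K ‖v - u‖²`. Differentiability therefore need not be
part of the structure. -/
theorem hasGradientAt_J (u : E) : HasGradientAt P.J (P.G u) u := by
  obtain ⟨K, hK, hlip⟩ := P.lip
  rw [hasGradientAt_iff_isLittleO]
  refine Asymptotics.IsBigO.trans_isLittleO (g := fun v => ‖v - u‖ ^ 2) ?_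
    (Asymptotics.isLittleO_pow_sub_sub u one_lt_two)
  refine Asymptotics.IsBigO.of_bound K (Eventually.of_forall fun v => ?_)
  have h1 := P.strong u v
  have h2 := P.strong v u
  have h3 : 0 ≤ P.m * ‖v - u‖ ^ 2 := mul_nonneg P.m_pos.le (sq_nonneg _)
  rw [norm_sub_rev u v, ← neg_sub v u, inner_neg_right] at h2
  have h4 := real_inner_le_norm (P.G v - P.G u) (v - u)
  rw [inner_sub_left] at h4
  have h5 := mul_le_mul_of_nonneg_right (hlip v u) (norm_nonneg (v - u))
  rw [Real.norm_eq_abs, Real.norm_eq_abs, abs_of_nonneg (sq_nonneg ‖v - u‖), abs_of_nonneg]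
  · linarith
  · linarith

variable [Fintype I]

theorem hasGradientAt_barrier {u : E} (hu : ∀ i, 0 < P.gap i u) (l : I → ℝ) :
    HasGradientAt (fun v => P.J v - ∑ i, l i * Real.log (P.gap i v)) (P.field negLogDeriv u l) u := by
  rw [hasGradientAt_iff_hasFDerivAt]
  have h1 := (P.hasGradientAt_J u).hasFDerivAt
  have h2 : ∀ i, HasFDerivAt (P.gap i) (-(innerSL ℝ (P.a i))) u := fun i =>
    (innerSL ℝ (P.a i)).hasFDerivAt.const_sub (P.s i)
  have h3 := h1.sub (HasFDerivAt.fun_sum (u := Finset.univ) fun i _ =>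
    ((h2 i).log (hu i).ne').const_mul (l i))
  refine h3.congr_fderiv ?_
  ext w
  simp [field, negLogDeriv, mul_assoc]

end ConvexProgram

/-! ### Quadratic functions -/

/-- `f` is a quadratic function with homogeneous quadratic part `q`. -/
def IsQuadraticWith {E : Type*} [AddCommGroup E] [Module ℝ E] (f q : E → ℝ) : Prop :=
  ∃ (b : E →ₗ[ℝ] E →ₗ[ℝ] ℝ) (ℓ : E →ₗ[ℝ] ℝ) (c : ℝ),
    (∀ x y, b x y = b y x) ∧ (∀ x, b x x = q x) ∧ ∀ x, f x = c + ℓ x + q x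

section Quadratic

variable {E : Type*} [AddCommGroup E] [Module ℝ E]

theorem IsQuadraticWith.add {f f' q q' : E → ℝ} (h : IsQuadraticWith f q)
    (h' : IsQuadraticWith f' q') :
    IsQuadraticWith (fun x => f x + f' x) (fun x => q x + q' x) := by
  obtain ⟨b, ℓ, c, h1, h2, h3⟩ := h
  obtain ⟨b', ℓ', c', h1', h2', h3'⟩ := h'
  refine ⟨b + b', ℓ + ℓ', c + c', fun x y => ?_, fun x => ?_, fun x => ?_⟩
  · simp [h1 x y, h1' x y]
  · simp [h2, h2']
  · simp only [h3, h3', LinearMap.add_apply]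
    ring

theorem IsQuadraticWith.sum {ι : Type*} (s : Finset ι) {f q : ι → E → ℝ}
    (h : ∀ i ∈ s, IsQuadraticWith (f i) (q i)) :
    IsQuadraticWith (fun x => ∑ i ∈ s, f i x) (fun x => ∑ i ∈ s, q i x) := by
  classical
  induction s using Finset.induction_on with
  | empty => exact ⟨0, 0, 0, by simp, by simp, by simp⟩
  | insert k s hk ih =>
    simp only [Finset.sum_insert hk]
    exact (h k (Finset.mem_insert_self _ _)).add
      (ih fun i hi => h i (Finset.mem_insert_of_mem hi))

theorem isQuadraticWith_wsq {n : ℕ} {L : Matrix (Fin n) (Fin n) ℝ} (hL : L.IsHermitian)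
    (T : E →ₗ[ℝ] (Fin n → ℝ)) (x₀ : Fin n → ℝ) :
    IsQuadraticWith (fun x => wsq L (x₀ + T x)) (fun x => wsq L (T x)) := by
  have hsymm : ∀ x y : Fin n → ℝ, x ⬝ᵥ L *ᵥ y = y ⬝ᵥ L *ᵥ x := by
    intro x y
    have hT : Lᵀ = L := by simpa [Matrix.IsHermitian] using hL
    rw [Matrix.dotProduct_mulVec, ← Matrix.mulVec_transpose, hT, dotProduct_comm]
  refine ⟨(Matrix.toBilin' L).compl₁₂ T T, (2 : ℝ) • (Matrix.toBilin' L x₀).comp T,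
    wsq L x₀, fun x y => ?_, fun x => ?_, fun x => ?_⟩
  · simp only [LinearMap.compl₁₂_apply, Matrix.toBilin'_apply']
    exact hsymm _ _
  · simp only [LinearMap.compl₁₂_apply, Matrix.toBilin'_apply', wsq]
  · simp only [wsq, LinearMap.smul_apply, LinearMap.comp_apply, Matrix.toBilin'_apply',
      Matrix.mulVec_add, add_dotProduct, dotProduct_add, smul_eq_mul]
    rw [hsymm (T x) x₀]
    ring

end Quadratic

/-- A quadratic function with positive definite homogeneous part is strongly convex. -/
theorem IsQuadraticWith.exists_gradient {E : Type*} [NormedAddCommGroup E] [InnerProductSpace ℝ E]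
    [FiniteDimensional ℝ E] {f q : E → ℝ} (h : IsQuadraticWith f q) (hq : ∀ x, x ≠ 0 → 0 < q x) :
    Continuous f ∧ ∃ (G : E → E) (m : ℝ), 0 < m ∧
      (∀ u v, f u + inner ℝ (G u) (v - u) + m * ‖v - u‖ ^ 2 ≤ f v) ∧
      ∃ K, 0 ≤ K ∧ ∀ u v, ‖G u - G v‖ ≤ K * ‖u - v‖ := by
  obtain ⟨b, ℓ, c, hsymm, hb, hf⟩ := h
  let B : E →L[ℝ] E →L[ℝ] ℝ := LinearMap.toContinuousLinearMap
    ((LinearMap.toContinuousLinearMap : (E →ₗ[ℝ] ℝ) ≃ₗ[ℝ] E →L[ℝ] ℝ).toLinearMap ∘ₗ b)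
  have hB : ∀ x y, B x y = b x y := fun x y => rfl
  let ℓ' : E →L[ℝ] ℝ := LinearMap.toContinuousLinearMap ℓ
  have hqc : Continuous q := by
    have : q = fun x => B x x := funext fun x => (hb x).symm
    rw [this]
    fun_prop
  have hfc : Continuous f := by
    have : f = fun x => c + ℓ' x + q x := funext hf
    rw [this]
    fun_prop
  have hsmul : ∀ (t : ℝ) x, q (t • x) = t ^ 2 * q x := fun t x => by
    simp only [← hb, map_smul, LinearMap.smul_apply, smul_eq_mul]
    ring
  -- The modulus is the minimum of `q` on the unit sphere, extended by homogeneity. The sphere is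
  -- empty if the space is trivial, and then any modulus will do.
  obtain ⟨m, hm, hmq⟩ : ∃ m, 0 < m ∧ ∀ x, m * ‖x‖ ^ 2 ≤ q x := by
    have hq0 : q 0 = 0 := by rw [← hb]; simp
    rcases (Metric.sphere (0 : E) 1).eq_empty_or_nonempty with he | hne
    · refine ⟨1, one_pos, fun x => ?_⟩
      by_cases hx : x = 0
      · simp [hx, hq0]
      · have : (‖x‖⁻¹ • x) ∈ Metric.sphere (0 : E) 1 := by
          simp [norm_smul, inv_mul_cancel₀ (norm_ne_zero_iff.2 hx)]
        rw [he] at this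
        exact absurd this (notMem_empty _)
    · obtain ⟨x₀, hx₀, hmin⟩ := (isCompact_sphere (0 : E) 1).exists_isMinOn hne hqc.continuousOn
      have hx₀1 : ‖x₀‖ = 1 := by simpa using hx₀
      refine ⟨q x₀, hq x₀ (fun h => by simp [h] at hx₀1), fun x => ?_⟩
      by_cases hx : x = 0
      · simp [hx, hq0]
      · have hn : ‖x‖ ≠ 0 := norm_ne_zero_iff.2 hx
        have h1 : (‖x‖⁻¹ • x) ∈ Metric.sphere (0 : E) 1 := by
          simp [norm_smul, inv_mul_cancel₀ hn]
        have h2 : q x₀ ≤ q (‖x‖⁻¹ • x) := hmin h1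
        rw [hsmul] at h2
        have h3 := mul_le_mul_of_nonneg_right h2 (sq_nonneg ‖x‖)
        have h4 : ‖x‖⁻¹ ^ 2 * q x * ‖x‖ ^ 2 = q x := by field_simp
        linarith
  -- The Riesz representative of the derivative. With it the Taylor expansion is exact with
  -- remainder `q (v - u)`.
  let G (u : E) : E := (InnerProductSpace.toDual ℝ E).symm (ℓ' + (2 : ℝ) • B u)
  have hG : ∀ u w, inner ℝ (G u) w = ℓ w + 2 * b u w := fun u w => by
    simp only [G, InnerProductSpace.toDual_symm_apply]
    rfl
  refine ⟨hfc, G, m, hm, fun u v => ?_, 2 * ‖B‖, by positivity, fun u v => ?_⟩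
  · rw [hG, hf, hf]
    have h1 := hmq (v - u)
    have h2 : q (v - u) = q v - 2 * b u v + q u := by
      rw [← hb, ← hb, ← hb]
      simp only [map_sub, LinearMap.sub_apply]
      rw [hsymm v u]
      ring
    simp only [map_sub, hb]
    linarith
  · have h1 : ‖G u - G v‖ ^ 2 ≤ 2 * ‖B‖ * ‖u - v‖ * ‖G u - G v‖ := by
      rw [← real_inner_self_eq_norm_sq]
      have h2 : inner ℝ (G u - G v) (G u - G v) = 2 * B (u - v) (G u - G v) := by
        rw [inner_sub_left, hG, hG, hB, map_sub b, LinearMap.sub_apply]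
        ring
      have h3 := (le_abs_self _).trans (B.le_opNorm₂ (u - v) (G u - G v))
      rw [h2]
      linarith
    rcases (norm_nonneg (G u - G v)).eq_or_lt with h0 | h0
    · rw [← h0]
      positivity
    · rw [sq] at h1
      exact le_of_mul_le_mul_right h1 h0

/-! ### Prediction model, cost and constraints -/

variable {nz p m cx cu cT N : ℕ}

/-- The `k`-th control as a linear map. -/
def ctrlLin (N p k : ℕ) : CtrlSeq N p →ₗ[ℝ] (Fin p → ℝ) where
  toFun u := ctrl u k
  map_add' u v := by
    unfold ctrl
    split_ifs
    · rfl
    · simp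
  map_smul' t u := by
    unfold ctrl
    split_ifs
    · rfl
    · simp

namespace MPCProblem

variable (P : MPCProblem nz p m cx cu cT)

theorem predict_add (z z' : Fin nz → ℝ) (u u' : CtrlSeq N p) (k : ℕ) :
    P.predict (z + z') (u + u') k = P.predict z u k + P.predict z' u' k := by
  induction k with
  | zero => rfl
  | succ k ih =>
    simp only [predict]
    have : ctrl (u + u') k = ctrl u k + ctrl u' k := (ctrlLin N p k).map_add u u'
    rw [ih, this, Matrix.mulVec_add, Matrix.mulVec_add]
    abel

theorem predict_smul (t : ℝ) (z : Fin nz → ℝ) (u : CtrlSeq N p) (k : ℕ) :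
    P.predict (t • z) (t • u) k = t • P.predict z u k := by
  induction k with
  | zero => rfl
  | succ k ih =>
    simp only [predict]
    have : ctrl (t • u) k = t • ctrl u k := (ctrlLin N p k).map_smul t u
    rw [ih, this, Matrix.mulVec_smul, Matrix.mulVec_smul, smul_add]

/-- The effect of the controls on the `k`-th predicted state. -/
def predictLin (N k : ℕ) : CtrlSeq N p →ₗ[ℝ] (Fin nz → ℝ) where
  toFun u := P.predict 0 u k
  map_add' u v := by
    have := P.predict_add 0 0 u v k
    rwa [add_zero] at this
  map_smul' t u := by
    have := P.predict_smul t 0 u k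
    rwa [smul_zero] at this

theorem predict_eq (z : Fin nz → ℝ) (u : CtrlSeq N p) (k : ℕ) :
    P.predict z u k = P.predict z (0 : CtrlSeq N p) k + P.predictLin N k u := by
  have := P.predict_add z 0 0 u k
  rwa [add_zero, zero_add] at this

theorem cost_isQuadraticWith (z : Fin nz → ℝ) :
    IsQuadraticWith (P.cost z : CtrlSeq N p → ℝ) (fun u => (∑ k ∈ Finset.range N,
      (wsq P.Lx (P.predictLin N k u) + wsq P.Lu (ctrlLin N p k u))) +
      wsq P.LN (P.predictLin N N u)) := by
  have hs : ∀ (k : ℕ) (u : CtrlSeq N p), P.predict z u k - P.zbar =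
      (P.predict z (0 : CtrlSeq N p) k - P.zbar) + P.predictLin N k u := fun k u => by
    rw [P.predict_eq z u k]
    abel
  have hc : ∀ (k : ℕ) (u : CtrlSeq N p), ctrl u k - P.ubar = -P.ubar + ctrlLin N p k u :=
    fun k u => by
      change ctrl u k - P.ubar = -P.ubar + ctrl u k
      abel
  have e : (P.cost z : CtrlSeq N p → ℝ) = fun u => (∑ k ∈ Finset.range N,
      (wsq P.Lx ((P.predict z (0 : CtrlSeq N p) k - P.zbar) + P.predictLin N k u) +
        wsq P.Lu (-P.ubar + ctrlLin N p k u))) +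
      wsq P.LN ((P.predict z (0 : CtrlSeq N p) N - P.zbar) + P.predictLin N N u) := by
    funext u
    refine congrArg₂ (· + ·) (Finset.sum_congr rfl fun k _ => ?_) ?_
    · rw [hs, hc]
    · rw [hs]
  rw [e]
  exact (IsQuadraticWith.sum _ fun k _ => (isQuadraticWith_wsq P.hLx.isHermitian _ _).add
    (isQuadraticWith_wsq P.hLu.isHermitian _ _)).add (isQuadraticWith_wsq P.hLN.isHermitian _ _)

theorem wsq_nonneg {n : ℕ} {L : Matrix (Fin n) (Fin n) ℝ} (hL : L.PosSemidef) (x : Fin n → ℝ) :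
    0 ≤ wsq L x := by
  simpa [wsq] using hL.dotProduct_mulVec_nonneg x

theorem wsq_pos {n : ℕ} {L : Matrix (Fin n) (Fin n) ℝ} (hL : L.PosDef) {x : Fin n → ℝ}
    (hx : x ≠ 0) : 0 < wsq L x := by
  simpa [wsq] using hL.dotProduct_mulVec_pos hx

/-- Strong convexity comes from the input weight alone: a nonzero sequence has a nonzero block. The
state and terminal terms only have to be nonnegative. -/
theorem exists_cost_gradient (z : Fin nz → ℝ) :
    Continuous (P.cost z : CtrlSeq N p → ℝ) ∧ ∃ (G : CtrlSeq N p → CtrlSeq N p) (μ : ℝ), 0 < μ ∧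
      (∀ u v, P.cost z u + inner ℝ (G u) (v - u) + μ * ‖v - u‖ ^ 2 ≤ P.cost z v) ∧
      ∃ K, 0 ≤ K ∧ ∀ u v, ‖G u - G v‖ ≤ K * ‖u - v‖ := by
  refine (P.cost_isQuadraticWith z).exists_gradient fun u hu => ?_
  obtain ⟨⟨k, j⟩, hkj⟩ : ∃ i, u i ≠ 0 := by
    by_contra! hcon
    exact hu (PiLp.ext hcon)
  have hne : ctrlLin N p k u ≠ 0 := fun h => hkj (by
    have h1 := congrFun h j
    simpa [ctrlLin, ctrl] using h1)
  refine add_pos_of_pos_of_nonneg ?_ (wsq_nonneg P.hLN.posSemidef _)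
  refine Finset.sum_pos' (fun i _ => add_nonneg (wsq_nonneg P.hLx _)
    (wsq_nonneg P.hLu.posSemidef _)) ⟨k, Finset.mem_range.2 k.2, ?_⟩
  exact add_pos_of_nonneg_of_pos (wsq_nonneg P.hLx _) (wsq_pos P.hLu hne)

theorem exists_con_eq (z : Fin nz → ℝ) (i : ConIdx N cx cu cT) :
    ∃ (η : CtrlSeq N p) (g : ℝ), ∀ u, P.con z i u = g + inner ℝ η u := by
  have key : ∀ ℓ : CtrlSeq N p →ₗ[ℝ] ℝ, ∃ η, ∀ u, inner ℝ η u = ℓ u := fun ℓ =>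
    ⟨(InnerProductSpace.toDual ℝ _).symm (LinearMap.toContinuousLinearMap ℓ), fun u => by
      rw [InnerProductSpace.toDual_symm_apply]
      rfl⟩
  rcases i with ⟨k, i⟩ | ⟨k, i⟩ | i
  · obtain ⟨η, hη⟩ := key ((dotProductBilin ℝ ℝ (P.a i)).comp (P.predictLin N k))
    refine ⟨η, P.a i ⬝ᵥ P.predict z (0 : CtrlSeq N p) k + P.b i, fun u => ?_⟩
    rw [hη, con, P.predict_eq z u k, dotProduct_add]
    change _ = _ + P.a i ⬝ᵥ P.predictLin N k u
    ring
  · obtain ⟨η, hη⟩ := key ((dotProductBilin ℝ ℝ (P.c i)).comp (ctrlLin N p k))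
    refine ⟨η, P.d i, fun u => ?_⟩
    rw [hη, con]
    exact add_comm _ _
  · obtain ⟨η, hη⟩ := key ((dotProductBilin ℝ ℝ (P.e i)).comp (P.predictLin N N))
    refine ⟨η, P.e i ⬝ᵥ P.predict z (0 : CtrlSeq N p) N + P.f i ⬝ᵥ P.ref + P.h i, fun u => ?_⟩
    rw [hη, con, P.predict_eq z u N, dotProduct_add]
    change _ = _ + P.e i ⬝ᵥ P.predictLin N N u
    ring

/-- The coefficient vector `ηᵢ` of a constraint. -/
def conGrad (z : Fin nz → ℝ) (i : ConIdx N cx cu cT) : CtrlSeq N p := (P.exists_con_eq z i).choose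

theorem con_eq (z : Fin nz → ℝ) (i : ConIdx N cx cu cT) (u : CtrlSeq N p) :
    P.con z i u = P.con z i (0 : CtrlSeq N p) + inner ℝ (P.conGrad z i) u := by
  have h := (P.exists_con_eq z i).choose_spec.choose_spec
  rw [h, h 0, inner_zero_right, add_zero]
  rfl

theorem gradient_con (z : Fin nz → ℝ) (i : ConIdx N cx cu cT) (u : CtrlSeq N p) :
    gradient (P.con z i) u = P.conGrad z i := by
  refine HasGradientAt.gradient ?_
  rw [hasGradientAt_iff_hasFDerivAt]
  have e : P.con z i = fun u : CtrlSeq N p => P.con z i (0 : CtrlSeq N p) +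
      innerSL ℝ (P.conGrad z i) u := funext fun u => P.con_eq z i u
  rw [e]
  exact (innerSL ℝ (P.conGrad z i)).hasFDerivAt.const_add _

/-- The convex program whose affine functions are the arguments of the logarithms. -/
def program (N : ℕ) (z : Fin nz → ℝ) (ω β : ℝ) :
    ConvexProgram (CtrlSeq N p) (ConIdx N cx cu cT) where
  -- The cost, its gradient and its modulus do not depend on `ω` and `β`. The program with both
  -- equal to one can therefore stand for all of them wherever only the cost matters.
  J := P.cost z
  G := (P.exists_cost_gradient z).2.choose
  m := (P.exists_cost_gradient (N := N) z).2.choose_spec.choose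
  a i := β • P.conGrad z i
  s i := 1 - β * (P.con z i (0 : CtrlSeq N p) + 1 / ω)
  m_pos := (P.exists_cost_gradient (N := N) z).2.choose_spec.choose_spec.1
  cont := (P.exists_cost_gradient z).1
  strong := (P.exists_cost_gradient (N := N) z).2.choose_spec.choose_spec.2.1
  lip := (P.exists_cost_gradient (N := N) z).2.choose_spec.choose_spec.2.2

theorem program_gap (z : Fin nz → ℝ) (ω β : ℝ) (i : ConIdx N cx cu cT) (u : CtrlSeq N p) :
    (P.program N z ω β).gap i u = P.slack z ω β i u := by
  rw [slack, P.con_eq z i u]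
  simp only [ConvexProgram.gap, program, inner_smul_left, conj_trivial]
  ring

end MPCProblem

/-! ### KKT points as saddle points of the barrier function -/

namespace ConvexProgram

variable {E I : Type*} [NormedAddCommGroup E] [InnerProductSpace ℝ E] {P : ConvexProgram E I}
  [Fintype I]

/-- Where a multiplier is nonzero the gap is one and the logarithm has slope one, so the barrier and
the Lagrangian have the same gradient. -/
theorem field_negLogDeriv_eq {u : E} {l : I → ℝ} (h : ∀ i, l i * (P.gap i u - 1) = 0) :
    P.field negLogDeriv u l = P.G u + ∑ i, l i • P.a i := by
  rw [field, sub_eq_add_neg, ← Finset.sum_neg_distrib]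
  congr 1
  refine Finset.sum_congr rfl fun i _ => ?_
  rw [← neg_smul]
  congr 1
  rcases mul_eq_zero.1 (h i) with h | h
  · simp [h]
  · rw [sub_eq_zero.1 h]
    simp [negLogDeriv]

theorem IsKKT.mul_log_eq_zero {u : E} {l : I → ℝ} (h : P.IsKKT u l) (i : I) :
    l i * Real.log (P.gap i u) = 0 := by
  rcases mul_eq_zero.1 (h.compl i) with h | h
  · rw [h, zero_mul]
  · rw [sub_eq_zero.1 h, Real.log_one, mul_zero]

/-- Since `log x ≤ x - 1`, the barrier function lies above the Lagrangian, which a KKT point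
minimizes. -/
theorem IsKKT.le_barrier {u : E} {l : I → ℝ} (h : P.IsKKT u l) {v : E}
    (hv : ∀ i, 0 < P.gap i v) : P.J u ≤ P.J v - ∑ i, l i * Real.log (P.gap i v) := by
  have h1 := P.strong u v
  have h2 : P.G u = -∑ i, l i • P.a i := eq_neg_of_add_eq_zero_left h.stat
  have h3 : inner ℝ (P.G u) (v - u) = ∑ i, l i * (P.gap i v - P.gap i u) := by
    rw [h2, inner_neg_left, sum_inner, ← Finset.sum_neg_distrib]
    refine Finset.sum_congr rfl fun i _ => ?_
    rw [inner_smul_left, conj_trivial, P.gap_sub i v u, mul_neg]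
  have h4 : ∑ i, l i * Real.log (P.gap i v) ≤ ∑ i, l i * (P.gap i v - P.gap i u) := by
    refine Finset.sum_le_sum fun i _ => ?_
    have h5 := mul_le_mul_of_nonneg_left (Real.log_le_sub_one_of_pos (hv i)) (h.nonneg i)
    have h6 := h.compl i
    linarith
  have h5 : 0 ≤ P.m * ‖v - u‖ ^ 2 := mul_nonneg P.m_pos.le (sq_nonneg _)
  linarith

end ConvexProgram

variable {nz p m cx cu cT N : ℕ}

theorem norm_firstBlock_sub_le (hN : 0 < N) (u v : CtrlSeq N p) :
    ‖firstBlock u - firstBlock v‖ ≤ ‖u - v‖ := by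
  refine le_of_sq_le_sq ?_ (norm_nonneg _)
  rw [EuclideanSpace.norm_sq_eq, EuclideanSpace.norm_sq_eq, Fintype.sum_prod_type]
  refine le_trans (le_of_eq ?_) (Finset.single_le_sum
    (f := fun k : Fin N => ∑ j, ‖(u - v) (k, j)‖ ^ 2)
    (fun k _ => Finset.sum_nonneg fun j _ => sq_nonneg _) (Finset.mem_univ ⟨0, hN⟩))
  refine Finset.sum_congr rfl fun j _ => ?_
  simp [firstBlock, ctrl, hN]

namespace MPCProblem

variable (P : MPCProblem nz p m cx cu cT) {z : Fin nz → ℝ} {ζ ω β : ℝ}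

/-! ### Constraint sets -/

theorem one_le_slack_iff (hβ : 0 < β) (i : ConIdx N cx cu cT) (u : CtrlSeq N p) :
    1 ≤ P.slack z ω β i u ↔ P.con z i u + 1 / ω ≤ 0 := by
  rw [slack, le_add_iff_nonneg_left, neg_mul, ← mul_neg, mul_nonneg_iff_of_pos_left hβ,
    Left.nonneg_neg_iff]

theorem slack_eq_one_iff (hβ : 0 < β) (i : ConIdx N cx cu cT) (u : CtrlSeq N p) :
    P.slack z ω β i u = 1 ↔ P.con z i u + 1 / ω = 0 := by
  rw [slack, add_eq_right, mul_eq_zero, neg_eq_zero, or_iff_right hβ.ne']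

theorem feasible_program (hβ : 0 < β) : (P.program N z ω β).feasible = P.tightenedSet N z ω := by
  ext u
  simp only [ConvexProgram.feasible, tightenedSet, mem_ofPred_eq, program_gap,
    P.one_le_slack_iff hβ]

/-- A positive slack means `con + 1 / ω < 1 / β`, and `1 / β ≤ 1 / ω`. This is where `β ≥ ω` yields
anytime feasibility. -/
theorem barrierDomain_subset (hω : 0 < ω) (hβ : ω ≤ β) :
    P.barrierDomain N z ω β ⊆ P.feasibleSet N z := by
  intro u hu i
  have h1 : 0 < -β * (P.con z i u + 1 / ω) + 1 := hu i
  have h2 : β * (1 / ω) ≥ 1 := by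
    rw [mul_one_div, ge_iff_le, one_le_div hω]
    exact hβ
  by_contra hcon
  have := mul_pos (hω.trans_le hβ) (not_le.1 hcon)
  linarith

theorem tightenedSet_subset (hω : 0 < ω) : P.tightenedSet N z ω ⊆ P.feasibleSet N z := by
  intro u hu i
  have h1 : P.con z i u + 1 / ω ≤ 0 := hu i
  have : 0 < 1 / ω := by positivity
  linarith

theorem tightenedSet_mono {ω' : ℝ} (hω : 0 < ω) (h : ω ≤ ω') :
    P.tightenedSet N z ω ⊆ P.tightenedSet N z ω' := by
  intro u hu i
  have h1 : P.con z i u + 1 / ω ≤ 0 := hu i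
  have := one_div_le_one_div_of_le hω h
  linarith

theorem con_combo (i : ConIdx N cx cu cT) (u v : CtrlSeq N p) {s t : ℝ} (hst : s + t = 1) :
    P.con z i (s • u + t • v) = s * P.con z i u + t * P.con z i v := by
  rw [P.con_eq z i u, P.con_eq z i v, P.con_eq z i (s • u + t • v), inner_add_right,
    inner_smul_right, inner_smul_right]
  linear_combination (-P.con z i (0 : CtrlSeq N p)) * hst

theorem convex_feasibleSet : Convex ℝ (P.feasibleSet N z) := by
  intro u hu v hv s t hs ht hst i
  rw [P.con_combo i u v hst]
  exact add_nonpos (mul_nonpos_of_nonneg_of_nonpos hs (hu i))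
    (mul_nonpos_of_nonneg_of_nonpos ht (hv i))

theorem continuous_con (i : ConIdx N cx cu cT) :
    Continuous (P.con z i : CtrlSeq N p → ℝ) := by
  have e : P.con z i = fun u : CtrlSeq N p => P.con z i (0 : CtrlSeq N p) +
      inner ℝ (P.conGrad z i) u := funext fun u => P.con_eq z i u
  rw [e]
  fun_prop

theorem isClosed_feasibleSet : IsClosed (P.feasibleSet N z) := by
  have : P.feasibleSet N z = ⋂ i : ConIdx N cx cu cT, {u | P.con z i u ≤ 0} := by
    ext u
    simp [feasibleSet]
  rw [this]
  exact isClosed_iInter fun i => isClosed_le (P.continuous_con i) continuous_const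

/-! ### Optimizers -/

/-- Quadratic growth of the cost at an optimizer of the MPC problem; the modulus does not depend on
the parameters of the barrier function. -/
theorem IsMPCOptimal.growth {P : MPCProblem nz p m cx cu cT} {u v : CtrlSeq N p}
    (hu : P.IsMPCOptimal z u) (hv : v ∈ P.feasibleSet N z) :
    P.cost z u + (P.program N z 1 1).m / 2 * ‖v - u‖ ^ 2 ≤ P.cost z v :=
  (P.program N z 1 1).quadratic_growth P.convex_feasibleSet hu.1 hv hu.2

theorem existsUnique_isMPCOptimal (hne : (P.feasibleSet N z).Nonempty) :
    ∃ u, ∀ v : CtrlSeq N p, P.IsMPCOptimal z v ↔ v = u := by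
  obtain ⟨u, hu, hmin⟩ := (P.program N z 1 1).exists_min P.isClosed_feasibleSet hne
  have hopt : P.IsMPCOptimal z u := ⟨hu, hmin⟩
  refine ⟨u, fun v => ⟨fun hv => ?_, fun h => h ▸ hopt⟩⟩
  have h1 := hopt.growth hv.1
  have h2 := hv.2 u hu
  have h3 : (P.program N z 1 1).m / 2 * ‖v - u‖ ^ 2 ≤ 0 := by linarith
  have h4 : 0 < (P.program N z 1 1).m / 2 := half_pos (P.program N z 1 1).m_pos
  by_contra hne
  have h5 : 0 < ‖v - u‖ := norm_pos_iff.2 (sub_ne_zero.2 hne)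
  have : 0 < (P.program N z 1 1).m / 2 * ‖v - u‖ ^ 2 := by positivity
  linarith

theorem barrier_eq (u : CtrlSeq N p) (l : Dual N cx cu cT) :
    P.barrier z ω β u l = (P.program N z ω β).J u -
      ∑ i, l i * Real.log ((P.program N z ω β).gap i u) := by
  simp only [barrier, program_gap]
  rfl

theorem mem_barrierDomain_iff {u : CtrlSeq N p} :
    u ∈ P.barrierDomain N z ω β ↔ ∀ i, 0 < (P.program N z ω β).gap i u := by
  simp only [barrierDomain, mem_ofPred_eq, program_gap]

theorem gradient_barrier {u : CtrlSeq N p} (hu : u ∈ P.barrierDomain N z ω β)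
    (l : Dual N cx cu cT) : gradient (fun v => P.barrier z ω β v l) u =
      (P.program N z ω β).field negLogDeriv u l.ofLp := by
  refine HasGradientAt.gradient ?_
  simp only [barrier_eq]
  exact (P.program N z ω β).hasGradientAt_barrier (P.mem_barrierDomain_iff.1 hu) _

theorem gradient_barrier_dual (u : CtrlSeq N p) (l : Dual N cx cu cT) :
    gradient (fun μ => P.barrier z ω β u μ) l =
      WithLp.toLp 2 fun i => negLog ((P.program N z ω β).gap i u) := by
  refine HasGradientAt.gradient ?_
  rw [hasGradientAt_iff_hasFDerivAt]
  set g : Dual N cx cu cT := WithLp.toLp 2 fun i => negLog ((P.program N z ω β).gap i u)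
  have e : (fun μ => P.barrier z ω β u μ) = fun μ => (P.program N z ω β).J u + innerSL ℝ g μ := by
    funext μ
    rw [barrier_eq, sub_eq_add_neg, ← Finset.sum_neg_distrib, innerSL_apply_apply,
      PiLp.inner_apply]
    congr 1
    refine Finset.sum_congr rfl fun i _ => ?_
    simp [g, negLog]
  rw [e]
  exact (innerSL ℝ g).hasFDerivAt.const_add _

theorem isBarrierOptimal_iff {w : CtrlSeq N p × Dual N cx cu cT} :
    P.IsBarrierOptimal z ω β w ↔ (P.program N z ω β).IsKKT w.1 w.2.ofLp := by
  set Q := P.program N z ω β with hQ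
  constructor
  · rintro ⟨hdom, hnn, hmin, hmax⟩
    have hpos := P.mem_barrierDomain_iff.1 hdom
    have hlog : ∀ i, 0 ≤ Real.log (Q.gap i w.1) := by
      intro i
      -- Raising one multiplier by one cannot increase the barrier function, so its logarithm is
      -- nonnegative. Comparison with the zero multiplier then gives complementarity.
      have h := hmax (w.2 + EuclideanSpace.single i 1) fun j => by
        have := hnn j
        rw [PiLp.add_apply, PiLp.single_apply]
        split_ifs <;> linarith
      rw [barrier_eq, barrier_eq] at h
      simp only [PiLp.add_apply, PiLp.single_apply, add_mul, Finset.sum_add_distrib, ite_mul,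
        one_mul, zero_mul, Finset.sum_ite_eq', Finset.mem_univ, if_true] at h
      linarith
    have hsum : ∑ i, w.2 i * Real.log (Q.gap i w.1) ≤ 0 := by
      have h := hmax 0 fun j => le_rfl
      rw [barrier_eq, barrier_eq] at h
      simp only [PiLp.zero_apply, zero_mul, Finset.sum_const_zero] at h
      linarith
    have hzero : ∀ i, w.2 i * Real.log (Q.gap i w.1) = 0 := by
      have hnn' : ∀ i ∈ Finset.univ, 0 ≤ w.2 i * Real.log (Q.gap i w.1) := fun i _ =>
        mul_nonneg (hnn i) (hlog i)
      intro i
      exact (Finset.sum_eq_zero_iff_of_nonneg hnn').1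
        (le_antisymm hsum (Finset.sum_nonneg hnn')) i (Finset.mem_univ i)
    have hcompl : ∀ i, w.2 i * (Q.gap i w.1 - 1) = 0 := fun i => by
      rcases mul_eq_zero.1 (hzero i) with h | h
      · rw [h, zero_mul]
      · rw [Real.eq_one_of_pos_of_log_eq_zero (hpos i) h, sub_self, mul_zero]
    refine ⟨hnn, fun i => ?_, hcompl, ?_⟩
    · by_contra hlt
      exact absurd (hlog i) (not_le.2 (Real.log_neg (hpos i) (not_le.1 hlt)))
    -- The domain is open, so the minimizer is interior and the gradient vanishes.
    · have hopen : IsOpen (P.barrierDomain N z ω β) := by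
        have : P.barrierDomain N z ω β = ⋂ i, {u | 0 < Q.gap i u} := by
          ext u
          rw [P.mem_barrierDomain_iff, mem_iInter]
          rfl
        rw [this]
        exact isOpen_iInter_of_finite fun i => isOpen_lt continuous_const (Q.continuous_gap i)
      have hloc : IsLocalMin (fun v => P.barrier z ω β v w.2) w.1 := by
        filter_upwards [hopen.mem_nhds hdom] with v hv using hmin v hv
      simp only [barrier_eq] at hloc
      have h1 := hloc.hasFDerivAt_eq_zero (Q.hasGradientAt_barrier hpos _).hasFDerivAt
      rw [LinearIsometryEquiv.map_eq_zero_iff] at h1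
      rw [← ConvexProgram.field_negLogDeriv_eq hcompl]
      exact h1
  · intro h
    have hpos : ∀ i, 0 < Q.gap i w.1 := fun i => zero_lt_one.trans_le (h.one_le i)
    have hval : P.barrier z ω β w.1 w.2 = Q.J w.1 := by
      rw [barrier_eq, Finset.sum_eq_zero fun i _ => h.mul_log_eq_zero i, sub_zero]
    refine ⟨P.mem_barrierDomain_iff.2 hpos, h.nonneg, fun v hv => ?_, fun μ hμ => ?_⟩
    · rw [hval, barrier_eq]
      exact h.le_barrier (P.mem_barrierDomain_iff.1 hv)
    · rw [hval, barrier_eq]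
      have : 0 ≤ ∑ i, μ i * Real.log (Q.gap i w.1) := Finset.sum_nonneg fun i _ =>
        mul_nonneg (hμ i) (Real.log_nonneg (h.one_le i))
      linarith

theorem linearIndependent_program (hβ : 0 < β) {u : CtrlSeq N p} (h : P.LICQ (cT := cT) z ω u) :
    LinearIndependent ℝ fun i : {i // (P.program N z ω β).gap i u = 1} =>
      (P.program N z ω β).a i.1 := by
  have hiff : ∀ i, (P.program N z ω β).gap i u = 1 ↔ P.con z i u + 1 / ω = 0 := fun i => by
    rw [program_gap, P.slack_eq_one_iff hβ]
  have h1 := LinearIndependent.comp h (Equiv.subtypeEquivRight hiff)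
    (Equiv.subtypeEquivRight hiff).injective
  have h2 := h1.units_smul fun _ => Units.mk0 β hβ.ne'
  convert h2 using 1
  funext i
  simp only [P.gradient_con]
  rfl

theorem existsUnique_isBarrierOptimal (hβ : 0 < β) (hne : (P.tightenedSet N z ω).Nonempty)
    (hLICQ : ∀ w : CtrlSeq N p × Dual N cx cu cT, P.IsBarrierOptimal z ω β w → P.LICQ z ω w.1) :
    ∃ w, ∀ w' : CtrlSeq N p × Dual N cx cu cT, P.IsBarrierOptimal z ω β w' ↔ w' = w := by
  rw [← P.feasible_program hβ] at hne
  obtain ⟨u, l, h⟩ := (P.program N z ω β).exists_isKKT hne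
  have hopt : P.IsBarrierOptimal z ω β (u, WithLp.toLp 2 l) := P.isBarrierOptimal_iff.2 h
  refine ⟨(u, WithLp.toLp 2 l), fun w => ⟨fun hw => ?_, fun hw => hw ▸ hopt⟩⟩
  have hk := P.isBarrierOptimal_iff.1 hw
  have h1 : w.1 = u := hk.fst_unique h
  rw [h1] at hk
  have h2 := hk.snd_unique h (P.linearIndependent_program hβ (hLICQ _ hopt))
  exact Prod.ext h1 (PiLp.ext fun i => congrFun h2 i)

/-! ### The flow -/

theorem dual_rate_apply (u : CtrlSeq N p) (l : Dual N cx cu cT) (i : ConIdx N cx cu cT) :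
    (ζ • (gradient (fun μ => P.barrier z ω β u μ) l +
      projTerm l (gradient (fun μ => P.barrier z ω β u μ) l))) i =
      ζ * ConvexProgram.projRate (l i) (negLog ((P.program N z ω β).gap i u)) := by
  rw [gradient_barrier_dual]
  simp only [PiLp.smul_apply, PiLp.add_apply, projTerm, smul_eq_mul, ConvexProgram.projRate]
  split_ifs <;> simp

/-- Nonnegativity is not part of the definition of the flow; it follows from the projection, which
makes the rate of a nonpositive multiplier nonnegative. The proof compares `-λᵢ` with a line of
small positive slope, so that the rate matters only at contact. -/
theorem IsFlow.nonneg {P : MPCProblem nz p m cx cu cT} {x₀ : CtrlSeq N p × Dual N cx cu cT}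
    {w : ℝ → CtrlSeq N p × Dual N cx cu cT} (h : P.IsFlow z ζ ω β x₀ w) (hζ : 0 < ζ)
    (hx₀ : ∀ i, 0 ≤ x₀.2 i) {t : ℝ} (ht : 0 ≤ t) (i : ConIdx N cx cu cT) : 0 ≤ (w t).2 i := by
  have hd : ∀ s, 0 ≤ s → HasDerivWithinAt (fun s => -(w s).2 i)
      (-(ζ * ConvexProgram.projRate ((w s).2 i)
        (negLog ((P.program N z ω β).gap i (w s).1)))) (Ici s) s := fun s hs => by
    have := (EuclideanSpace.proj (𝕜 := ℝ) i).hasFDerivAt.comp_hasDerivWithinAt s (h.dual s hs)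
    rw [← P.dual_rate_apply]
    exact this.neg
  have hc : ContinuousOn (fun s => -(w s).2 i) (Ici 0) :=
    ((EuclideanSpace.proj (𝕜 := ℝ) i).continuous.comp_continuousOn
      (continuous_snd.comp_continuousOn h.cont)).neg
  refine le_of_forall_pos_le_add fun ε hε => ?_
  have := image_le_of_deriv_right_lt_deriv_boundary' (f := fun s => -(w s).2 i) (a := 0) (b := t)
    (hc.mono fun s hs => hs.1) (fun s hs => hd s hs.1) (B := fun s => ε / (t + 1) * s)
    (B' := fun _ => ε / (t + 1)) (by simpa [h.init] using hx₀ i) (by fun_prop)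
    (fun s _ => (by simpa using (hasDerivAt_id s).const_mul (ε / (t + 1)) :
      HasDerivAt (fun s => ε / (t + 1) * s) (ε / (t + 1)) s).hasDerivWithinAt)
    (fun s hs heq => by
      have h1 : 0 ≤ ε / (t + 1) * s := mul_nonneg (by positivity) hs.1
      have h2 : ¬ 0 < (w s).2 i := by linarith
      have h3 : 0 ≤ ConvexProgram.projRate ((w s).2 i)
          (negLog ((P.program N z ω β).gap i (w s).1)) := by
        unfold ConvexProgram.projRate
        split_ifs with hif
        · exact hif.resolve_left h2
        · exact le_rfl
      have h4 := mul_nonneg hζ.le h3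
      have h5 : 0 < ε / (t + 1) := by positivity
      linarith) (right_mem_Icc.2 ht)
  have h6 : ε / (t + 1) * t ≤ ε := by
    rw [div_mul_eq_mul_div, div_le_iff₀ (by positivity)]
    linarith
  linarith

theorem IsFlow.isLogFlow {P : MPCProblem nz p m cx cu cT} {x₀ : CtrlSeq N p × Dual N cx cu cT}
    {w : ℝ → CtrlSeq N p × Dual N cx cu cT} (h : P.IsFlow z ζ ω β x₀ w) (hζ : 0 < ζ)
    (hx₀ : ∀ i, 0 ≤ x₀.2 i) :
    (P.program N z ω β).IsLogFlow ζ (fun t => (w t).1) (fun t => (w t).2.ofLp) where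
  cont_fst := continuous_fst.comp_continuousOn h.cont
  cont_snd i := (EuclideanSpace.proj (𝕜 := ℝ) i).continuous.comp_continuousOn
    (continuous_snd.comp_continuousOn h.cont)
  mem t ht := P.mem_barrierDomain_iff.1 (h.mem_domain t ht)
  nonneg t ht i := h.nonneg hζ hx₀ ht i
  primal t ht := by
    rw [← P.gradient_barrier (h.mem_domain t ht)]
    exact (h.primal t ht).mono (Ici_subset_Ici.2 ht)
  dual t ht i := by
    have := (EuclideanSpace.proj (𝕜 := ℝ) i).hasFDerivAt.comp_hasDerivWithinAt t (h.dual t ht)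
    rw [← P.dual_rate_apply]
    exact this

/-- A KKT pair serves only as an anchor that bounds the multipliers. No constraint qualification
enters, so the result also applies to the modified parameters of the last claim. -/
theorem wellPosed (hζ : 0 < ζ) (hβ : 0 < β) (hne : (P.tightenedSet N z ω).Nonempty)
    {x₀ : CtrlSeq N p × Dual N cx cu cT} (hx₀ : P.IsFeasibleInit z ω β x₀) :
    P.WellPosed z ζ ω β x₀ := by
  constructor
  · rw [← P.feasible_program hβ] at hne
    obtain ⟨v, k, hv⟩ := (P.program N z ω β).exists_isKKT hne
    obtain ⟨u, l, hu0, hl0, hflow, hdu⟩ := ConvexProgram.exists_logFlow hv hζ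
      (P.mem_barrierDomain_iff.1 hx₀.1) (l₀ := x₀.2.ofLp) hx₀.2
    have hmem : ∀ t, 0 ≤ t → u t ∈ P.barrierDomain N z ω β := fun t ht =>
      P.mem_barrierDomain_iff.2 (hflow.mem t ht)
    refine ⟨fun t => (u t, WithLp.toLp 2 (l t)), Prod.ext hu0 (by simp [hl0]), ?_, hmem,
      fun t ht => ?_, fun t ht => ?_⟩
    · exact hflow.cont_fst.prodMk
        ((PiLp.continuous_toLp 2 _).comp_continuousOn (continuousOn_pi.2 hflow.cont_snd))
    · rw [P.gradient_barrier (hmem t ht)]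
      exact hdu t ht
    · rw [hasDerivWithinAt_iff_hasFDerivWithinAt, hasFDerivWithinAt_euclidean]
      intro i
      refine (hflow.dual t ht i).hasFDerivWithinAt.congr_fderiv ?_
      ext
      simp only [ContinuousLinearMap.toSpanSingleton_apply, ContinuousLinearMap.comp_apply, one_smul]
      exact (P.dual_rate_apply (u t) (WithLp.toLp 2 (l t)) i).symm
  · intro w w' h h' t ht
    have := (h.isLogFlow hζ hx₀.2).unique tangentOn_negLog hζ (h'.isLogFlow hζ hx₀.2)
      (by rw [h.init, h'.init]) (by rw [h.init, h'.init]) ht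
    exact Prod.ext this.1 (PiLp.ext fun i => congrFun this.2 i)

theorem WellPosed.isFlow {P : MPCProblem nz p m cx cu cT} {x₀ : CtrlSeq N p × Dual N cx cu cT}
    (h : P.WellPosed z ζ ω β x₀) : P.IsFlow z ζ ω β x₀ (P.flow z ζ ω β x₀) := by
  rw [flow, dif_pos h.1]
  exact h.1.choose_spec

theorem flow_exp_bound (hζ : 0 < ζ) (hβ : 0 < β) (hne : (P.tightenedSet N z ω).Nonempty)
    {x₀ w : CtrlSeq N p × Dual N cx cu cT} (hx₀ : P.IsFeasibleInit z ω β x₀)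
    (hw : P.IsBarrierOptimal z ω β w) (hLICQ : P.LICQ z ω w.1) :
    ∃ K > 0, ∃ μ > 0, ∀ ρ, 0 ≤ ρ →
      ‖(P.flow z ζ ω β x₀ ρ).1 - w.1‖ ≤ K * Real.exp (-μ * ρ) ∧
      ‖(P.flow z ζ ω β x₀ ρ).2 - w.2‖ ≤ K * Real.exp (-μ * ρ) := by
  have hflow := (P.wellPosed hζ hβ hne hx₀).isFlow.isLogFlow hζ hx₀.2
  obtain ⟨K, μ, hK, hμ, hle⟩ := hflow.exists_exp_bound hζ (P.isBarrierOptimal_iff.1 hw)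
    (P.linearIndependent_program hβ hLICQ)
  -- The bound on the squared distance has rate `μ`; its root halves the rate.
  refine ⟨√K, Real.sqrt_pos.2 hK, μ / 2, half_pos hμ, fun ρ hρ => ?_⟩
  have hsq : (√K * Real.exp (-(μ / 2) * ρ)) ^ 2 = K * Real.exp (-μ * ρ) := by
    rw [mul_pow, Real.sq_sqrt hK.le, ← Real.exp_nat_mul]
    congr 2
    push_cast
    ring
  have h0 : 0 ≤ √K * Real.exp (-(μ / 2) * ρ) := by positivity
  constructor
  · refine le_of_sq_le_sq ?_ h0
    rw [hsq]
    exact (norm_sq_le_sqDist _ _ _ _).trans (hle ρ hρ)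
  · refine le_of_sq_le_sq ?_ h0
    rw [hsq, EuclideanSpace.norm_sq_eq]
    refine le_trans (le_of_eq_of_le ?_ (le_add_of_nonneg_left (sq_nonneg _))) (hle ρ hρ)
    refine Finset.sum_congr rfl fun i _ => ?_
    rw [Real.norm_eq_abs, sq_abs, PiLp.sub_apply]

theorem tendsto_flow (hζ : 0 < ζ) (hβ : 0 < β) (hne : (P.tightenedSet N z ω).Nonempty)
    {x₀ : CtrlSeq N p × Dual N cx cu cT} (hx₀ : P.IsFeasibleInit z ω β x₀)
    {v : CtrlSeq N p} {k : ConIdx N cx cu cT → ℝ} (hv : (P.program N z ω β).IsKKT v k) :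
    Tendsto (fun t => (P.flow z ζ ω β x₀ t).1) atTop (𝓝 v) :=
  ((P.wellPosed hζ hβ hne hx₀).isFlow.isLogFlow hζ hx₀.2).tendsto_fst hζ hv

/-- The minimizers over the tightened constraint sets converge to the minimizer over the original
constraint set. -/
theorem exists_tightening {u v : CtrlSeq N p} (hu : P.IsMPCOptimal z u) (hω : 0 < ω)
    (hv : v ∈ P.tightenedSet N z ω) {ε : ℝ} (hε : 0 < ε) :
    ∃ ω₀ ≥ ω, ∀ ω' ≥ ω₀, ∀ β' > 0, ∀ (u' : CtrlSeq N p) (k : ConIdx N cx cu cT → ℝ),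
      (P.program N z ω' β').IsKKT u' k → ‖u' - u‖ < ε := by
  set μ := (P.program N z 1 1).m / 2 with hμ
  have hμ0 : 0 < μ := half_pos (P.program N z 1 1).m_pos
  set D := P.cost z v - P.cost z u with hD
  have hvf := P.tightenedSet_subset hω hv
  have hD0 : 0 ≤ D := sub_nonneg.2 (hu.2 v hvf)
  -- This bound on `ω'` is the condition `θ * D < μ * ε ^ 2` for `θ = ω / ω'`.
  refine ⟨max ω (ω * D / (μ * ε ^ 2) + 1), le_max_left _ _, fun ω' hω' β' hβ' u' k hk => ?_⟩
  have h1 : ω ≤ ω' := (le_max_left _ _).trans hω'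
  have h2 : ω * D / (μ * ε ^ 2) + 1 ≤ ω' := (le_max_right _ _).trans hω'
  have hω'0 : 0 < ω' := hω.trans_le h1
  set θ := ω / ω' with hθ
  have hθ0 : 0 < θ := by positivity
  have hθ1 : θ ≤ 1 := (div_le_one hω'0).2 h1
  have hθD : θ * D < μ * ε ^ 2 := by
    have h3 : ω * D / (μ * ε ^ 2) < ω' := by linarith
    rw [div_lt_iff₀ (by positivity)] at h3
    rw [hθ, div_mul_eq_mul_div, div_lt_iff₀ hω'0]
    linarith
  -- The competitor moves from the optimizer towards `v`, whose margin is `1 / ω`. The fraction `θ`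
  -- leaves the margin `θ / ω = 1 / ω'`, and by convexity it costs at most `θ * D`.
  set q := (1 - θ) • u + θ • v with hq
  have hqt : q ∈ P.tightenedSet N z ω' := by
    intro i
    have h3 : P.con z i v + 1 / ω ≤ 0 := hv i
    have h4 : P.con z i u ≤ 0 := hu.1 i
    rw [hq, P.con_combo i u v (by ring)]
    have h5 := mul_le_mul_of_nonneg_left h3 hθ0.le
    have h6 := mul_nonpos_of_nonneg_of_nonpos (sub_nonneg.2 hθ1) h4
    have h7 : θ * (1 / ω) = 1 / ω' := by
      rw [hθ]
      field_simp
    linarith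
  have hu'f : u' ∈ P.tightenedSet N z ω' := by
    rw [← P.feasible_program hβ']
    exact hk.one_le
  have hle : P.cost z u' ≤ P.cost z q := by
    rw [← P.feasible_program hβ'] at hqt
    have := hk.min hqt
    have h3 : 0 ≤ (P.program N z ω' β').m * ‖q - u'‖ ^ 2 :=
      mul_nonneg (P.program N z ω' β').m_pos.le (sq_nonneg _)
    have h4 : (P.program N z ω' β').J u' ≤ (P.program N z ω' β').J q := by linarith
    exact h4
  have hconv : P.cost z q ≤ P.cost z u + θ * D := by
    have e1 := (P.program N z 1 1).strong q u
    have e2 := (P.program N z 1 1).strong q v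
    have f1 : u - q = -(θ • (v - u)) := by rw [hq]; module
    have f2 : v - q = (1 - θ) • (v - u) := by rw [hq]; module
    have g1 : 0 ≤ (P.program N z 1 1).m * ‖u - q‖ ^ 2 :=
      mul_nonneg (P.program N z 1 1).m_pos.le (sq_nonneg _)
    have g2 : 0 ≤ (P.program N z 1 1).m * ‖v - q‖ ^ 2 :=
      mul_nonneg (P.program N z 1 1).m_pos.le (sq_nonneg _)
    rw [f1, inner_neg_right, inner_smul_right] at e1
    rw [f2, inner_smul_right] at e2
    rw [f1] at g1
    rw [f2] at g2
    have e1' := mul_le_mul_of_nonneg_left (le_trans (le_add_of_nonneg_right g1) e1)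
      (sub_nonneg.2 hθ1)
    have e2' := mul_le_mul_of_nonneg_left (le_trans (le_add_of_nonneg_right g2) e2) hθ0.le
    change (1 - θ) * (P.cost z q + _) ≤ (1 - θ) * P.cost z u at e1'
    change θ * (P.cost z q + _) ≤ θ * P.cost z v at e2'
    rw [hD]
    linarith
  have hg := hu.growth (P.tightenedSet_subset hω'0 hu'f)
  rw [← hμ] at hg
  have h8 : μ * ‖u' - u‖ ^ 2 < μ * ε ^ 2 := by linarith
  exact lt_of_pow_lt_pow_left₀ 2 hε.le (lt_of_mul_lt_mul_left h8 hμ0.le)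

end MPCProblem

end Reap

end

/-! ### The planner -/

theorem corollary1 {nz p m cx cu cT N : ℕ} (hN : 0 < N) {Info : Type*}
    -- planner states, and the problem data determined by the privileged information
    (Z : Set (Fin nz → ℝ)) (prob : Info → MPCProblem nz p m cx cu cT)
    (ζ ω β : ℝ) (hζ : 0 < ζ) (hω : 0 < ω) (hβ : ω ≤ β)
    -- the tightening parameter is large enough for the tightened problem to be feasible
    (hne : ∀ z ∈ Z, ∀ ι, ((prob ι).tightenedSet N z ω).Nonempty)
    -- constraint qualification at the minimizer of the barrier function
    (hLICQ : ∀ z ∈ Z, ∀ ι, ∀ w : CtrlSeq N p × Dual N cx cu cT,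
      (prob ι).IsBarrierOptimal z ω β w → (prob ι).LICQ z ω w.1)
    (init : (Fin nz → ℝ) → Info → CtrlSeq N p × Dual N cx cu cT)
    (hinit : ∀ z ∈ Z, ∀ ι, (prob ι).IsFeasibleInit z ω β (init z ι)) :
    ∃ (ustar udag : (Fin nz → ℝ) → Info → CtrlSeq N p)
      (ldag : (Fin nz → ℝ) → Info → Dual N cx cu cT),
      -- `ustar` is the unique optimizer of the MPC problem
      (∀ z ∈ Z, ∀ ι, ∀ u, (prob ι).IsMPCOptimal z u ↔ u = ustar z ι) ∧
      -- `(udag, ldag)` is the unique pair (minimizer of the barrier function, optimal dual)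
      (∀ z ∈ Z, ∀ ι, ∀ w, (prob ι).IsBarrierOptimal z ω β w ↔ w = (udag z ι, ldag z ι)) ∧
      -- the flow has exactly one global solution, which converges exponentially to that pair
      -- and never leaves the constraint set
      (∀ z ∈ Z, ∀ ι, (prob ι).WellPosed z ζ ω β (init z ι)) ∧
      (∀ z ∈ Z, ∀ ι, ∃ K > 0, ∃ μ > 0, ∀ ρ, 0 ≤ ρ →
        ‖((prob ι).flow z ζ ω β (init z ι) ρ).1 - udag z ι‖ ≤ K * Real.exp (-μ * ρ) ∧
        ‖((prob ι).flow z ζ ω β (init z ι) ρ).2 - ldag z ι‖ ≤ K * Real.exp (-μ * ρ)) ∧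
      (∀ z ∈ Z, ∀ ι, ∀ ρ, 0 ≤ ρ →
        ((prob ι).flow z ζ ω β (init z ι) ρ).1 ∈ (prob ι).feasibleSet N z) ∧
      -- the planner is anytime-feasible, with the first element of `udag` as its limit
      IsAnytimeFeasiblePlanner Z (fun z ι => (prob ι).firstSet N z)
        (fun z ι => firstBlock (udag z ι)) (planner prob ζ ω β init) ∧
      -- this limit is the first element of `ustar` if `ustar` meets the tightened constraints
      (∀ z ∈ Z, ∀ ι, ustar z ι ∈ (prob ι).tightenedSet N z ω → udag z ι = ustar z ι) ∧
      -- and in general it is the first element of `ustar` up to an error that vanishes as the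
      -- tightening parameter tends to infinity
      (∀ z ∈ Z, ∀ ι, ∀ ε > 0, ∃ ω₀ > 0, ∀ ω' ≥ ω₀, ∀ β' ≥ ω',
        ∀ init' : (Fin nz → ℝ) → Info → CtrlSeq N p × Dual N cx cu cT,
          (prob ι).IsFeasibleInit z ω' β' (init' z ι) →
          (prob ι).WellPosed z ζ ω' β' (init' z ι) ∧
          ∀ᶠ t in atTop,
            ‖planner prob ζ ω' β' init' t z ι - firstBlock (ustar z ι)‖ < ε) := by
  have hβ0 : 0 < β := hω.trans_le hβ
  have hex₁ : ∀ (z : Fin nz → ℝ) (ι : Info), ∃ u, z ∈ Z → ∀ v : CtrlSeq N p,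
      (prob ι).IsMPCOptimal z v ↔ v = u := fun z ι => by
    by_cases hz : z ∈ Z
    · obtain ⟨u, hu⟩ := (prob ι).existsUnique_isMPCOptimal
        ((hne z hz ι).mono ((prob ι).tightenedSet_subset hω))
      -- Inside `Z` the true optimizer is chosen; outside, where nothing is claimed, the value is an
      -- arbitrary zero. The same applies to the barrier pair below.
      exact ⟨u, fun _ => hu⟩
    · exact ⟨0, fun h => absurd h hz⟩
  have hex₂ : ∀ (z : Fin nz → ℝ) (ι : Info), ∃ w, z ∈ Z →
      ∀ w' : CtrlSeq N p × Dual N cx cu cT, (prob ι).IsBarrierOptimal z ω β w' ↔ w' = w :=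
    fun z ι => by
      by_cases hz : z ∈ Z
      · obtain ⟨w, hw⟩ := (prob ι).existsUnique_isBarrierOptimal hβ0 (hne z hz ι) (hLICQ z hz ι)
        exact ⟨w, fun _ => hw⟩
      · exact ⟨0, fun h => absurd h hz⟩
  choose ustar hustar using hex₁
  choose wdag hwdag using hex₂
  have hopt : ∀ z ∈ Z, ∀ ι, (prob ι).IsMPCOptimal z (ustar z ι) := fun z hz ι =>
    (hustar z ι hz _).2 rfl
  have hbar : ∀ z ∈ Z, ∀ ι, (prob ι).IsBarrierOptimal z ω β (wdag z ι) := fun z hz ι =>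
    (hwdag z ι hz _).2 rfl
  have hwp : ∀ z ∈ Z, ∀ ι, (prob ι).WellPosed z ζ ω β (init z ι) := fun z hz ι =>
    (prob ι).wellPosed hζ hβ0 (hne z hz ι) (hinit z hz ι)
  have hmem : ∀ z ∈ Z, ∀ ι, ∀ ρ, 0 ≤ ρ →
      ((prob ι).flow z ζ ω β (init z ι) ρ).1 ∈ (prob ι).feasibleSet N z := fun z hz ι ρ hρ =>
    (prob ι).barrierDomain_subset hω hβ ((hwp z hz ι).isFlow.mem_domain ρ hρ)
  refine ⟨ustar, fun z ι => (wdag z ι).1, fun z ι => (wdag z ι).2, fun z hz ι => hustar z ι hz,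
    fun z hz ι => hwdag z ι hz, hwp, fun z hz ι => ?_, hmem, ⟨fun t ht z hz ι => ?_,
    fun z hz ι => ?_⟩, fun z hz ι hu => ?_, fun z hz ι ε hε => ?_⟩
  · exact (prob ι).flow_exp_bound hζ hβ0 (hne z hz ι) (hinit z hz ι) (hbar z hz ι)
      (hLICQ z hz ι _ (hbar z hz ι))
  · exact mem_image_of_mem _ (hmem z hz ι t ht)
  · have h1 := (prob ι).tendsto_flow hζ hβ0 (hne z hz ι) (hinit z hz ι)
      ((prob ι).isBarrierOptimal_iff.1 (hbar z hz ι))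
    rw [tendsto_iff_norm_sub_tendsto_zero] at h1 ⊢
    exact squeeze_zero (fun _ => norm_nonneg _) (fun t => norm_firstBlock_sub_le hN _ _) h1
  · have hk := (prob ι).isBarrierOptimal_iff.1 (hbar z hz ι)
    have h1 : (wdag z ι).1 ∈ (prob ι).tightenedSet N z ω := by
      rw [← (prob ι).feasible_program hβ0]
      exact hk.one_le
    -- The point `𝐮†` minimizes the cost over `𝕌_ω`. If `𝐮*` lies in that set, `𝐮†` costs no more
    -- than `𝐮*` and is thus optimal over `𝕌`; uniqueness identifies the two.
    refine (hustar z ι hz _).1 ⟨(prob ι).tightenedSet_subset hω h1, fun v hv => ?_⟩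
    rw [← (prob ι).feasible_program hβ0] at hu
    have h2 := hk.min hu
    have h3 : 0 ≤ ((prob ι).program N z ω β).m * ‖ustar z ι - (wdag z ι).1‖ ^ 2 :=
      mul_nonneg ((prob ι).program N z ω β).m_pos.le (sq_nonneg _)
    have h4 : ((prob ι).program N z ω β).J (wdag z ι).1 ≤
        ((prob ι).program N z ω β).J (ustar z ι) := by linarith
    exact le_trans h4 ((hopt z hz ι).2 v hv)
  · obtain ⟨v, hv⟩ := hne z hz ι
    obtain ⟨ω₀, hω₀, h⟩ := (prob ι).exists_tightening (hopt z hz ι) hω hv (half_pos hε)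
    refine ⟨ω₀, hω.trans_le hω₀, fun ω' hω' β' hβ' init' hinit' => ?_⟩
    have hω'0 : 0 < ω' := (hω.trans_le hω₀).trans_le hω'
    have hβ'0 : 0 < β' := hω'0.trans_le hβ'
    have hne' : ((prob ι).tightenedSet N z ω').Nonempty :=
      ⟨v, (prob ι).tightenedSet_mono hω (hω₀.trans hω') hv⟩
    refine ⟨(prob ι).wellPosed hζ hβ'0 hne' hinit', ?_⟩
    have hne'' := hne'
    rw [← (prob ι).feasible_program hβ'0] at hne''
    obtain ⟨u', k, hk⟩ := ((prob ι).program N z ω' β').exists_isKKT hne''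
    -- The error splits into the tightening error of the new KKT point, below `ε / 2` for every
    -- `β'`, and the distance of the flow to that point, eventually below `ε / 2`.
    have h1 := h ω' hω' β' hβ'0 u' k hk
    have h2 := (prob ι).tendsto_flow hζ hβ'0 hne' hinit' hk
    filter_upwards [h2.eventually (Metric.ball_mem_nhds u' (half_pos hε))] with t ht
    have ht' : ‖((prob ι).flow z ζ ω' β' (init' z ι) t).1 - u'‖ < ε / 2 := by
      rw [← dist_eq_norm]
      exact ht
    refine (norm_firstBlock_sub_le hN _ _).trans_lt ?_
    calc _ ≤ _ := norm_sub_le_norm_sub_add_norm_sub _ u' _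
      _ < ε / 2 + ε / 2 := add_lt_add ht' h1
      _ = ε := add_halves ε
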